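/- Let $V, V^\vee$ be finite-dimensional real vector spaces in perfect duality $(\ ,\ )$, and let $\Phi=(V,R,V^\vee,R^\vee)$ be a reduced root system (not necessarily crystallographic, and with $R$ not necessarily spanning $V$): $R\subset V\setminus\{0\}$ and $R^\vee\subset V^\vee\setminus\{0\}$ are finite, with a bijection $\alpha\leftrightarrow\alpha^\vee$ such that $(\alpha,\alpha^\vee)=2$, the reflections $s_\alpha(v)=v-(v,\alpha^\vee)\alpha$ and $s_\alpha(v')=v'-(\alpha,v')\alpha^\vee$ preserve $R$ and $R^\vee$ respectively, and $\mathbb R\alpha\cap R=\{\pm\alpha\}$ for all $\alpha\in R$. Let $W$ be the group generated by the reflections $s_\alpha$, $\alpha\in R$, let $\Pi\subset R$ be a set of simple roots, and let $k:\Pi\to\mathbb R\setminus\{0\}$ be a function with $k_\alpha=k_\beta$ whenever $\alpha,\beta\in\Pi$ are $W$-conjugate. Let $\mathbb H$ be the graded affine Hecke algebra of $(\Phi,\Pi,k)$: the associative unital $\mathbb C$-algebra generated by the algebra $\mathbb A=S(V_{\mathbb C})$ and the group algebra $\mathbb C[W]=\operatorname{span}\{t_w:w\in W\}$ subject to the relations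 $$a\,t_{s_\alpha}=t_{s_\alpha}\,s_\alpha(a)+k_\alpha\,\frac{a-s_\alpha(a)}{\alpha}\qquad(\alpha\in\Pi,\ a\in S(V_{\mathbb C})).$$ For a simple $\mathbb H$-module $X$ (necessarily finite-dimensional) and $\lambda\in V^\vee_{\mathbb C}$, let $X_\lambda$ be the set of $x\in X$ such that for every $a\in\mathbb A$ one has $(a-a(\lambda))^n x=0$ for some $n$, where $a(\lambda)$ is the value of $a$ at $\lambda$, and let the $\mathbb A$-character of $X$ be the formal sum $$\Theta_{\mathbb A}(X)=\sum_{\lambda\in V^\vee_{\mathbb C}}(\dim X_\lambda)\,e^\lambda .$$ Then the $\mathbb A$-characters $\Theta_{\mathbb A}(X)$, where $X$ ranges over the isomorphism classes of simple $\mathbb H$-modules, are $\mathbb Z$-linearly independent: for every family of pairwise non-isomorphic simple $\mathbb H$-modules, the family of their $\mathbb A$-characters is linearly independent over $\mathbb Z$. -/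

import Mathlib

open scoped TensorProduct

noncomputable section

namespace GradedHecke

variable {ι V V' : Type*} [AddCommGroup V] [Module ℝ V] [AddCommGroup V'] [Module ℝ V']

/-- `B` (a finite set of indices of roots) is a choice of simple roots: these roots are linearly
independent, and every root is a combination of them with real coefficients that are either all
nonnegative or all nonpositive.  (The root pairing need not be crystallographic, so that integer
coefficients cannot be asked for.) -/
structure IsSimpleRoots (P : RootPairing ι ℝ V V') (B : Finset ι) : Prop where
  linearIndepOn : LinearIndepOn ℝ P.root (B : Set ι)
  nonneg_or_nonpos : ∀ i, ∃ c : ι → ℝ,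
    ((∀ j ∈ B, 0 ≤ c j) ∨ (∀ j ∈ B, c j ≤ 0)) ∧ P.root i = ∑ j ∈ B, c j • P.root j

/-- `k_α = k_β` whenever the simple roots `α`, `β` are conjugate under the Weyl group. -/
def IsInvariantParameter (P : RootPairing ι ℝ V V') (B : Finset ι) (k : B → ℝ) : Prop :=
  ∀ i j : B, (∃ w : P.weylGroup, w • P.root i = P.root j) → k i = k j

variable (V) in
/-- The algebra `A = S(V_ℂ)`, where `V_ℂ = ℂ ⊗ V`. -/
abbrev SymA : Type _ := SymmetricAlgebra ℂ (ℂ ⊗[ℝ] V)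

/-- The inclusion of `V` in `S(V_ℂ)`. -/
def ofV (v : V) : SymA V := SymmetricAlgebra.ι ℂ (ℂ ⊗[ℝ] V) (1 ⊗ₜ[ℝ] v)

/-- The automorphism of `S(V_ℂ)` that extends the reflection `s_α` of `V`. -/
def refl (P : RootPairing ι ℝ V V') (i : ι) : SymA V →ₐ[ℂ] SymA V :=
  SymmetricAlgebra.lift
    (SymmetricAlgebra.ι ℂ (ℂ ⊗[ℝ] V) ∘ₗ (P.reflection i).toLinearMap.baseChange ℂ)

/-- The difference `a - s_α(a)` is divisible by `α` in `S(V_ℂ)`. -/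
theorem exists_diffOp (P : RootPairing ι ℝ V V') (i : ι) (a : SymA V) :
    ∃ b : SymA V, ofV (P.root i) * b = a - refl P i a := by
  induction a using SymmetricAlgebra.induction with
  | algebraMap r => exact ⟨0, by simp⟩
  | ι x =>
    induction x using TensorProduct.induction_on with
    | zero => exact ⟨0, by simp⟩
    | tmul c v =>
      refine ⟨algebraMap ℂ (SymA V) (c * (P.toLinearMap v (P.coroot i) : ℂ)), ?_⟩
      rw [mul_comm, ← Algebra.smul_def]
      simp only [refl, ofV, SymmetricAlgebra.lift_ι_apply, LinearMap.comp_apply,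
        LinearMap.baseChange_tmul, ← map_sub, ← map_smul]
      congr 1
      rw [LinearEquiv.coe_coe, RootPairing.reflection_apply, ← TensorProduct.tmul_sub,
        sub_sub_cancel, TensorProduct.smul_tmul', TensorProduct.tmul_smul,
        TensorProduct.smul_tmul']
      congr 1
      simp [mul_comm]
    | add x y hx hy =>
      obtain ⟨b, hb⟩ := hx
      obtain ⟨c, hc⟩ := hy
      exact ⟨b + c, by rw [mul_add, hb, hc, map_add, map_add]; ring⟩
  | mul x y hx hy =>
    obtain ⟨b, hb⟩ := hx
    obtain ⟨c, hc⟩ := hy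
    refine ⟨b * y + refl P i x * c, ?_⟩
    rw [mul_add, ← mul_assoc, hb, mul_left_comm, hc, map_mul]
    ring
  | add x y hx hy =>
    obtain ⟨b, hb⟩ := hx
    obtain ⟨c, hc⟩ := hy
    exact ⟨b + c, by rw [mul_add, hb, hc, map_add]; ring⟩

/-- The difference operator `Δ_α(a) = (a - s_α(a)) / α`. -/
def diffOp (P : RootPairing ι ℝ V V') (i : ι) (a : SymA V) : SymA V :=
  (exists_diffOp P i a).choose

theorem root_mul_diffOp (P : RootPairing ι ℝ V V') (i : ι) (a : SymA V) :
    ofV (P.root i) * diffOp P i a = a - refl P i a :=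
  (exists_diffOp P i a).choose_spec

/-- The quotient `(a - s_α(a)) / α` is unique. -/
theorem eq_diffOp (P : RootPairing ι ℝ V V') (i : ι) (a b : SymA V)
    (h : ofV (P.root i) * b = a - refl P i a) : b = diffOp P i a := by
  refine mul_left_cancel₀ (fun h0 => ?_) (h.trans (root_mul_diffOp P i a).symm)
  have h1 := congrArg (SymmetricAlgebra.lift (LinearMap.liftBaseChange ℂ
    (Complex.ofRealLI.toLinearMap ∘ₗ P.toLinearMap.flip (P.coroot i)))) h0
  simp [ofV, P.root_coroot_two] at h1

/-- The free algebra on symbols `t_w`, `w ∈ W`, and `a ∈ S(V_ℂ)`. -/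
abbrev Free (P : RootPairing ι ℝ V V') : Type _ := FreeAlgebra ℂ (P.weylGroup ⊕ SymA V)

/-- The symbol `t_w`. -/
abbrev symT (P : RootPairing ι ℝ V V') (w : P.weylGroup) : Free P := FreeAlgebra.ι ℂ (Sum.inl w)

/-- The symbol of `a ∈ S(V_ℂ)`. -/
abbrev symA (P : RootPairing ι ℝ V V') (a : SymA V) : Free P := FreeAlgebra.ι ℂ (Sum.inr a)

/-- The defining relations of the graded affine Hecke algebra: `w ↦ t_w` is multiplicative,
`S(V_ℂ)` embeds by an algebra homomorphism, and
`a t_{s_α} = t_{s_α} s_α(a) + k_α Δ_α(a)` for all `α ∈ B` and `a ∈ S(V_ℂ)`. -/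
inductive Rel (P : RootPairing ι ℝ V V') (B : Finset ι) (k : B → ℝ) : Free P → Free P → Prop
  | t_one : Rel P B k (symT P 1) 1
  | t_mul (w w' : P.weylGroup) : Rel P B k (symT P (w * w')) (symT P w * symT P w')
  | a_algebraMap (c : ℂ) : Rel P B k (symA P (algebraMap ℂ (SymA V) c)) (algebraMap ℂ (Free P) c)
  | a_add (a b : SymA V) : Rel P B k (symA P (a + b)) (symA P a + symA P b)
  | a_mul (a b : SymA V) : Rel P B k (symA P (a * b)) (symA P a * symA P b)
  | cross (i : B) (a : SymA V) :
      Rel P B k (symA P a * symT P (RootPairing.weylGroup.ofIdx P i))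
        (symT P (RootPairing.weylGroup.ofIdx P i) * symA P (refl P i a)
          + algebraMap ℂ (Free P) (k i : ℂ) * symA P (diffOp P i a))

end GradedHecke

open GradedHecke

variable {ι V V' : Type*} [AddCommGroup V] [Module ℝ V] [AddCommGroup V'] [Module ℝ V']

/-- The graded affine Hecke algebra `H(Φ, k)`: the associative unital `ℂ`-algebra generated by
`S(V_ℂ)` and the `t_w`, `w ∈ W`, subject to the relations `GradedHecke.Rel`. By the
Poincaré–Birkhoff–Witt theorem for graded Hecke algebras it is `ℂ[W] ⊗ S(V_ℂ)` as a bimodule. -/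
def GradedHecke (P : RootPairing ι ℝ V V') (B : Finset ι) (k : B → ℝ) : Type _ :=
  RingQuot (GradedHecke.Rel P B k)

namespace GradedHecke

instance (P : RootPairing ι ℝ V V') (B : Finset ι) (k : B → ℝ) : Ring (GradedHecke P B k) :=
  inferInstanceAs (Ring (RingQuot (GradedHecke.Rel P B k)))

instance (P : RootPairing ι ℝ V V') (B : Finset ι) (k : B → ℝ) : Algebra ℂ (GradedHecke P B k) :=
  inferInstanceAs (Algebra ℂ (RingQuot (GradedHecke.Rel P B k)))

/-- The quotient map from the free algebra. -/
def mk (P : RootPairing ι ℝ V V') (B : Finset ι) (k : B → ℝ) : Free P →ₐ[ℂ] GradedHecke P B k :=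
  RingQuot.mkAlgHom ℂ (GradedHecke.Rel P B k)

/-- The group homomorphism `w ↦ t_w`. -/
def t (P : RootPairing ι ℝ V V') (B : Finset ι) (k : B → ℝ) :
    P.weylGroup →* GradedHecke P B k where
  toFun w := mk P B k (symT P w)
  map_one' := (RingQuot.mkAlgHom_rel ℂ (Rel.t_one (P := P) (B := B) (k := k))).trans
    (map_one (mk P B k))
  map_mul' w w' := (RingQuot.mkAlgHom_rel ℂ (Rel.t_mul (P := P) (B := B) (k := k) w w')).trans
    (map_mul (mk P B k) _ _)

/-- The algebra homomorphism from `A = S(V_ℂ)` to `H`. -/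
def ofA (P : RootPairing ι ℝ V V') (B : Finset ι) (k : B → ℝ) :
    SymA V →ₐ[ℂ] GradedHecke P B k :=
  AlgHom.ofLinearMap
    { toFun := fun a => mk P B k (symA P a)
      map_add' := fun a b =>
        (RingQuot.mkAlgHom_rel ℂ (Rel.a_add (P := P) (B := B) (k := k) a b)).trans
          (map_add (mk P B k) _ _)
      map_smul' := fun c a => by
        rw [Algebra.smul_def]
        refine (RingQuot.mkAlgHom_rel ℂ (Rel.a_mul (P := P) (B := B) (k := k) _ a)).trans ?_
        rw [map_mul, RingQuot.mkAlgHom_rel ℂ (Rel.a_algebraMap (P := P) (B := B) (k := k) c),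
          AlgHom.commutes, ← Algebra.smul_def]
        rfl }
    (by
      have h := RingQuot.mkAlgHom_rel ℂ (Rel.a_algebraMap (P := P) (B := B) (k := k) 1)
      rw [map_one, map_one, map_one] at h
      exact h)
    (fun a b =>
      (RingQuot.mkAlgHom_rel ℂ (Rel.a_mul (P := P) (B := B) (k := k) a b)).trans
        (map_mul (mk P B k) _ _))

theorem ofA_mul_t (P : RootPairing ι ℝ V V') (B : Finset ι) (k : B → ℝ) (i : B) (a : SymA V) :
    ofA P B k a * t P B k (RootPairing.weylGroup.ofIdx P i) =
      t P B k (RootPairing.weylGroup.ofIdx P i) * ofA P B k (refl P i a)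
        + (k i : ℂ) • ofA P B k (diffOp P i a) := by
  have h : mk P B k _ = mk P B k _ :=
    RingQuot.mkAlgHom_rel ℂ (Rel.cross (P := P) (B := B) (k := k) i a)
  rw [map_mul, map_add, map_mul, map_mul, AlgHom.commutes, ← Algebra.smul_def] at h
  exact h

/-- The complexified pairing `V_ℂ × V'_ℂ → ℂ`, as a map from `V'_ℂ` to the dual of `V_ℂ`. -/
def pairC (P : RootPairing ι ℝ V V') : (ℂ ⊗[ℝ] V') →ₗ[ℂ] (ℂ ⊗[ℝ] V) →ₗ[ℂ] ℂ :=
  LinearMap.liftBaseChange ℂ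
    { toFun := fun u =>
        LinearMap.liftBaseChange ℂ (Complex.ofRealLI.toLinearMap ∘ₗ P.toLinearMap.flip u)
      map_add' := fun u u' => by
        ext v
        simp
      map_smul' := fun r u => by
        ext v
        simp }

theorem pairC_tmul (P : RootPairing ι ℝ V V') (c d : ℂ) (u : V') (v : V) :
    pairC P (c ⊗ₜ[ℝ] u) (d ⊗ₜ[ℝ] v) = c * d * (P.toLinearMap v u : ℂ) := by
  simp [pairC, mul_assoc]

/-- The value `(a, lam)` of `a ∈ S(V_ℂ)` at `lam ∈ V'_ℂ`. -/
def evalA (P : RootPairing ι ℝ V V') (lam : ℂ ⊗[ℝ] V') : SymA V →ₐ[ℂ] ℂ :=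
  SymmetricAlgebra.lift (pairC P lam)

section Modules

variable (P : RootPairing ι ℝ V V') (B : Finset ι) (k : B → ℝ)
variable (X : Type*) [AddCommGroup X] [Module ℂ X] [Module (GradedHecke P B k) X]
  [IsScalarTower ℂ (GradedHecke P B k) X]

/-- The generalized weight space `X_lam`: all `x` such that for every `a ∈ S(V_ℂ)` some power of
`a - (a, lam)` kills `x`. -/
def weightSpace (lam : ℂ ⊗[ℝ] V') : Submodule ℂ X :=
  ⨅ a : SymA V,
    (Algebra.lsmul ℂ ℂ X (ofA P B k a)).maxGenEigenspace (evalA P lam a)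

theorem mem_weightSpace (lam : ℂ ⊗[ℝ] V') (x : X) :
    x ∈ weightSpace P B k X lam ↔
      ∀ a : SymA V, ∃ n : ℕ,
        (ofA P B k a - algebraMap ℂ (GradedHecke P B k) (evalA P lam a)) ^ n • x = 0 := by
  have key : ∀ (h : GradedHecke P B k) (c : ℂ) (n : ℕ),
      ((Algebra.lsmul ℂ ℂ X h - c • (1 : Module.End ℂ X)) ^ n) x =
        (h - algebraMap ℂ (GradedHecke P B k) c) ^ n • x := by
    intro h c n
    have : Algebra.lsmul ℂ ℂ X h - c • (1 : Module.End ℂ X) =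
        Algebra.lsmul ℂ ℂ X (h - algebraMap ℂ (GradedHecke P B k) c) := by
      rw [map_sub, AlgHom.commutes, Algebra.algebraMap_eq_smul_one]
    rw [this, ← map_pow, Algebra.lsmul_coe]
  simp only [weightSpace, Submodule.mem_iInf, Module.End.mem_maxGenEigenspace, key]

/-- The `A`-character `Θ_A(X) = ∑ (dim X_lam) e^lam`, a formal sum with integer coefficients,
i.e. the function `lam ↦ dim X_lam`.  It is applied to simple modules only; these are
finite-dimensional, since `H` is a finite module over the central subalgebra `S(V_ℂ)^W`. -/
def character : (ℂ ⊗[ℝ] V') → ℤ :=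
  fun lam => (Module.finrank ℂ (weightSpace P B k X lam) : ℤ)

end Modules

end GradedHecke

end

/-! Characters of non-isomorphic irreducible representations are linearly independent
(`linearIndependent_repChar`). So it is enough to show that a relation between `A`-characters is
already a relation between traces on the whole algebra. The trace of `a ∈ A` on `X` is the sum of
`dim X_λ · a(λ)`. Hence the relation says that a combination `τ` of irreducible characters vanishes
on `A`, and `eq_zero_of_comp_aM` shows that such a `τ` is zero.

This is proved for every parabolic algebra `H_M`, `M ⊆ B`, by induction on `M`. The pullback of `τ`
to `H_N`, for `N` properly contained in `M`, is again a combination of irreducible characters, hence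
zero. It remains to treat `τ = ∑ c_j tr X_j` with pairwise non-isomorphic `X_j` and all `c_j ≠ 0`,
when `τ` dies on all these `H_N`.

The first claim is that all weights of all `X_j` vanish on the span of the roots in `M`; it follows
from `weight_nonpos`. Otherwise some real functional of some weight is positive at a dominant
vector. Choose the weight and the dominant unit vector `ω` that make this value largest. Let `z` be
the value of that weight at `ω`, and `N` the set of simple roots in `M` orthogonal to `ω`, which is
a proper subset. Since `ω` is central in `H_N`, its generalized `z`-eigenspace `E_j` in `X_j` is an
`H_N`-module. By maximality, a weight with value `z` at `ω` has another value at `u⁻¹ω` for every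
nontrivial minimal coset representative `u` (`lt_of_maximal`). Therefore an `H_N`-submodule of `E_j`
generates an `H_M`-submodule that meets `E_j` in nothing more (`mem_of_mem_span`). So `E_j` is
irreducible or zero, and a nonzero `E_j` determines `X_j`. One polynomial in `ω` projects onto all
`E_j`, so the vanishing of `τ` on `H_N` is a nontrivial relation between the characters of the
nonzero `E_j`, which is impossible.

The second claim, where `k ≠ 0` enters, is that an irreducible module is determined by a weight that
vanishes on the roots (`repIso_of_weight`). If `x` is a weight vector, the vectors `t_w x` are
independent: a regular dominant vector applied `ℓ(w)` times to `t_w x` gives a nonzero multiple of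
`x`. Nothing cancels, because all contributions have the sign prescribed by a character of `W` that
records the signs of the parameters. Thus each `X_j` has exactly one weight, these weights are
distinct, and the independence of distinct characters of the algebra `A` contradicts `c_j ≠ 0`.

The parabolic algebras are given by generators and relations and compared by homomorphisms whose
injectivity is never needed; the given algebra is only used as a quotient of `H_B`. -/

set_option linter.unusedSectionVars false

noncomputable section

namespace GradedHecke

universe u

/-! ### Finite-dimensional representations and their characters -/

section Representations

variable {H : Type*} [Ring H] [Algebra ℂ H]
variable {X : Type u} [AddCommGroup X] [Module ℂ X]
variable {Y : Type u} [AddCommGroup Y] [Module ℂ Y]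

/-- The trace of an endomorphism that preserves a subspace is the sum of the traces on the subspace
and on the quotient. -/
theorem trace_eq_trace_restrict_add_trace_mapQ [FiniteDimensional ℂ X] (U : Submodule ℂ X)
    (f : Module.End ℂ X) (hf : ∀ x ∈ U, f x ∈ U) :
    LinearMap.trace ℂ X f = LinearMap.trace ℂ U (f.restrict hf) +
      LinearMap.trace ℂ (X ⧸ U) (U.mapQ U f hf) := by
  obtain ⟨C, hC⟩ := U.exists_isCompl
  set p : Module.End ℂ X := U.projection C hC with hp
  set q : Module.End ℂ X := C.projection U hC.symm with hq
  have hpq : ∀ x, p x + q x = x := fun x => by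
    have := Submodule.projection_add_projection_eq_self hC x
    simpa [hp, hq] using this
  have hpU : ∀ x, p x ∈ U := fun x => Submodule.projection_apply_mem hC x
  have hqC : ∀ x, q x ∈ C := fun x => Submodule.projection_apply_mem hC.symm x
  have hpid : ∀ x ∈ U, p x = x := fun x hx => Submodule.projection_apply_left hC ⟨x, hx⟩
  have hsum : f = f * p + f * q := by
    ext x
    simp [← map_add, hpq]
  have h1 : LinearMap.trace ℂ X (f * p) = LinearMap.trace ℂ U (f.restrict hf) := by
    rw [← LinearMap.trace_restrict_eq_of_forall_mem U (f * p) (fun x => hf _ (hpU x))]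
    congr 1
    ext ⟨x, hx⟩
    rw [LinearMap.coe_restrict_apply, LinearMap.coe_restrict_apply, Module.End.mul_apply,
      hpid x hx]
  have h2 : LinearMap.trace ℂ X (f * q) = LinearMap.trace ℂ (X ⧸ U) (U.mapQ U f hf) := by
    rw [LinearMap.trace_mul_comm,
      ← LinearMap.trace_restrict_eq_of_forall_mem C (q * f) (fun x => hqC _),
      ← LinearMap.trace_conj' (U.mapQ U f hf) (Submodule.quotientEquivOfIsCompl U C hC)]
    congr 1
  conv_lhs => rw [hsum]
  rw [map_add, h1, h2]

/-- A subspace stable under a representation. -/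
def RepInv (ρ : H →ₐ[ℂ] Module.End ℂ X) (U : Submodule ℂ X) : Prop := ∀ h, ∀ x ∈ U, ρ h x ∈ U

/-- The representation on a stable subspace. -/
def subRep (ρ : H →ₐ[ℂ] Module.End ℂ X) (U : Submodule ℂ X) (hU : RepInv ρ U) :
    H →ₐ[ℂ] Module.End ℂ U :=
  AlgHom.ofLinearMap
    { toFun := fun h => (ρ h).restrict (hU h)
      map_add' := fun a b => by ext; simp
      map_smul' := fun a b => by ext; simp }
    (by ext; simp) (fun a b => by ext; simp)

@[simp] theorem subRep_apply_coe (ρ : H →ₐ[ℂ] Module.End ℂ X) (U : Submodule ℂ X)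
    (hU : RepInv ρ U) (h : H) (x : U) : (subRep ρ U hU h x : X) = ρ h x := rfl

/-- The representation on the quotient by a stable subspace. -/
def quotRep (ρ : H →ₐ[ℂ] Module.End ℂ X) (U : Submodule ℂ X) (hU : RepInv ρ U) :
    H →ₐ[ℂ] Module.End ℂ (X ⧸ U) :=
  AlgHom.ofLinearMap
    { toFun := fun h => U.mapQ U (ρ h) (hU h)
      map_add' := fun a b => by ext; simp
      map_smul' := fun a b => by ext; simp }
    (by ext; simp) (fun a b => by ext; simp)

/-- Irreducibility. -/
structure IsIrrRep (ρ : H →ₐ[ℂ] Module.End ℂ X) : Prop where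
  nontrivial : Nontrivial X
  eq_bot_or_top : ∀ U, RepInv ρ U → U = ⊥ ∨ U = ⊤

/-- The character of a representation. -/
def repChar (ρ : H →ₐ[ℂ] Module.End ℂ X) : H →ₗ[ℂ] ℂ := LinearMap.trace ℂ X ∘ₗ ρ.toLinearMap

theorem repChar_apply (ρ : H →ₐ[ℂ] Module.End ℂ X) (h : H) :
    repChar ρ h = LinearMap.trace ℂ X (ρ h) := rfl

theorem repChar_eq_add [FiniteDimensional ℂ X] (ρ : H →ₐ[ℂ] Module.End ℂ X) (U : Submodule ℂ X)
    (hU : RepInv ρ U) : repChar ρ = repChar (subRep ρ U hU) + repChar (quotRep ρ U hU) := by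
  ext h
  exact trace_eq_trace_restrict_add_trace_mapQ U (ρ h) (hU h)

/-- Isomorphism of representations. -/
def RepIso (ρ : H →ₐ[ℂ] Module.End ℂ X) (ρ' : H →ₐ[ℂ] Module.End ℂ Y) : Prop :=
  ∃ e : X ≃ₗ[ℂ] Y, ∀ h x, e (ρ h x) = ρ' h (e x)

theorem RepIso.repChar_eq {ρ : H →ₐ[ℂ] Module.End ℂ X} {ρ' : H →ₐ[ℂ] Module.End ℂ Y}
    (h : RepIso ρ ρ') : repChar ρ = repChar ρ' := by
  obtain ⟨e, he⟩ := h
  ext a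
  rw [repChar_apply, repChar_apply, ← LinearMap.trace_conj' (ρ a) e]
  congr 1
  ext y
  simp [LinearEquiv.conj_apply, he]

variable (H) in
/-- The characters of the irreducible finite-dimensional representations. -/
def irrChars : Set (H →ₗ[ℂ] ℂ) :=
  {f | ∃ (X : Type u) (_ : AddCommGroup X) (_ : Module ℂ X) (_ : FiniteDimensional ℂ X)
    (ρ : H →ₐ[ℂ] Module.End ℂ X), IsIrrRep ρ ∧ repChar ρ = f}

/-- A proper stable subspace splits the character into two characters of smaller degree.
Irreducibility is usually lost under restriction to a parabolic algebra; membership in this span is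
what survives. -/
theorem repChar_mem_span [FiniteDimensional ℂ X] (ρ : H →ₐ[ℂ] Module.End ℂ X) :
    repChar ρ ∈ Submodule.span ℂ (irrChars.{u} H) := by
  generalize hn : Module.finrank ℂ X = n
  induction n using Nat.strong_induction_on generalizing X with
  | _ n ih =>
    by_cases hX : Nontrivial X
    · by_cases hirr : ∀ U, RepInv ρ U → U = ⊥ ∨ U = ⊤
      · exact Submodule.subset_span ⟨X, _, _, inferInstance, ρ, ⟨hX, hirr⟩, rfl⟩
      · push Not at hirr
        obtain ⟨U, hU, hb, ht⟩ := hirr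
        rw [repChar_eq_add ρ U hU]
        have h1 : Module.finrank ℂ U < n := hn ▸ Submodule.finrank_lt ht
        have h2 : Module.finrank ℂ (X ⧸ U) < n := by
          have := U.finrank_quotient_add_finrank
          have h3 : 0 < Module.finrank ℂ U := by
            rw [Module.finrank_pos_iff]
            exact Submodule.nontrivial_iff_ne_bot.mpr hb
          omega
        exact add_mem (ih _ h1 _ rfl) (ih _ h2 _ rfl)
    · rw [not_nontrivial_iff_subsingleton] at hX
      have : repChar ρ = 0 := by
        ext h
        rw [repChar_apply, Subsingleton.elim (ρ h) 0, map_zero]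
        rfl
      rw [this]
      exact zero_mem _

end Representations

/-! ### Jacobson density for non-isomorphic simple modules -/

section Density

variable {H : Type*} [Ring H]

/-- For pairwise non-isomorphic simple modules some ring element acts on given vectors as the
projection to one of the modules. -/
theorem exists_smul_eq_proj {J : Type*} [Finite J] [DecidableEq J] (X : J → Type*)
    [∀ j, AddCommGroup (X j)] [∀ j, Module H (X j)] [∀ j, IsSimpleModule H (X j)]
    (hiso : ∀ i j, Nonempty (X i ≃ₗ[H] X j) → i = j) (j : J) (s : Finset (∀ j, X j)) :
    ∃ r : H, ∀ x ∈ s, r • x = Pi.single j (x j) := by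
  have : IsSemisimpleModule H (∀ j, X j) := inferInstance
  -- By Schur's lemma an endomorphism of the product has no components between different factors. So
  -- it commutes with the projection to a factor, and density applies to that projection.
  have key : ∀ (g : Module.End H (∀ j, X j)) (x : ∀ j, X j) (i : J),
      g x i = g (Pi.single i (x i)) i := by
    intro g x i
    cases nonempty_fintype J
    conv_lhs => rw [← Finset.univ_sum_single x, map_sum, Finset.sum_apply]
    rw [Finset.sum_eq_single i]
    · intro l _ hl
      have h0 : LinearMap.proj i ∘ₗ g ∘ₗ LinearMap.single H X l = 0 := by
        by_contra hne
        exact hl (hiso l i ⟨LinearEquiv.ofBijective _ (LinearMap.bijective_of_ne_zero hne)⟩)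
      exact LinearMap.congr_fun h0 (x l)
    · simp
  let f : Module.End (Module.End H (∀ j, X j)) (∀ j, X j) :=
    { toFun := fun x => Pi.single j (x j)
      map_add' := fun x y => by rw [Pi.add_apply, Pi.single_add]
      map_smul' := fun g x => by
        ext i
        simp only [RingHom.id_apply, Module.End.smul_def]
        by_cases hi : i = j
        · subst hi
          rw [Pi.single_eq_same, key]
        · rw [Pi.single_eq_of_ne hi, key, Pi.single_eq_of_ne hi, Pi.single_zero, map_zero]
          rfl }
  obtain ⟨r, hr⟩ := jacobson_density f s
  exact ⟨r, fun x hx => (hr x hx).symm⟩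

end Density

/-! ### Linear independence of irreducible characters -/

section LinearIndependence

variable {H : Type*} [Ring H] [Algebra ℂ H]

/-- A type synonym: the module of a representation. -/
def RepMod {X : Type u} [AddCommGroup X] [Module ℂ X] (_ : H →ₐ[ℂ] Module.End ℂ X) : Type u := X

variable {X : Type u} [AddCommGroup X] [Module ℂ X] {Y : Type u} [AddCommGroup Y] [Module ℂ Y]

instance (ρ : H →ₐ[ℂ] Module.End ℂ X) : AddCommGroup (RepMod ρ) := inferInstanceAs (AddCommGroup X)

instance (ρ : H →ₐ[ℂ] Module.End ℂ X) : Module H (RepMod ρ) :=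
  letI : Module (Module.End ℂ X) (RepMod ρ) := inferInstanceAs (Module (Module.End ℂ X) X)
  Module.compHom _ ρ.toRingHom

theorem IsIrrRep.isSimpleModule {ρ : H →ₐ[ℂ] Module.End ℂ X} (hρ : IsIrrRep ρ) :
    IsSimpleModule H (RepMod ρ) := by
  have hn : Nontrivial (RepMod ρ) := hρ.nontrivial
  rw [isSimpleModule_iff]
  refine { exists_pair_ne := ⟨⊥, ⊤, bot_ne_top⟩, eq_bot_or_eq_top := fun U => ?_ }
  have h := hρ.eq_bot_or_top
    { carrier := {x : X | (show RepMod ρ from x) ∈ U}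
      add_mem' := fun {a b} ha hb => U.add_mem ha hb
      zero_mem' := U.zero_mem
      smul_mem' := fun c x hx => by
        have h1 : ρ (algebraMap ℂ H c) x ∈ {x : X | (show RepMod ρ from x) ∈ U} :=
          U.smul_mem (algebraMap ℂ H c) hx
        rw [AlgHom.commutes] at h1
        exact h1 }
    (fun h x hx => U.smul_mem h hx)
  rcases h with h | h
  · left
    rw [eq_bot_iff]
    intro x hx
    have : (show X from x) ∈ (⊥ : Submodule ℂ X) := by rw [← h]; exact hx
    exact this
  · right
    rw [eq_top_iff]
    intro x _
    have : (show X from x) ∈ (⊤ : Submodule ℂ X) := trivial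
    rw [← h] at this
    exact this

theorem repIso_of_linearEquiv {ρ : H →ₐ[ℂ] Module.End ℂ X} {ρ' : H →ₐ[ℂ] Module.End ℂ Y}
    (e : RepMod ρ ≃ₗ[H] RepMod ρ') : RepIso ρ ρ' := by
  refine ⟨{ toFun := fun x => e x, invFun := fun y => e.symm y, map_add' := fun a b => e.map_add a b,
            map_smul' := fun c x => ?_, left_inv := e.left_inv, right_inv := e.right_inv },
          fun h x => e.map_smul h x⟩
  have h1 : e (ρ (algebraMap ℂ H c) x : X) = (ρ' (algebraMap ℂ H c) (e x : Y) : Y) :=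
    e.map_smul (algebraMap ℂ H c) x
  rw [AlgHom.commutes, AlgHom.commutes] at h1
  exact h1

/-- The characters of pairwise non-isomorphic irreducible representations are linearly
independent. -/
theorem linearIndependent_repChar {J : Type*} (X : J → Type u) [∀ j, AddCommGroup (X j)]
    [∀ j, Module ℂ (X j)] [∀ j, FiniteDimensional ℂ (X j)]
    (ρ : ∀ j, H →ₐ[ℂ] Module.End ℂ (X j)) (hirr : ∀ j, IsIrrRep (ρ j))
    (hiso : ∀ i j, RepIso (ρ i) (ρ j) → i = j) :
    LinearIndependent ℂ (fun j => repChar (ρ j)) := by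
  classical
  rw [linearIndependent_iff']
  intro S c hc j hj
  have hs : ∀ i : S, IsSimpleModule H (RepMod (ρ i)) := fun i => (hirr i).isSimpleModule
  -- Bases of all factors: an element acting on them as the projection acts as the identity on one
  -- factor and as zero on the others.
  let s : Finset (∀ i : S, RepMod (ρ i)) :=
    Finset.univ.biUnion fun i : S => Finset.univ.image fun b : Module.Basis.ofVectorSpaceIndex ℂ (X i) =>
      (Pi.single i (show RepMod (ρ i) from Module.Basis.ofVectorSpace ℂ (X i) b))
  obtain ⟨r, hr⟩ := exists_smul_eq_proj (H := H) (fun i : S => RepMod (ρ i))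
    (fun i l ⟨e⟩ => Subtype.ext (hiso _ _ (repIso_of_linearEquiv e))) ⟨j, hj⟩ s
  have hr' : ∀ i : S, ρ i r = if (i : J) = j then 1 else 0 := by
    intro i
    refine (Module.Basis.ofVectorSpace ℂ (X i)).ext fun b => ?_
    have h1 := congrFun (hr (Pi.single i (show RepMod (ρ i) from Module.Basis.ofVectorSpace ℂ (X i) b))
      (by
        simp only [s, Finset.mem_biUnion, Finset.mem_univ, Finset.mem_image, true_and]
        exact ⟨i, b, rfl⟩)) i
    rw [Pi.smul_apply, Pi.single_eq_same] at h1
    by_cases hi : (i : J) = j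
    · have hi' : i = ⟨j, hj⟩ := Subtype.ext hi
      subst hi'
      rw [if_pos rfl]
      rw [Pi.single_eq_same, Pi.single_eq_same] at h1
      exact h1
    · rw [if_neg hi]
      rw [Pi.single_eq_of_ne (fun h => hi (congrArg Subtype.val h))] at h1
      exact h1
  have h2 := LinearMap.congr_fun hc r
  simp only [LinearMap.sum_apply, LinearMap.smul_apply, repChar_apply, LinearMap.zero_apply] at h2
  rw [Finset.sum_eq_single j] at h2
  · have h3 := hr' ⟨j, hj⟩
    simp only [if_true] at h3
    rw [h3, LinearMap.trace_one, smul_eq_mul, mul_eq_zero] at h2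
    refine h2.resolve_right ?_
    have := (hirr j).nontrivial
    exact_mod_cast (Module.finrank_pos (R := ℂ) (M := X j)).ne'
  · intro i hi hij
    have h3 := hr' ⟨i, hi⟩
    simp only [if_neg hij] at h3
    rw [h3, map_zero, smul_zero]
  · exact fun h => absurd hj h

end LinearIndependence

/-! ### Reflections, parabolic subgroups and word length -/

section RootGeometry

variable {ι V V' : Type*} [AddCommGroup V] [Module ℝ V] [AddCommGroup V'] [Module ℝ V']
variable (P : RootPairing ι ℝ V V')

theorem weyl_ext {w w' : P.weylGroup} (h : ∀ v : V, w • v = w' • v) : w = w' := by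
  apply Subtype.ext
  apply RootPairing.Equiv.weightHom_injective P
  ext v
  exact h v

theorem root_smul (w : P.weylGroup) (i : ι) : P.root (w • i) = w • P.root i :=
  RootPairing.Equiv.root_indexEquiv_eq_smul P i w.1

theorem coroot'_smul (w : P.weylGroup) (i : ι) (v : V) :
    P.coroot' (w • i) (w • v) = P.coroot' i v := by
  obtain ⟨w, hw⟩ := w
  have h1 := RootPairing.Hom.weight_coweight_transpose_apply P P (P.coroot (w.indexEquiv i))
    (f := w.toHom)
  have h2 : w.toHom.coweightMap (P.coroot (w.indexEquiv i)) = P.coroot i := by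
    rw [RootPairing.Hom.coroot_coweightMap_apply]
    exact congrArg P.coroot (w.indexEquiv.symm_apply_apply i)
  rw [h2] at h1
  exact LinearMap.congr_fun h1 v

abbrev refIdx (i : ι) : P.weylGroup := RootPairing.weylGroup.ofIdx P i

theorem refIdx_smul (i : ι) (v : V) : refIdx P i • v = v - P.coroot' i v • P.root i := by
  rw [← RootPairing.reflection_apply]
  rfl

theorem refIdx_mul_self (i : ι) : refIdx P i * refIdx P i = 1 := by
  apply weyl_ext
  intro v
  rw [mul_smul, one_smul, refIdx_smul, refIdx_smul, map_sub, map_smul]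
  rw [RootPairing.root_coroot'_eq_pairing, P.pairing_same, smul_eq_mul]
  module

theorem refIdx_inv (i : ι) : (refIdx P i)⁻¹ = refIdx P i :=
  inv_eq_of_mul_eq_one_left (refIdx_mul_self P i)

theorem smul_real (w : P.weylGroup) (c : ℝ) (v : V) : w • (c • v) = c • (w • v) :=
  smul_comm w c v

theorem refIdx_smul_root (i : ι) : refIdx P i • P.root i = -P.root i := by
  rw [refIdx_smul, RootPairing.root_coroot'_eq_pairing, P.pairing_same]
  module

theorem refIdx_conj (w : P.weylGroup) (i : ι) : refIdx P (w • i) = w * refIdx P i * w⁻¹ := by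
  apply weyl_ext
  intro v
  rw [mul_smul, mul_smul, refIdx_smul, refIdx_smul, smul_sub, smul_inv_smul, smul_real, root_smul,
    ← coroot'_smul P w i, smul_inv_smul]

/-- The parabolic subgroup generated by the reflections with index in `M`. -/
def WM (M : Finset ι) : Subgroup P.weylGroup := Subgroup.closure (refIdx P '' M)

variable {P}

theorem refIdx_mem {M : Finset ι} {i : ι} (hi : i ∈ M) : refIdx P i ∈ WM P M :=
  Subgroup.subset_closure ⟨i, hi, rfl⟩

theorem WM_mono {M N : Finset ι} (h : N ⊆ M) : WM P N ≤ WM P M :=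
  Subgroup.closure_mono (Set.image_mono (by exact_mod_cast h))

variable (P) in
/-- The product of a word in reflections. -/
def wordProd (l : List ι) : P.weylGroup := (l.map (refIdx P)).prod

@[simp] theorem wordProd_nil : wordProd P [] = 1 := rfl

@[simp] theorem wordProd_cons (i : ι) (l : List ι) :
    wordProd P (i :: l) = refIdx P i * wordProd P l := by simp [wordProd]

theorem wordProd_append (l l' : List ι) :
    wordProd P (l ++ l') = wordProd P l * wordProd P l' := by simp [wordProd]

theorem wordProd_reverse (l : List ι) : wordProd P l.reverse = (wordProd P l)⁻¹ := by
  induction l with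
  | nil => simp
  | cons i l ih => simp [wordProd_append, ih, refIdx_inv]

theorem mem_WM_iff {M : Finset ι} {w : P.weylGroup} :
    w ∈ WM P M ↔ ∃ l : List ι, (∀ i ∈ l, i ∈ M) ∧ wordProd P l = w := by
  constructor
  · intro hw
    induction hw using Subgroup.closure_induction with
    | mem x hx =>
      obtain ⟨i, hi, rfl⟩ := hx
      exact ⟨[i], by simpa using hi, by simp⟩
    | one => exact ⟨[], by simp, rfl⟩
    | mul x y _ _ hx hy =>
      obtain ⟨l, hl, rfl⟩ := hx
      obtain ⟨l', hl', rfl⟩ := hy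
      refine ⟨l ++ l', fun i hi => ?_, wordProd_append l l'⟩
      rcases List.mem_append.mp hi with h | h
      · exact hl i h
      · exact hl' i h
    | inv x _ hx =>
      obtain ⟨l, hl, rfl⟩ := hx
      exact ⟨l.reverse, fun i hi => hl i (List.mem_reverse.mp hi), wordProd_reverse l⟩
  · rintro ⟨l, hl, rfl⟩
    induction l with
    | nil => exact one_mem _
    | cons i l ih =>
      rw [wordProd_cons]
      exact mul_mem (refIdx_mem (hl i (by simp))) (ih fun j hj => hl j (by simp [hj]))

/-- Word length with respect to the reflections with index in `M`. -/
def len (M : Finset ι) (w : P.weylGroup) : ℕ :=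
  sInf {n | ∃ l : List ι, (∀ i ∈ l, i ∈ M) ∧ wordProd P l = w ∧ l.length = n}

theorem len_le {M : Finset ι} {l : List ι} (hl : ∀ i ∈ l, i ∈ M) :
    len M (wordProd P l) ≤ l.length :=
  Nat.sInf_le ⟨l, hl, rfl, rfl⟩

theorem exists_word {M : Finset ι} {w : P.weylGroup} (hw : w ∈ WM P M) :
    ∃ l : List ι, (∀ i ∈ l, i ∈ M) ∧ wordProd P l = w ∧ l.length = len M w := by
  obtain ⟨l, hl, h⟩ := mem_WM_iff.mp hw
  exact Nat.sInf_mem (s := {n | ∃ l : List ι, (∀ i ∈ l, i ∈ M) ∧ wordProd P l = w ∧ l.length = n})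
    ⟨_, l, hl, h, rfl⟩

theorem len_one (M : Finset ι) : len M (1 : P.weylGroup) = 0 :=
  Nat.le_zero.mp (len_le (M := M) (P := P) (l := []) (by simp))

theorem eq_one_of_len {M : Finset ι} {w : P.weylGroup} (hw : w ∈ WM P M) (h : len M w = 0) :
    w = 1 := by
  obtain ⟨l, _, rfl, h2⟩ := exists_word hw
  rw [h, List.length_eq_zero_iff] at h2
  rw [h2, wordProd_nil]

theorem len_refIdx_mul_le {M : Finset ι} {w : P.weylGroup} (hw : w ∈ WM P M) {i : ι} (hi : i ∈ M) :
    len M (refIdx P i * w) ≤ len M w + 1 := by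
  obtain ⟨l, hl, rfl, h2⟩ := exists_word hw
  rw [← h2, ← wordProd_cons]
  refine len_le fun j hj => ?_
  rcases List.mem_cons.mp hj with rfl | h
  · exact hi
  · exact hl j h

theorem len_inv_le {M : Finset ι} {w : P.weylGroup} (hw : w ∈ WM P M) : len M w⁻¹ ≤ len M w := by
  obtain ⟨l, hl, rfl, h2⟩ := exists_word hw
  rw [← h2, ← wordProd_reverse, ← List.length_reverse]
  exact len_le fun j hj => hl j (List.mem_reverse.mp hj)

theorem len_inv {M : Finset ι} {w : P.weylGroup} (hw : w ∈ WM P M) : len M w⁻¹ = len M w :=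
  le_antisymm (len_inv_le hw) (by simpa using len_inv_le (inv_mem hw))

theorem exists_len_descent {M : Finset ι} {w : P.weylGroup} (hw : w ∈ WM P M) {n : ℕ}
    (h : len M w = n + 1) :
    ∃ i ∈ M, ∃ u ∈ WM P M, w = refIdx P i * u ∧ len M u = n := by
  obtain ⟨l, hl, rfl, h2⟩ := exists_word hw
  cases l with
  | nil =>
    rw [h] at h2
    exact absurd h2 (by simp)
  | cons i l =>
    have hi : i ∈ M := hl i (by simp)
    have hl' : ∀ j ∈ l, j ∈ M := fun j hj => hl j (by simp [hj])
    have hu : wordProd P l ∈ WM P M := mem_WM_iff.mpr ⟨l, hl', rfl⟩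
    refine ⟨i, hi, wordProd P l, hu, wordProd_cons i l, ?_⟩
    have h3 := len_le (P := P) hl'
    have h4 := len_refIdx_mul_le hu hi
    rw [wordProd_cons] at h h2
    simp only [List.length_cons] at h2
    omega

@[elab_as_elim]
theorem WM_induction {M : Finset ι} {p : ∀ w : P.weylGroup, w ∈ WM P M → Prop}
    (one : p 1 (one_mem _))
    (mul : ∀ i (hi : i ∈ M) w (hw : w ∈ WM P M), p w hw →
      p (refIdx P i * w) (mul_mem (refIdx_mem hi) hw)) {w : P.weylGroup} (hw : w ∈ WM P M) :
    p w hw := by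
  obtain ⟨l, hl, rfl⟩ := mem_WM_iff.mp hw
  induction l with
  | nil => exact one
  | cons i l ih =>
    have hl' : ∀ j ∈ l, j ∈ M := fun j hj => hl j (by simp [hj])
    have hu : wordProd P l ∈ WM P M := mem_WM_iff.mpr ⟨l, hl', rfl⟩
    exact mul i (hl i (by simp)) _ hu (ih hl' hu)

/-! ### The invariant form on roots -/

section Form

variable [Fintype ι]

theorem rootForm_smul (w : P.weylGroup) (x y : V) :
    P.RootForm (w • x) (w • y) = P.RootForm x y :=
  RootPairing.InvariantForm.apply_weylGroup_smul (B := (P.posRootForm ℝ).toInvariantForm) P w x y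

theorem rootForm_comm (x y : V) : P.RootForm x y = P.RootForm y x :=
  P.rootForm_symmetric.eq x y

theorem rootForm_root_pos (i : ι) : 0 < P.RootForm (P.root i) (P.root i) := by
  rw [P.rootForm_root_self]
  exact Finset.sum_pos' (fun j _ => mul_self_nonneg _) ⟨i, by simp⟩

/-- Invariance of the form under the reflection in the root. It turns statements on coroots into
statements on a semidefinite form, with no integrality needed. -/
theorem two_mul_rootForm (x : V) (i : ι) :
    2 * P.RootForm x (P.root i) = P.coroot' i x * P.RootForm (P.root i) (P.root i) := by
  have h := rootForm_smul (refIdx P i) x (P.root i)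
  rw [refIdx_smul_root, refIdx_smul] at h
  simp only [map_sub, map_smul, map_neg, LinearMap.sub_apply, LinearMap.smul_apply,
    smul_eq_mul] at h
  linarith

theorem coroot'_nonneg_iff (x : V) (i : ι) : 0 ≤ P.coroot' i x ↔ 0 ≤ P.RootForm x (P.root i) := by
  have h := two_mul_rootForm (P := P) x i
  have h1 := rootForm_root_pos (P := P) i
  constructor
  · intro h2
    have := mul_nonneg h2 h1.le
    linarith
  · intro h2
    by_contra h3
    push Not at h3
    have := mul_neg_of_neg_of_pos h3 h1
    linarith

theorem coroot'_eq_zero_iff (x : V) (i : ι) : P.coroot' i x = 0 ↔ P.RootForm x (P.root i) = 0 := by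
  have h := two_mul_rootForm (P := P) x i
  have h1 := rootForm_root_pos (P := P) i
  constructor
  · intro h2
    rw [h2] at h
    linarith
  · intro h2
    rw [h2] at h
    have : P.coroot' i x * P.RootForm (P.root i) (P.root i) = 0 := by linarith
    exact (mul_eq_zero.mp this).resolve_right h1.ne'

end Form

/-! ### Positive roots, the exchange condition, minimal coset representatives -/

section Simple

variable {B : Finset ι} (hB : IsSimpleRoots P B)

include hB in
theorem IsSimpleRoots.exists_coord [DecidableEq ι] :
    ∃ f : ι → Module.Dual ℝ V, ∀ i ∈ B, ∀ j ∈ B, f i (P.root j) = if i = j then 1 else 0 := by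
  classical
  have h := hB.linearIndepOn
  let b := Module.Basis.extend h.id_image
  have hb : ∀ i ∈ B, P.root i ∈ h.id_image.extend (Set.subset_univ _) := fun i hi =>
    Module.Basis.subset_extend h.id_image ⟨i, hi, rfl⟩
  refine ⟨fun i => if hi : i ∈ B then b.coord ⟨P.root i, hb i hi⟩ else 0, fun i hi j hj => ?_⟩
  simp only [dif_pos hi]
  have h1 : P.root j = b ⟨P.root j, hb j hj⟩ :=
    (Module.Basis.extend_apply_self h.id_image ⟨P.root j, hb j hj⟩).symm
  rw [h1, Module.Basis.coord_apply, Module.Basis.repr_self, Finsupp.single_apply]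
  simp only [Subtype.mk.injEq, EmbeddingLike.apply_eq_iff_eq]
  simp only [eq_comm]

/-- Linear forms dual to the simple roots. -/
def coord : ι → Module.Dual ℝ V :=
  letI := Classical.decEq ι
  hB.exists_coord.choose

theorem coord_root {i j : ι} (hi : i ∈ B) (hj : j ∈ B) [Decidable (i = j)] :
    coord hB i (P.root j) = if i = j then 1 else 0 := by
  let := Classical.decEq ι
  have h := hB.exists_coord.choose_spec i hi j hj
  refine h.trans ?_
  congr

theorem coord_root_self {i : ι} (hi : i ∈ B) : coord hB i (P.root i) = 1 := by
  classical
  rw [coord_root hB hi hi, if_pos rfl]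

theorem coord_root_ne {i j : ι} (hi : i ∈ B) (hj : j ∈ B) (h : i ≠ j) :
    coord hB i (P.root j) = 0 := by
  classical
  rw [coord_root hB hi hj, if_neg h]

theorem coord_sum (c : ι → ℝ) {j : ι} (hj : j ∈ B) :
    coord hB j (∑ i ∈ B, c i • P.root i) = c j := by
  classical
  rw [map_sum, Finset.sum_eq_single j]
  · rw [map_smul, coord_root_self hB hj, smul_eq_mul, mul_one]
  · intro i hi hij
    rw [map_smul, coord_root_ne hB hj hi hij.symm, smul_zero]
  · exact fun h => absurd hj h

theorem root_eq_sum_coord (i : ι) : P.root i = ∑ j ∈ B, coord hB j (P.root i) • P.root j := by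
  obtain ⟨c, _, h⟩ := hB.nonneg_or_nonpos i
  conv_lhs => rw [h]
  refine Finset.sum_congr rfl fun j hj => ?_
  rw [h, coord_sum hB c hj]

/-- All simple coordinates are nonnegative. -/
def PosV (v : V) : Prop := ∀ j ∈ B, 0 ≤ coord hB j v

theorem posV_root {i : ι} (hi : i ∈ B) : PosV hB (P.root i) := by
  classical
  intro j hj
  rw [coord_root hB hj hi]
  split_ifs <;> norm_num

theorem posV_or (i : ι) : PosV hB (P.root i) ∨ PosV hB (-P.root i) := by
  obtain ⟨c, hc, h⟩ := hB.nonneg_or_nonpos i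
  rcases hc with hc | hc
  · left
    intro j hj
    rw [h, coord_sum hB c hj]
    exact hc j hj
  · right
    intro j hj
    rw [h, map_neg, coord_sum hB c hj]
    linarith [hc j hj]

theorem not_posV_both {i : ι} (h : PosV hB (P.root i)) : ¬ PosV hB (-P.root i) := by
  intro h'
  have : P.root i = 0 := by
    rw [root_eq_sum_coord hB i]
    refine Finset.sum_eq_zero fun j hj => ?_
    have h1 := h j hj
    have h2 := h' j hj
    rw [map_neg] at h2
    rw [le_antisymm (by linarith) h1, zero_smul]
  exact P.ne_zero i this

theorem posV_neg_of_not {i : ι} (h : ¬ PosV hB (P.root i)) : PosV hB (-P.root i) :=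
  (posV_or hB i).resolve_left h

variable [P.IsReduced]

theorem root_eq_or_neg_of_smul {i j : ι} {c : ℝ} (h : P.root i = c • P.root j) :
    P.root i = P.root j ∨ P.root i = -P.root j := by
  refine RootPairing.IsReduced.eq_or_eq_neg i j fun hli => ?_
  rw [LinearIndependent.pair_iff] at hli
  have := hli 1 (-c) (by rw [h]; module)
  exact one_ne_zero this.1

/-- The reflection changes only the `j`-th coordinate, so any other nonzero coordinate keeps the
root positive. If there is none, the root is proportional to the `j`-th simple root, and reducedness
leaves only `i = j`. -/
theorem posV_refIdx {i j : ι} (hj : j ∈ B) (hi : PosV hB (P.root i)) (hij : i ≠ j) :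
    PosV hB (refIdx P j • P.root i) := by
  classical
  by_cases h : ∃ m ∈ B, m ≠ j ∧ coord hB m (P.root i) ≠ 0
  · obtain ⟨m, hm, hmj, hne⟩ := h
    by_contra hneg
    rw [← root_smul] at hneg
    have h1 := posV_neg_of_not hB hneg m hm
    rw [root_smul, refIdx_smul, map_neg, map_sub, map_smul, coord_root_ne hB hm hj hmj, smul_zero,
      sub_zero] at h1
    exact hne (le_antisymm (by linarith) (hi m hm))
  · push Not at h
    exfalso
    have h1 : P.root i = coord hB j (P.root i) • P.root j := by
      conv_lhs => rw [root_eq_sum_coord hB i]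
      refine Finset.sum_eq_single j (fun m hm hmj => ?_) (fun h => absurd hj h)
      rw [h m hm hmj, zero_smul]
    rcases root_eq_or_neg_of_smul h1 with h2 | h2
    · exact hij (P.root.injective h2)
    · exact not_posV_both hB (posV_root hB hj) (h2 ▸ hi)

/-- The exchange condition. -/
theorem exchange {M : Finset ι} (hM : M ⊆ B) {l : List ι} (hl : ∀ i ∈ l, i ∈ M) {i : ι}
    (hi : PosV hB (P.root i)) (hneg : PosV hB (-((wordProd P l)⁻¹ • P.root i))) :
    ∃ l' : List ι, (∀ i ∈ l', i ∈ M) ∧ l'.length + 1 = l.length ∧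
      wordProd P l' = refIdx P i * wordProd P l := by
  induction l generalizing i with
  | nil =>
    simp only [wordProd_nil, inv_one, one_smul] at hneg
    exact absurd hneg (not_posV_both hB hi)
  | cons j l ih =>
    have hj : j ∈ M := hl j (by simp)
    have hl' : ∀ m ∈ l, m ∈ M := fun m hm => hl m (by simp [hm])
    by_cases hij : i = j
    · subst hij
      exact ⟨l, hl', by simp, by rw [wordProd_cons, ← mul_assoc, refIdx_mul_self, one_mul]⟩
    -- Move the reflection past the first letter: `s_i s_j = s_j s_β` with `β = s_j(α_i)`, which is
    -- still positive.
    · have h1 := posV_refIdx hB (hM hj) hi hij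
      rw [← root_smul] at h1
      obtain ⟨l', h2, h3, h4⟩ := ih hl' h1 (by
        rw [wordProd_cons, mul_inv_rev, mul_smul, refIdx_inv] at hneg
        rwa [root_smul])
      refine ⟨j :: l', fun m hm => ?_, by simp [h3], ?_⟩
      · rcases List.mem_cons.mp hm with rfl | h
        · exact hj
        · exact h2 m h
      · rw [wordProd_cons, h4, refIdx_conj, wordProd_cons, refIdx_inv]
        simp only [← mul_assoc, refIdx_mul_self, one_mul]

theorem refIdx_mul_mem {M : Finset ι} (hM : M ⊆ B) {w : P.weylGroup} (hw : w ∈ WM P M) {i : ι}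
    (hi : PosV hB (P.root i)) (hneg : PosV hB (-(w⁻¹ • P.root i))) :
    refIdx P i * w ∈ WM P M ∧ len M (refIdx P i * w) < len M w := by
  obtain ⟨l, hl, rfl, h2⟩ := exists_word hw
  obtain ⟨l', h3, h4, h5⟩ := exchange hB hM hl hi hneg
  rw [← h5]
  refine ⟨mem_WM_iff.mpr ⟨l', h3, rfl⟩, ?_⟩
  have := len_le (P := P) h3
  omega

theorem len_mul_refIdx_lt {M : Finset ι} (hM : M ⊆ B) {w : P.weylGroup} (hw : w ∈ WM P M) {j : ι}
    (hj : j ∈ M) (hneg : PosV hB (-(w • P.root j))) : len M (w * refIdx P j) < len M w := by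
  have h := (refIdx_mul_mem hB hM (inv_mem hw) (posV_root hB (hM hj)) (by rwa [inv_inv])).2
  have h1 : w * refIdx P j = (refIdx P j * w⁻¹)⁻¹ := by rw [mul_inv_rev, inv_inv, refIdx_inv]
  rw [h1, len_inv (mul_mem (refIdx_mem hj) (inv_mem hw)), ← len_inv hw]
  exact h

/-- A shortest expression ends in a simple reflection whose root becomes negative. -/
theorem exists_neg_of_ne_one {M : Finset ι} (hM : M ⊆ B) {w : P.weylGroup} (hw : w ∈ WM P M)
    (h1 : w ≠ 1) : ∃ j ∈ M, PosV hB (-(w • P.root j)) := by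
  obtain ⟨n, hn⟩ : ∃ n, len M w⁻¹ = n + 1 :=
    Nat.exists_eq_succ_of_ne_zero fun h => h1 (inv_eq_one.mp (eq_one_of_len (inv_mem hw) h))
  obtain ⟨j, hj, u, hu, h2, h3⟩ := exists_len_descent (inv_mem hw) hn
  refine ⟨j, hj, ?_⟩
  by_contra hneg
  have h4 : PosV hB (w • P.root j) := by
    rw [← root_smul] at hneg ⊢
    exact (posV_or hB _).resolve_right hneg
  have h5 : w = u⁻¹ * refIdx P j := by rw [← inv_inv w, h2, mul_inv_rev, refIdx_inv]
  have h6 : w * refIdx P j = u⁻¹ := by rw [h5, mul_assoc, refIdx_mul_self, mul_one]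
  have h7 := len_mul_refIdx_lt hB hM (inv_mem hu) hj (by
    rw [← h6, mul_smul, refIdx_smul_root, smul_neg, neg_neg]
    exact h4)
  rw [← h5, len_inv hu, ← len_inv hw] at h7
  omega

theorem eq_one_of_posV {M : Finset ι} (hM : M ⊆ B) {w : P.weylGroup} (hw : w ∈ WM P M)
    (h : ∀ j ∈ M, PosV hB (w • P.root j)) : w = 1 := by
  by_contra h1
  obtain ⟨j, hj, h2⟩ := exists_neg_of_ne_one hB hM hw h1
  have h3 := h j hj
  rw [← root_smul] at h2 h3
  exact not_posV_both hB h3 h2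

/-- Factorization with respect to a parabolic subgroup. -/
theorem exists_coset_rep {M N : Finset ι} (hM : M ⊆ B) (hN : N ⊆ M) {w : P.weylGroup}
    (hw : w ∈ WM P M) : ∃ u ∈ WM P M, ∃ y ∈ WM P N, w = u * y ∧
      (∀ j ∈ N, PosV hB (u • P.root j)) ∧ len M u ≤ len M w := by
  generalize hn : len M w = n
  induction n using Nat.strong_induction_on generalizing w with
  | _ n ih =>
    by_cases h : ∀ j ∈ N, PosV hB (w • P.root j)
    · exact ⟨w, hw, 1, one_mem _, by simp, h, hn.le⟩
    · push Not at h
      -- A simple reflection of `N` whose root is sent to a negative one can be split off on the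
      -- right, and the length drops.
      obtain ⟨j, hj, h⟩ := h
      rw [← root_smul] at h
      have h1 := posV_neg_of_not hB h
      rw [root_smul] at h1
      have h2 := len_mul_refIdx_lt hB hM hw (hN hj) h1
      obtain ⟨u, hu, y, hy, h3, h4, h5⟩ := ih _ (hn ▸ h2) (mul_mem hw (refIdx_mem (hN hj))) rfl
      refine ⟨u, hu, y * refIdx P j, mul_mem hy (refIdx_mem hj), ?_, h4, ?_⟩
      · rw [← mul_assoc, ← h3, mul_assoc, refIdx_mul_self, mul_one]
      · omega

end Simple

end RootGeometry

/-! ### Finiteness of the Weyl group and spans of simple roots -/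

section ParabolicGeometry

variable {ι V V' : Type*} [AddCommGroup V] [Module ℝ V] [AddCommGroup V'] [Module ℝ V']
variable {P : RootPairing ι ℝ V V'}

/-- `V` is the sum of the root span and the kernel of the root form. All coroots vanish on that
kernel, so the Weyl group fixes it pointwise. -/
theorem weyl_eq_one_of_root [Finite ι] {w : P.weylGroup} (h : ∀ i : ι, w • i = i) : w = 1 := by
  cases nonempty_fintype ι
  apply weyl_ext
  intro v
  rw [one_smul]
  have hv : v ∈ P.rootSpan ℝ ⊔ LinearMap.ker P.RootForm := by
    rw [P.isCompl_rootSpan_ker_rootForm.sup_eq_top]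
    trivial
  obtain ⟨x, hx, y, hy, rfl⟩ := Submodule.mem_sup.mp hv
  have h1 : w • x = x := by
    clear hv
    induction hx using Submodule.span_induction with
    | mem x hx =>
      obtain ⟨i, rfl⟩ := hx
      rw [← root_smul, h]
    | zero => exact smul_zero w
    | add a b _ _ ha hb => rw [smul_add, ha, hb]
    | smul c a _ ha => rw [smul_real, ha]
  have h2 : ∀ u : P.weylGroup, u • y = y := by
    rintro ⟨u, hu⟩
    induction hu using RootPairing.weylGroup.induction with
    | mem i =>
      have h3 : refIdx P i • y = y := by
        rw [refIdx_smul, (coroot'_eq_zero_iff y i).mpr (by rw [LinearMap.mem_ker.mp hy]; rfl)]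
        module
      exact h3
    | one => exact one_smul _ y
    | mul a b ha hb h3 h4 =>
      rw [← Submonoid.mk_mul_mk _ _ _ ha hb]
      exact (mul_smul _ _ _).trans ((congrArg _ h4).trans h3)
  rw [smul_add, h1, h2]

instance [Finite ι] : Finite P.weylGroup := by
  refine Finite.of_injective (fun w : P.weylGroup => (fun i : ι => w • i)) fun w w' h => ?_
  rw [← inv_mul_eq_one]
  refine weyl_eq_one_of_root fun i => ?_
  rw [mul_smul, inv_smul_eq_iff]
  exact (congrFun h i).symm

variable (P) in
/-- The span of the simple roots with index in `M`. -/
def US (M : Finset ι) : Submodule ℝ V := Submodule.span ℝ (P.root '' M)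

theorem root_mem_US {M : Finset ι} {i : ι} (hi : i ∈ M) : P.root i ∈ US P M :=
  Submodule.subset_span ⟨i, hi, rfl⟩

theorem US_le_rootSpan (M : Finset ι) : US P M ≤ P.rootSpan ℝ :=
  Submodule.span_mono (by rintro _ ⟨i, _, rfl⟩; exact ⟨i, rfl⟩)

theorem smul_sub_mem_US {M : Finset ι} {w : P.weylGroup} (hw : w ∈ WM P M) (v : V) :
    w • v - v ∈ US P M := by
  induction hw using WM_induction with
  | one => rw [one_smul, sub_self]; exact zero_mem _
  | mul i hi w _ ih =>
    have : (refIdx P i * w) • v - v = (w • v - v) - P.coroot' i (w • v) • P.root i := by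
      rw [mul_smul, refIdx_smul]
      abel
    rw [this]
    exact sub_mem ih (Submodule.smul_mem _ _ (root_mem_US hi))

theorem smul_mem_US {M : Finset ι} {w : P.weylGroup} (hw : w ∈ WM P M) {x : V} (hx : x ∈ US P M) :
    w • x ∈ US P M := by
  have := add_mem (smul_sub_mem_US hw x) hx
  rwa [sub_add_cancel] at this

/-! ### Dominant vectors and their stabilizers -/

section Dominance

variable [Fintype ι] {B : Finset ι} (hB : IsSimpleRoots P B)

/-- The root form is definite on the root span, and `x` is orthogonal to a spanning set of a
subspace that contains it. -/
theorem eq_zero_of_mem_US {M : Finset ι} {x : V} (hx : x ∈ US P M)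
    (h : ∀ j ∈ M, P.coroot' j x = 0) : x = 0 := by
  apply P.eq_zero_of_mem_rootSpan_of_rootForm_self_eq_zero (US_le_rootSpan M hx)
  have h1 : US P M ≤ LinearMap.ker (P.RootForm x) := by
    refine Submodule.span_le.mpr ?_
    rintro _ ⟨j, hj, rfl⟩
    exact (coroot'_eq_zero_iff x j).mp (h j hj)
  exact h1 hx

include hB in
theorem eq_sum_coord_of_mem_US {M : Finset ι} (hM : M ⊆ B) {x : V} (hx : x ∈ US P M) :
    x = ∑ j ∈ M, coord hB j x • P.root j := by
  classical
  induction hx using Submodule.span_induction with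
  | mem x hx =>
    obtain ⟨i, hi, rfl⟩ := hx
    rw [Finset.sum_eq_single i]
    · rw [coord_root_self hB (hM hi), one_smul]
    · intro j hj hji
      rw [coord_root_ne hB (hM hj) (hM hi) hji, zero_smul]
    · exact fun h => absurd hi h
  | zero => simp
  | add a b _ _ ha hb =>
    conv_lhs => rw [ha, hb]
    simp only [map_add, add_smul, Finset.sum_add_distrib]
  | smul c a _ ha =>
    conv_lhs => rw [ha]
    simp only [map_smul, smul_eq_mul, mul_smul, Finset.smul_sum]

variable (P) in
/-- Dominance with respect to `M`. -/
def Dominant (M : Finset ι) (v : V) : Prop := ∀ j ∈ M, 0 ≤ P.coroot' j v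

include hB in
theorem Dominant.coroot'_nonneg {M : Finset ι} (hM : M ⊆ B) {v : V} (hv : Dominant P M v) {i : ι}
    (hi : P.root i ∈ US P M) (hpos : PosV hB (P.root i)) : 0 ≤ P.coroot' i v := by
  rw [coroot'_nonneg_iff, eq_sum_coord_of_mem_US hB hM hi, map_sum]
  refine Finset.sum_nonneg fun j hj => ?_
  rw [map_smul, smul_eq_mul]
  exact mul_nonneg (hpos j (hM hj)) ((coroot'_nonneg_iff v j).mp (hv j hj))

variable [P.IsReduced]

include hB in
-- A nontrivial stabilizing element `w` makes some simple root `α_j` negative. Then `⟨v, α_j⟩ = ⟨v,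
-- w α_j⟩` is both nonnegative and nonpositive, so `s_j` fixes `v` as well, and `w s_j` is shorter.
theorem stabilizer_dominant {M : Finset ι} (hM : M ⊆ B) {v : V} (hv : Dominant P M v)
    {w : P.weylGroup} (hw : w ∈ WM P M) (h : w • v = v) :
    w ∈ WM P (M.filter fun j => P.coroot' j v = 0) := by
  generalize hn : len M w = n
  induction n using Nat.strong_induction_on generalizing w with
  | _ n ih =>
    by_cases h1 : w = 1
    · rw [h1]
      exact one_mem _
    · obtain ⟨j, hj, hneg⟩ := exists_neg_of_ne_one hB hM hw h1
      have h2 := len_mul_refIdx_lt hB hM hw hj hneg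
      have h3 : P.coroot' j v = 0 := by
        refine le_antisymm ?_ (hv j hj)
        rw [← coroot'_smul P w j v, h]
        have h4 : P.root (refIdx P (w • j) • (w • j)) = -(w • P.root j) := by
          rw [root_smul, refIdx_smul_root, root_smul]
        have h5 := hv.coroot'_nonneg hB hM (i := refIdx P (w • j) • (w • j)) (by
          rw [h4]
          exact neg_mem (smul_mem_US hw (root_mem_US hj))) (by rw [h4]; exact hneg)
        rw [coroot'_nonneg_iff, h4, map_neg, ← root_smul] at h5
        by_contra h6
        push Not at h6
        have h7 := two_mul_rootForm (P := P) v (w • j)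
        have := mul_pos h6 (rootForm_root_pos (P := P) (w • j))
        linarith
      have h6 : refIdx P j • v = v := by
        rw [refIdx_smul, h3]
        module
      have h7 := ih _ (hn ▸ h2) (mul_mem hw (refIdx_mem hj)) (by rw [mul_smul, h6, h]) rfl
      have h8 := mul_mem h7 (refIdx_mem (Finset.mem_filter.mpr ⟨hj, h3⟩))
      rwa [mul_assoc, refIdx_mul_self, mul_one] at h8

end Dominance

/-! ### Fundamental vectors -/

section Fundamental

variable [Fintype ι] {B : Finset ι} (hB : IsSimpleRoots P B)

include hB in
-- The Cartan matrix of `M` is injective by definiteness of the root form, hence invertible.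
-- Dominant vectors in the span are the nonnegative combinations of the `ω j`.
theorem exists_fund {M : Finset ι} (hM : M ⊆ B) [DecidableEq ι] :
    ∃ ω : ι → V, (∀ j ∈ M, ω j ∈ US P M) ∧
      ∀ i ∈ M, ∀ j ∈ M, P.coroot' i (ω j) = if i = j then 1 else 0 := by
  let S : (M → ℝ) →ₗ[ℝ] V := Fintype.linearCombination ℝ (fun j : M => P.root j)
  let T : (M → ℝ) →ₗ[ℝ] (M → ℝ) := LinearMap.pi fun i : M => P.coroot' i ∘ₗ S
  have hS : ∀ c, S c ∈ US P M := fun c => by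
    rw [Fintype.linearCombination_apply]
    exact sum_mem fun j _ => Submodule.smul_mem _ _ (root_mem_US j.2)
  have hT : Function.Injective T := by
    rw [← LinearMap.ker_eq_bot, LinearMap.ker_eq_bot']
    intro c hc
    have h1 : S c = 0 := eq_zero_of_mem_US (hS c) fun j hj => congrFun hc ⟨j, hj⟩
    ext j
    have h2 := congrArg (coord hB j) h1
    rw [Fintype.linearCombination_apply, map_sum, map_zero, Finset.sum_eq_single j] at h2
    · rwa [map_smul, coord_root_self hB (hM j.2), smul_eq_mul, mul_one] at h2
    · intro i _ hij
      rw [map_smul, coord_root_ne hB (hM j.2) (hM i.2) (fun h => hij (Subtype.ext h.symm)),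
        smul_zero]
    · exact fun h => absurd (Finset.mem_univ _) h
  have hT' : Function.Surjective T := LinearMap.injective_iff_surjective.mp hT
  choose R hR using hT'
  refine ⟨fun j => if hj : j ∈ M then S (R (Pi.single ⟨j, hj⟩ 1)) else 0, fun j hj => ?_,
    fun i hi j hj => ?_⟩
  · simp only [dif_pos hj]
    exact hS _
  · simp only [dif_pos hj]
    have := congrFun (hR (Pi.single ⟨j, hj⟩ 1)) ⟨i, hi⟩
    refine this.trans ?_
    rw [Pi.single_apply]
    simp only [Subtype.mk.injEq]

end Fundamental

/-! ### The longest element of a parabolic subgroup -/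

section Longest

variable [Fintype ι] {B : Finset ι} (hB : IsSimpleRoots P B) [P.IsReduced]

include hB in
-- An element of maximal length works: a simple root that stayed positive would allow a longer
-- product.
theorem exists_longest {M : Finset ι} (hM : M ⊆ B) :
    ∃ w₀ ∈ WM P M, ∀ j ∈ M, PosV hB (-(w₀ • P.root j)) := by
  obtain ⟨w, hw⟩ := Finite.exists_max (fun w : WM P M => len M (w : P.weylGroup))
  refine ⟨w, w.2, fun j hj => ?_⟩
  by_contra h
  have h1 : PosV hB ((w : P.weylGroup) • P.root j) := by
    rw [← root_smul] at h ⊢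
    exact (posV_or hB _).resolve_right h
  have h2 := len_mul_refIdx_lt hB hM (mul_mem w.2 (refIdx_mem hj)) hj (by
    rw [mul_smul, refIdx_smul_root, smul_neg, neg_neg]
    exact h1)
  rw [mul_assoc, refIdx_mul_self, mul_one] at h2
  have h3 := hw ⟨w * refIdx P j, mul_mem w.2 (refIdx_mem hj)⟩
  simp only at h3
  omega

/-- The longest element of the parabolic subgroup. -/
def longest {M : Finset ι} (hM : M ⊆ B) : P.weylGroup := (exists_longest hB hM).choose

theorem longest_mem {M : Finset ι} (hM : M ⊆ B) : longest hB hM ∈ WM P M :=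
  (exists_longest hB hM).choose_spec.1

theorem longest_neg {M : Finset ι} (hM : M ⊆ B) {j : ι} (hj : j ∈ M) :
    PosV hB (-(longest hB hM • P.root j)) :=
  (exists_longest hB hM).choose_spec.2 j hj

theorem posV_sum {s : Finset ι} {f : ι → V} (h : ∀ i ∈ s, PosV hB (f i)) :
    PosV hB (∑ i ∈ s, f i) := fun j hj => by
  rw [map_sum]
  exact Finset.sum_nonneg fun i hi => h i hi j hj

theorem posV_smul {c : ℝ} (hc : 0 ≤ c) {v : V} (h : PosV hB v) : PosV hB (c • v) := fun j hj => by
  rw [map_smul, smul_eq_mul]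
  exact mul_nonneg hc (h j hj)

/-- An element that makes the simple roots of `M` negative maps nonnegative combinations to
nonpositive ones. -/
theorem posV_neg_smul {M : Finset ι} (hM : M ⊆ B) {w : P.weylGroup}
    (hw : ∀ j ∈ M, PosV hB (-(w • P.root j))) {x : V} (hx : x ∈ US P M) (hpos : PosV hB x) :
    PosV hB (-(w • x)) := by
  rw [eq_sum_coord_of_mem_US hB hM hx, Finset.smul_sum, ← Finset.sum_neg_distrib]
  refine posV_sum hB fun j hj => ?_
  rw [smul_real, ← smul_neg]
  exact posV_smul hB (hpos j (hM hj)) (hw j hj)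

/-- With `w₀` the longest element, both `w₀ w` and `w₀ w₀` keep the simple roots of `M` positive, so
both are trivial. -/
theorem eq_longest {M : Finset ι} (hM : M ⊆ B) {w : P.weylGroup} (hw : w ∈ WM P M)
    (h : ∀ j ∈ M, PosV hB (-(w • P.root j))) : w = longest hB hM := by
  have h1 : longest hB hM * w = 1 := by
    refine eq_one_of_posV hB hM (mul_mem (longest_mem hB hM) hw) fun j hj => ?_
    have h2 := posV_neg_smul hB hM (fun i hi => longest_neg hB hM hi)
      (neg_mem (smul_mem_US hw (root_mem_US hj))) (h j hj)
    rwa [smul_neg, neg_neg, ← mul_smul] at h2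
  have h1' : longest hB hM * longest hB hM = 1 := by
    refine eq_one_of_posV hB hM (mul_mem (longest_mem hB hM) (longest_mem hB hM)) fun j hj => ?_
    have h2 := posV_neg_smul hB hM (fun i hi => longest_neg hB hM hi)
      (neg_mem (smul_mem_US (longest_mem hB hM) (root_mem_US hj))) (longest_neg hB hM hj)
    rwa [smul_neg, neg_neg, ← mul_smul] at h2
  exact mul_left_cancel (h1.trans h1'.symm)

/-- Every other element can be lengthened by a simple reflection, so the maximal length is attained
only here. -/
theorem len_lt_longest {M : Finset ι} (hM : M ⊆ B) {w : P.weylGroup} (hw : w ∈ WM P M)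
    (h : w ≠ longest hB hM) : len M w < len M (longest hB hM) := by
  have key : ∀ w ∈ WM P M, w ≠ longest hB hM → ∃ j ∈ M, len M w < len M (w * refIdx P j) := by
    intro w hw h
    by_contra hcon
    push Not at hcon
    refine h (eq_longest hB hM hw fun j hj => ?_)
    by_contra h1
    have h2 : PosV hB (w • P.root j) := by
      rw [← root_smul] at h1 ⊢
      exact (posV_or hB _).resolve_right h1
    have h3 := len_mul_refIdx_lt hB hM (mul_mem hw (refIdx_mem hj)) hj (by
      rw [mul_smul, refIdx_smul_root, smul_neg, neg_neg]
      exact h2)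
    rw [mul_assoc, refIdx_mul_self, mul_one] at h3
    exact absurd h3 (not_lt.mpr (hcon j hj))
  obtain ⟨m, hm⟩ := Finite.exists_max (fun w : WM P M => len M (w : P.weylGroup))
  have hm' : (m : P.weylGroup) = longest hB hM := by
    by_contra hne
    obtain ⟨j, hj, h1⟩ := key m m.2 hne
    have := hm ⟨m * refIdx P j, mul_mem m.2 (refIdx_mem hj)⟩
    simp only at this
    omega
  obtain ⟨j, hj, h1⟩ := key w hw h
  have h2 := hm ⟨w * refIdx P j, mul_mem hw (refIdx_mem hj)⟩
  rw [hm'] at h2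
  exact h1.trans_le h2

end Longest

/-! ### Simple reflections generate the Weyl group -/

section Generation

variable [Fintype ι] {B : Finset ι} (hB : IsSimpleRoots P B) [P.IsReduced]

include hB in
-- Among the positive roots in the orbit take one of least height, the sum of its simple
-- coordinates. If it were not simple, a simple reflection would lower the height and keep the root
-- positive.
theorem exists_smul_simple (i : ι) : ∃ w ∈ WM P B, ∃ j ∈ B, P.root i = w • P.root j := by
  classical
  have hpos : ∃ w : WM P B, PosV hB ((w : P.weylGroup) • P.root i) := by
    rcases posV_or hB i with h | h
    · exact ⟨1, by simpa using h⟩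
    · refine ⟨⟨longest hB subset_rfl, longest_mem hB subset_rfl⟩, ?_⟩
      have h1 : P.root i ∈ US P B := by
        rw [root_eq_sum_coord hB i]
        exact sum_mem fun j hj => Submodule.smul_mem _ _ (root_mem_US hj)
      have h2 := posV_neg_smul hB subset_rfl (fun j hj => longest_neg hB subset_rfl hj)
        (neg_mem h1) h
      rwa [smul_neg, neg_neg] at h2
  have : Nonempty {w : WM P B // PosV hB ((w : P.weylGroup) • P.root i)} := ⟨⟨_, hpos.choose_spec⟩⟩
  obtain ⟨⟨w, hw⟩, hmin⟩ := Finite.exists_min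
    (fun w : {w : WM P B // PosV hB ((w : P.weylGroup) • P.root i)} =>
      ∑ j ∈ B, coord hB j ((w.1 : P.weylGroup) • P.root i))
  rw [← root_smul] at hw
  set γ := (w : P.weylGroup) • i with hγ
  -- `γ` has positive norm and is a nonnegative combination of simple roots, so it pairs positively
  -- with one that occurs in it.
  obtain ⟨j, hj, h1, h2⟩ : ∃ j ∈ B, 0 < coord hB j (P.root γ) ∧ 0 < P.coroot' j (P.root γ) := by
    by_contra hcon
    push Not at hcon
    have h3 : P.RootForm (P.root γ) (P.root γ) ≤ 0 := by
      conv_lhs => rw [root_eq_sum_coord hB γ]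
      conv_lhs => enter [1]; rw [← root_eq_sum_coord hB γ]
      rw [map_sum]
      refine Finset.sum_nonpos fun j hj => ?_
      rw [map_smul, smul_eq_mul]
      rcases (hw j hj).eq_or_lt with h | h
      · rw [← h, zero_mul]
      · refine mul_nonpos_of_nonneg_of_nonpos h.le ?_
        have h4 := two_mul_rootForm (P := P) (P.root γ) j
        have h5 := mul_nonpos_of_nonpos_of_nonneg (hcon j hj h) (rootForm_root_pos (P := P) j).le
        linarith
    exact absurd (rootForm_root_pos (P := P) γ) (not_lt.mpr h3)
  by_cases hγj : γ = j
  · refine ⟨(w : P.weylGroup)⁻¹, inv_mem w.2, j, hj, ?_⟩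
    rw [← root_smul, ← hγj, hγ, inv_smul_smul]
  · exfalso
    have h3 := posV_refIdx hB hj hw hγj
    have h4 := hmin ⟨⟨refIdx P j * w, mul_mem (refIdx_mem hj) w.2⟩, by
      rw [mul_smul, ← root_smul P w]
      exact h3⟩
    simp only [mul_smul, ← root_smul P (w : P.weylGroup), ← hγ] at h4
    rw [refIdx_smul] at h4
    simp only [map_sub, map_smul, Finset.sum_sub_distrib, smul_eq_mul] at h4
    rw [← Finset.mul_sum, Finset.sum_eq_single_of_mem j hj (fun m hm hmj =>
      coord_root_ne hB hm hj hmj), coord_root_self hB hj, mul_one] at h4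
    linarith

include hB in
theorem WM_eq_top : WM P B = ⊤ := by
  rw [eq_top_iff]
  rintro ⟨w, hw⟩ -
  induction hw using RootPairing.weylGroup.induction with
  | mem i =>
    obtain ⟨u, hu, j, hj, h⟩ := exists_smul_simple hB i
    have h1 : i = u • j := P.root.injective (by rw [h, root_smul])
    have h2 : refIdx P i ∈ WM P B := by
      rw [h1, refIdx_conj]
      exact mul_mem (mul_mem hu (refIdx_mem hj)) (inv_mem hu)
    exact h2
  | one => exact one_mem _
  | mul x y hx hy h1 h2 => exact mul_mem h1 h2

end Generation

end ParabolicGeometry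

/-! ### The Weyl group on the symmetric algebra -/

section WeylOnSym

variable {ι V V' : Type*} [AddCommGroup V] [Module ℝ V] [AddCommGroup V'] [Module ℝ V']
variable (P : RootPairing ι ℝ V V')

theorem symA_hom_ext {A : Type*} [Semiring A] [Algebra ℂ A] {f g : SymA V →ₐ[ℂ] A}
    (h : ∀ v : V, f (ofV v) = g (ofV v)) : f = g := by
  ext x
  induction x using TensorProduct.induction_on with
  | zero => rw [map_zero, map_zero]
  | tmul c v =>
    have h1 : (c ⊗ₜ[ℝ] v : ℂ ⊗[ℝ] V) = c • ((1 : ℂ) ⊗ₜ[ℝ] v) := by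
      rw [TensorProduct.smul_tmul', smul_eq_mul, mul_one]
    rw [h1, map_smul, map_smul]
    exact congrArg _ (h v)
  | add x y hx hy => rw [map_add, map_add, hx, hy]

theorem ofV_add (v w : V) : ofV (v + w) = ofV v + ofV w := by
  simp [ofV, TensorProduct.tmul_add]

theorem ofV_smul (c : ℝ) (v : V) : ofV (c • v) = (c : ℂ) • ofV v := by
  rw [ofV, ofV, ← map_smul, TensorProduct.smul_tmul', TensorProduct.tmul_smul,
    TensorProduct.smul_tmul']
  congr 2

/-- The inclusion of `V` in `S(V_ℂ)` as an `ℝ`-linear map. -/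
def ofVL : V →ₗ[ℝ] SymA V where
  toFun := ofV
  map_add' := ofV_add
  map_smul' c v := by rw [ofV_smul]; rfl

theorem ofV_sub (v w : V) : ofV (v - w) = ofV v - ofV w := map_sub ofVL v w

theorem ofV_sum {s : Finset ι} (f : ι → V) : ofV (∑ i ∈ s, f i) = ∑ i ∈ s, ofV (f i) :=
  map_sum ofVL f s

theorem adjoin_ofV : Algebra.adjoin ℂ (Set.range (ofV (V := V))) = ⊤ := by
  rw [eq_top_iff]
  intro x hx
  clear hx
  induction x using SymmetricAlgebra.induction with
  | algebraMap r => exact Subalgebra.algebraMap_mem _ r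
  | ι x =>
    induction x using TensorProduct.induction_on with
    | zero => rw [map_zero]; exact zero_mem _
    | tmul c v =>
      have h1 : (c ⊗ₜ[ℝ] v : ℂ ⊗[ℝ] V) = c • ((1 : ℂ) ⊗ₜ[ℝ] v) := by
        rw [TensorProduct.smul_tmul', smul_eq_mul, mul_one]
      rw [h1, map_smul]
      exact Subalgebra.smul_mem _ (Algebra.subset_adjoin (Set.mem_range_self v)) c
    | add x y hx hy => rw [map_add]; exact add_mem hx hy
  | mul x y hx hy => exact mul_mem hx hy
  | add x y hx hy => exact add_mem hx hy

/-- The action of the Weyl group on `S(V_ℂ)`. -/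
def actA (w : P.weylGroup) : SymA V →ₐ[ℂ] SymA V :=
  SymmetricAlgebra.lift
    (SymmetricAlgebra.ι ℂ (ℂ ⊗[ℝ] V) ∘ₗ (DistribSMul.toLinearMap ℝ V w).baseChange ℂ)

@[simp] theorem actA_ofV (w : P.weylGroup) (v : V) : actA P w (ofV v) = ofV (w • v) := by
  rw [actA, ofV, SymmetricAlgebra.lift_ι_apply, LinearMap.comp_apply, LinearMap.baseChange_tmul]
  rfl

theorem actA_mul (w w' : P.weylGroup) (a : SymA V) : actA P (w * w') a = actA P w (actA P w' a) := by
  have : actA P (w * w') = (actA P w).comp (actA P w') :=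
    symA_hom_ext fun v => by simp [mul_smul]
  rw [this]
  rfl

theorem actA_one (a : SymA V) : actA P 1 a = a := by
  have : actA P 1 = AlgHom.id ℂ (SymA V) := symA_hom_ext fun v => by simp
  rw [this]
  rfl

theorem refl_eq_actA (i : ι) : refl P i = actA P (refIdx P i) := rfl

theorem diffOp_ofV (i : ι) (v : V) :
    diffOp P i (ofV v) = algebraMap ℂ (SymA V) (P.coroot' i v : ℝ) := by
  refine (eq_diffOp P i _ _ ?_).symm
  rw [refl_eq_actA, actA_ofV, refIdx_smul, ofV_sub, ofV_smul, mul_comm, ← Algebra.smul_def]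
  abel

theorem diffOp_eq_zero {i : ι} {a : SymA V} (h : refl P i a = a) : diffOp P i a = 0 :=
  (eq_diffOp P i a 0 (by rw [h]; simp)).symm

end WeylOnSym

/-! ### Graded Hecke algebras of parabolic subgroups -/

section ParabolicHecke

variable {ι V V' : Type*} [AddCommGroup V] [Module ℝ V] [AddCommGroup V'] [Module ℝ V']
variable (P : RootPairing ι ℝ V V') (M : Finset ι) (κ : ι → ℝ)

/-- The defining relations of the graded Hecke algebra of a parabolic subgroup. -/
inductive RelM : FreeAlgebra ℂ (WM P M ⊕ SymA V) → FreeAlgebra ℂ (WM P M ⊕ SymA V) → Prop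
  | t_one : RelM (FreeAlgebra.ι ℂ (Sum.inl 1)) 1
  | t_mul (w w' : WM P M) : RelM (FreeAlgebra.ι ℂ (Sum.inl (w * w')))
      (FreeAlgebra.ι ℂ (Sum.inl w) * FreeAlgebra.ι ℂ (Sum.inl w'))
  | a_algebraMap (c : ℂ) : RelM (FreeAlgebra.ι ℂ (Sum.inr (algebraMap ℂ (SymA V) c)))
      (algebraMap ℂ _ c)
  | a_add (a b : SymA V) : RelM (FreeAlgebra.ι ℂ (Sum.inr (a + b)))
      (FreeAlgebra.ι ℂ (Sum.inr a) + FreeAlgebra.ι ℂ (Sum.inr b))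
  | a_mul (a b : SymA V) : RelM (FreeAlgebra.ι ℂ (Sum.inr (a * b)))
      (FreeAlgebra.ι ℂ (Sum.inr a) * FreeAlgebra.ι ℂ (Sum.inr b))
  | cross (i : ι) (hi : i ∈ M) (a : SymA V) :
      RelM (FreeAlgebra.ι ℂ (Sum.inr a) * FreeAlgebra.ι ℂ (Sum.inl ⟨refIdx P i, refIdx_mem hi⟩))
        (FreeAlgebra.ι ℂ (Sum.inl ⟨refIdx P i, refIdx_mem hi⟩) *
            FreeAlgebra.ι ℂ (Sum.inr (refl P i a))
          + algebraMap ℂ _ (κ i : ℂ) * FreeAlgebra.ι ℂ (Sum.inr (diffOp P i a)))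

/-- The graded Hecke algebra of a parabolic subgroup. -/
def HeckeM : Type _ := RingQuot (RelM P M κ)

instance : Ring (HeckeM P M κ) := inferInstanceAs (Ring (RingQuot (RelM P M κ)))

instance : Algebra ℂ (HeckeM P M κ) := inferInstanceAs (Algebra ℂ (RingQuot (RelM P M κ)))

/-- The quotient map. -/
def mkM : FreeAlgebra ℂ (WM P M ⊕ SymA V) →ₐ[ℂ] HeckeM P M κ := RingQuot.mkAlgHom ℂ (RelM P M κ)

variable {P M κ} in
theorem mkM_rel {x y : FreeAlgebra ℂ (WM P M ⊕ SymA V)} (h : RelM P M κ x y) :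
    mkM P M κ x = mkM P M κ y := RingQuot.mkAlgHom_rel ℂ h

/-- The group elements. -/
def tM : WM P M →* HeckeM P M κ where
  toFun w := mkM P M κ (FreeAlgebra.ι ℂ (Sum.inl w))
  map_one' := (mkM_rel RelM.t_one).trans (map_one _)
  map_mul' w w' := (mkM_rel (RelM.t_mul w w')).trans (map_mul _ _ _)

/-- The polynomial part. -/
def aM : SymA V →ₐ[ℂ] HeckeM P M κ :=
  AlgHom.ofLinearMap
    { toFun := fun a => mkM P M κ (FreeAlgebra.ι ℂ (Sum.inr a))
      map_add' := fun a b => (mkM_rel (RelM.a_add a b)).trans (map_add _ _ _)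
      map_smul' := fun c a => by
        rw [Algebra.smul_def]
        refine (mkM_rel (RelM.a_mul _ a)).trans ?_
        rw [map_mul, mkM_rel (RelM.a_algebraMap c), AlgHom.commutes, ← Algebra.smul_def]
        rfl }
    (by
      have h := mkM_rel (P := P) (M := M) (κ := κ) (RelM.a_algebraMap 1)
      rw [map_one, map_one, map_one] at h
      exact h)
    (fun a b => (mkM_rel (RelM.a_mul a b)).trans (map_mul _ _ _))

variable {M} in
/-- The simple reflection as an element of the parabolic subgroup. -/
abbrev sM {i : ι} (hi : i ∈ M) : WM P M := ⟨refIdx P i, refIdx_mem hi⟩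

variable {P M κ}

theorem aM_mul_tM_sM {i : ι} (hi : i ∈ M) (a : SymA V) :
    aM P M κ a * tM P M κ (sM P hi) =
      tM P M κ (sM P hi) * aM P M κ (refl P i a) + (κ i : ℂ) • aM P M κ (diffOp P i a) := by
  have h := mkM_rel (RelM.cross (P := P) (κ := κ) i hi a)
  rw [map_mul, map_add, map_mul, map_mul, AlgHom.commutes, ← Algebra.smul_def] at h
  exact h

section Lift

variable {K : Type*} [Ring K] [Algebra ℂ K] (g : WM P M →* K) (f : SymA V →ₐ[ℂ] K)
  (h : ∀ i (hi : i ∈ M) a, f a * g (sM P hi) = g (sM P hi) * f (refl P i a) +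
    (κ i : ℂ) • f (diffOp P i a))

/-- The universal property. -/
def liftM : HeckeM P M κ →ₐ[ℂ] K :=
  RingQuot.liftAlgHom ℂ ⟨FreeAlgebra.lift ℂ (Sum.elim g f), by
    intro x y hxy
    cases hxy with
    | t_one => simp
    | t_mul w w' => simp
    | a_algebraMap c => simp
    | a_add a b => simp
    | a_mul a b => simp
    | cross i hi a => simpa [Algebra.smul_def] using h i hi a⟩

@[simp] theorem liftM_tM (w : WM P M) : liftM g f h (tM P M κ w) = g w := by
  change RingQuot.liftAlgHom ℂ _ (RingQuot.mkAlgHom ℂ _ _) = _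
  rw [RingQuot.liftAlgHom_mkAlgHom_apply]
  simp

@[simp] theorem liftM_aM (a : SymA V) : liftM g f h (aM P M κ a) = f a := by
  change RingQuot.liftAlgHom ℂ _ (RingQuot.mkAlgHom ℂ _ _) = _
  rw [RingQuot.liftAlgHom_mkAlgHom_apply]
  simp

end Lift

/-- The homomorphism between the algebras of nested parabolic subgroups. -/
def incM {N : Finset ι} (hN : N ⊆ M) : HeckeM P N κ →ₐ[ℂ] HeckeM P M κ :=
  liftM ((tM P M κ).comp (Subgroup.inclusion (WM_mono hN))) (aM P M κ)
    fun _ hi a => aM_mul_tM_sM (hN hi) a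

@[simp] theorem incM_tM {N : Finset ι} (hN : N ⊆ M) (w : WM P N) :
    incM hN (tM P N κ w) = tM P M κ ⟨w, WM_mono hN w.2⟩ := liftM_tM _ _ _ w

@[simp] theorem incM_aM {N : Finset ι} (hN : N ⊆ M) (a : SymA V) :
    incM hN (aM P N κ a) = aM P M κ a := liftM_aM _ _ _ a

/-- The span of the `t_w a` with `w` of length less than `n`. -/
def lenLT (P : RootPairing ι ℝ V V') (M : Finset ι) (κ : ι → ℝ) (n : ℕ) :
    Submodule ℂ (HeckeM P M κ) :=
  Submodule.span ℂ {h | ∃ (w : WM P M) (a : SymA V), len M (w : P.weylGroup) < n ∧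
    h = tM P M κ w * aM P M κ a}

theorem mem_lenLT {n : ℕ} {w : WM P M} (hw : len M (w : P.weylGroup) < n) (a : SymA V) :
    tM P M κ w * aM P M κ a ∈ lenLT P M κ n := Submodule.subset_span ⟨w, a, hw, rfl⟩

theorem lenLT_mono {m n : ℕ} (h : m ≤ n) : lenLT P M κ m ≤ lenLT P M κ n := by
  refine Submodule.span_mono ?_
  rintro _ ⟨w, a, hw, rfl⟩
  exact ⟨w, a, hw.trans_le h, rfl⟩

theorem sM_mul_mem_lenLT {n : ℕ} {i : ι} (hi : i ∈ M) {h : HeckeM P M κ} (hh : h ∈ lenLT P M κ n) :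
    tM P M κ (sM P hi) * h ∈ lenLT P M κ (n + 1) := by
  induction hh using Submodule.span_induction with
  | mem x hx =>
    obtain ⟨w, a, hw, rfl⟩ := hx
    rw [← mul_assoc, ← map_mul]
    refine mem_lenLT ?_ a
    have := len_refIdx_mul_le w.2 hi
    change len M (refIdx P i * (w : P.weylGroup)) < n + 1
    omega
  | zero => rw [mul_zero]; exact zero_mem _
  | add x y _ _ hx hy => rw [mul_add]; exact add_mem hx hy
  | smul c x _ hx => rw [mul_smul_comm]; exact Submodule.smul_mem _ _ hx

/-- Moving polynomials past group elements, up to shorter group elements. -/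
theorem aM_mul_tM_sub_mem (w : WM P M) (a : SymA V) :
    aM P M κ a * tM P M κ w - tM P M κ w * aM P M κ (actA P (w : P.weylGroup)⁻¹ a) ∈
      lenLT P M κ (len M (w : P.weylGroup)) := by
  generalize hn : len M (w : P.weylGroup) = n
  induction n using Nat.strong_induction_on generalizing w a with
  | _ n ih =>
    rcases n with _ | n
    · have h1 : w = 1 := Subtype.ext (eq_one_of_len w.2 hn)
      rw [h1]
      simp [actA_one]
    · obtain ⟨i, hi, u, hu, hwu, hlen⟩ := exists_len_descent w.2 hn
      have hw : w = sM P hi * ⟨u, hu⟩ := Subtype.ext hwu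
      have h1 := ih n (Nat.lt_succ_self n) ⟨u, hu⟩ (refl P i a) hlen
      have h2 := ih n (Nat.lt_succ_self n) ⟨u, hu⟩ (diffOp P i a) hlen
      -- The difference term of the cross relation is followed by `u` alone, so it only produces
      -- elements of length at most `n`.
      have h3 : aM P M κ (diffOp P i a) * tM P M κ ⟨u, hu⟩ ∈ lenLT P M κ (n + 1) := by
        rw [← sub_add_cancel (aM P M κ (diffOp P i a) * tM P M κ ⟨u, hu⟩)]
        refine add_mem (lenLT_mono n.le_succ h2) (mem_lenLT ?_ _)
        simp only [hlen]
        omega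
      have h4 : actA P (w : P.weylGroup)⁻¹ a = actA P u⁻¹ (refl P i a) := by
        rw [hwu, mul_inv_rev, refIdx_inv, actA_mul, refl_eq_actA]
      rw [h4, hw, map_mul, ← mul_assoc, aM_mul_tM_sM, add_mul, smul_mul_assoc, mul_assoc, mul_assoc]
      have h5 : ∀ x y z : HeckeM P M κ, x + y - z = (x - z) + y := fun x y z => by abel
      rw [h5, ← mul_sub]
      exact add_mem (sM_mul_mem_lenLT hi h1) (Submodule.smul_mem _ _ h3)

/-- The algebra is spanned by the products `t_w a`. -/
theorem span_tM_mul_aM : Submodule.span ℂ {h : HeckeM P M κ | ∃ w a, h = tM P M κ w * aM P M κ a} =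
    ⊤ := by
  set S := Submodule.span ℂ {h : HeckeM P M κ | ∃ w a, h = tM P M κ w * aM P M κ a} with hS
  have hmem : ∀ w a, tM P M κ w * aM P M κ a ∈ S := fun w a => Submodule.subset_span ⟨w, a, rfl⟩
  have hlt : ∀ n, lenLT P M κ n ≤ S := fun n =>
    Submodule.span_mono (by rintro _ ⟨w, a, _, rfl⟩; exact ⟨w, a, rfl⟩)
  have ht : ∀ w, ∀ h ∈ S, tM P M κ w * h ∈ S := by
    intro w h hh
    induction hh using Submodule.span_induction with
    | mem x hx =>
      obtain ⟨u, a, rfl⟩ := hx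
      rw [← mul_assoc, ← map_mul]
      exact hmem _ _
    | zero => rw [mul_zero]; exact zero_mem _
    | add x y _ _ hx hy => rw [mul_add]; exact add_mem hx hy
    | smul c x _ hx => rw [mul_smul_comm]; exact Submodule.smul_mem _ _ hx
  have ha' : ∀ a, ∀ h ∈ S, h * aM P M κ a ∈ S := by
    intro w h hh
    induction hh using Submodule.span_induction with
    | mem x hx =>
      obtain ⟨u, a, rfl⟩ := hx
      rw [mul_assoc, ← map_mul]
      exact hmem _ _
    | zero => rw [zero_mul]; exact zero_mem _
    | add x y _ _ hx hy => rw [add_mul]; exact add_mem hx hy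
    | smul c x _ hx => rw [smul_mul_assoc]; exact Submodule.smul_mem _ _ hx
  have ha : ∀ a, ∀ h ∈ S, aM P M κ a * h ∈ S := by
    intro b h hh
    induction hh using Submodule.span_induction with
    | mem x hx =>
      obtain ⟨u, a, rfl⟩ := hx
      rw [← mul_assoc]
      refine ha' _ _ ?_
      have h1 := add_mem (hlt _ (aM_mul_tM_sub_mem (κ := κ) u b)) (hmem u (actA P (u : P.weylGroup)⁻¹ b))
      rwa [sub_add_cancel] at h1
    | zero => rw [mul_zero]; exact zero_mem _
    | add x y _ _ hx hy => rw [mul_add]; exact add_mem hx hy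
    | smul c x _ hx => rw [mul_smul_comm]; exact Submodule.smul_mem _ _ hx
  rw [eq_top_iff]
  intro h _
  obtain ⟨x, hx⟩ := RingQuot.mkAlgHom_surjective ℂ (RelM P M κ) h
  replace hx : mkM P M κ x = h := hx
  have key : ∀ x, ∀ y ∈ S, mkM P M κ x * y ∈ S := by
    intro x
    induction x using FreeAlgebra.induction with
    | grade0 r =>
      intro y hy
      rw [AlgHom.commutes, ← Algebra.smul_def]
      exact Submodule.smul_mem _ _ hy
    | grade1 x =>
      rcases x with w | a
      · exact ht w
      · exact ha a
    | mul a b h1 h2 =>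
      intro y hy
      rw [map_mul, mul_assoc]
      exact h1 _ (h2 y hy)
    | add a b h1 h2 =>
      intro y hy
      rw [map_add, add_mul]
      exact add_mem (h1 _ hy) (h2 _ hy)
  have h1 : (1 : HeckeM P M κ) ∈ S := by
    have := hmem 1 1
    rwa [map_one, map_one, one_mul] at this
  have := key x 1 h1
  rwa [mul_one, hx] at this

theorem commute_aM_tM {a : SymA V} (ha : ∀ j ∈ M, refl P j a = a) (w : WM P M) :
    Commute (aM P M κ a) (tM P M κ w) := by
  obtain ⟨w, hw⟩ := w
  induction hw using WM_induction with
  | one =>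
    have : (⟨1, one_mem _⟩ : WM P M) = 1 := rfl
    rw [this, map_one]
    exact Commute.one_right _
  | mul i hi w hw ih =>
    have : (⟨refIdx P i * w, mul_mem (refIdx_mem hi) hw⟩ : WM P M) = sM P hi * ⟨w, hw⟩ := rfl
    rw [this, map_mul]
    refine Commute.mul_right ?_ ih
    rw [commute_iff_eq, aM_mul_tM_sM, ha i hi, diffOp_eq_zero P (ha i hi), map_zero, smul_zero,
      add_zero]

end ParabolicHecke

/-! ### Invariant parameters; the longest element inside the parabolic subgroup -/

section LongestElement

variable {ι V V' : Type*} [AddCommGroup V] [Module ℝ V] [AddCommGroup V'] [Module ℝ V']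
variable {P : RootPairing ι ℝ V V'} {κ : ι → ℝ} [Fintype ι] [P.IsReduced] {B : Finset ι}
variable (hB : IsSimpleRoots P B)

variable (P) in
/-- Invariance of a parameter function defined on all indices. -/
def InvPar (B : Finset ι) (κ : ι → ℝ) : Prop :=
  ∀ i ∈ B, ∀ j ∈ B, (∃ w : P.weylGroup, w • P.root i = P.root j) → κ i = κ j

/-- The longest element in the parabolic subgroup. -/
def wM {M : Finset ι} (hM : M ⊆ B) : WM P M := ⟨longest hB hM, longest_mem hB hM⟩

end LongestElement

/-! ### Weights of commuting operators -/

section Weights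

open Polynomial

variable {X : Type*} [AddCommGroup X] [Module ℂ X] [FiniteDimensional ℂ X]
variable {A : Type*} [CommRing A] [Algebra ℂ A] (f : A →ₐ[ℂ] Module.End ℂ X)

/-- `χ` is a weight of `f` with a weight vector in `U`. -/
def IsWt (U : Submodule ℂ X) (χ : A →ₐ[ℂ] ℂ) : Prop := ∃ x ∈ U, x ≠ 0 ∧ ∀ a, f a x = χ a • x

theorem apply_comm (a b : A) (x : X) : f a (f b x) = f b (f a x) := by
  rw [← Module.End.mul_apply, ← Module.End.mul_apply, ← map_mul, ← map_mul, mul_comm]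

/-- If every operator is scalar on `U`, the scalars form a character. Otherwise an eigenspace of a
non-scalar one is a smaller nonzero stable subspace, by commutativity. -/
theorem exists_isWt {U : Submodule ℂ X} (hU : ∀ a, ∀ x ∈ U, f a x ∈ U) (h : U ≠ ⊥) :
    ∃ χ, IsWt f U χ := by
  generalize hn : Module.finrank ℂ U = n
  induction n using Nat.strong_induction_on generalizing U with
  | _ n ih =>
    by_cases hs : ∀ a, ∃ z : ℂ, ∀ x ∈ U, f a x = z • x
    · choose z hz using hs
      obtain ⟨x, hx, hx0⟩ := (Submodule.ne_bot_iff U).mp h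
      have hinj : ∀ c d : ℂ, c • x = d • x → c = d := fun c d hcd => smul_left_injective ℂ hx0 hcd
      refine ⟨AlgHom.ofLinearMap
        { toFun := z
          map_add' := fun a b => hinj _ _ ?_
          map_smul' := fun c a => hinj _ _ ?_ } (hinj _ _ ?_) (fun a b => hinj _ _ ?_), x, hx, hx0,
        fun a => hz a x hx⟩
      · rw [← hz _ x hx, map_add, add_smul, LinearMap.add_apply, hz _ x hx, hz _ x hx]
      · rw [← hz _ x hx, map_smul, LinearMap.smul_apply, hz _ x hx, smul_assoc]
        rfl
      · change z 1 • x = _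
        rw [← hz _ x hx, map_one, one_smul]
        rfl
      · change z (a * b) • x = (z a * z b) • x
        rw [← hz _ x hx, map_mul, Module.End.mul_apply, hz b x hx, map_smul, hz a x hx, smul_smul,
          mul_comm]
    · push Not at hs
      obtain ⟨a, ha⟩ := hs
      have : Nontrivial U := Submodule.nontrivial_iff_ne_bot.mpr h
      obtain ⟨z, hz⟩ := Module.End.exists_eigenvalue ((f a).restrict (hU a))
      obtain ⟨y, hy⟩ := hz.exists_hasEigenvector
      have hy1 : f a (y : X) = z • (y : X) := congrArg Subtype.val hy.apply_eq_smul
      set U' := U ⊓ (f a).eigenspace z with hU'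
      have hmem : ∀ x, x ∈ U' ↔ x ∈ U ∧ f a x = z • x := fun x => by
        rw [hU', Submodule.mem_inf, Module.End.mem_eigenspace_iff]
      have hlt : U' < U := by
        refine lt_of_le_of_ne inf_le_left fun heq => ?_
        obtain ⟨x, hx, hne⟩ := ha z
        exact hne ((hmem x).mp (heq ▸ hx)).2
      obtain ⟨χ, x, hx, h1⟩ := ih _ (hn ▸ Submodule.finrank_lt_finrank_of_lt hlt) (U := U')
        (fun b x hx => by
          rw [hmem] at hx ⊢
          exact ⟨hU b x hx.1, by rw [apply_comm, hx.2, map_smul]⟩)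
        (fun h0 => hy.2 (Subtype.ext (by
          have : (y : X) ∈ U' := (hmem _).mpr ⟨y.2, hy1⟩
          rw [h0, Submodule.mem_bot] at this
          exact this))) rfl
      exact ⟨χ, x, hlt.le hx, h1⟩

theorem exists_isWt_of_eigenvector {U : Submodule ℂ X} (hU : ∀ a, ∀ x ∈ U, f a x ∈ U) {b : A} {z : ℂ}
    {x : X} (hx : x ∈ U) (hx0 : x ≠ 0) (h : f b x = z • x) : ∃ χ, IsWt f U χ ∧ χ b = z := by
  obtain ⟨χ, y, hy, hy0, hχ⟩ := exists_isWt f (U := U ⊓ (f b).eigenspace z) (fun a y hy => by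
      rw [Submodule.mem_inf, Module.End.mem_eigenspace_iff] at hy ⊢
      exact ⟨hU a y hy.1, by rw [apply_comm, hy.2, map_smul]⟩)
    (fun h0 => hx0 ((Submodule.mem_bot ℂ).mp (h0 ▸ ⟨hx, Module.End.mem_eigenspace_iff.mpr h⟩)))
  refine ⟨χ, ⟨y, hy.1, hy0, hχ⟩, smul_left_injective ℂ hy0 ?_⟩
  change χ b • y = z • y
  rw [← hχ, Module.End.mem_eigenspace_iff.mp hy.2]

/-- Simultaneous generalized eigenspaces are independent, and a finite-dimensional space has only
finitely many nonzero independent subspaces. -/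
theorem finite_isWt (U : Submodule ℂ X) : {χ | IsWt f U χ}.Finite := by
  have h1 := Module.End.independent_iInf_maxGenEigenspace_of_forall_mapsTo (fun a : A => f a)
    (fun a b φ => Module.End.mapsTo_maxGenEigenspace_of_comm
      (LinearMap.ext fun x => apply_comm f _ _ x) φ)
  have h2 := WellFoundedGT.finite_ne_bot_of_iSupIndep h1
  refine (h2.preimage (f := fun χ : A →ₐ[ℂ] ℂ => (χ : A → ℂ))
    (fun χ _ χ' _ h => DFunLike.coe_injective h)).subset ?_
  rintro χ ⟨x, hx, hx0, hχ⟩ h0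
  refine hx0 ((Submodule.mem_bot ℂ).mp (h0 ▸ ?_))
  rw [Submodule.mem_iInf]
  intro a
  refine Module.End.mem_maxGenEigenspace _ _ _ |>.mpr ⟨1, ?_⟩
  simp [hχ]

theorem eq_of_mem_maxGenEigenspace {D : Module.End ℂ X} {z c : ℂ} {x : X}
    (hx : x ∈ D.maxGenEigenspace z) (hx0 : x ≠ 0) (hc : D x = c • x) : c = z := by
  obtain ⟨k, hk⟩ := (Module.End.mem_maxGenEigenspace _ _ _).mp hx
  have h1 : ∀ k, ((D - z • (1 : Module.End ℂ X)) ^ k) x = (c - z) ^ k • x := by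
    intro k
    induction k with
    | zero => simp
    | succ k ih =>
      rw [pow_succ, Module.End.mul_apply, LinearMap.sub_apply, LinearMap.smul_apply, hc,
        Module.End.one_apply, ← sub_smul, map_smul, ih, smul_smul, pow_succ, mul_comm]
  rw [h1] at hk
  exact sub_eq_zero.mp (eq_zero_of_pow_eq_zero ((smul_eq_zero.mp hk).resolve_right hx0))

/-- A common polynomial that projects to the generalized eigenspaces of finitely many
endomorphisms. -/
theorem exists_aeval_eq_proj {J : Type*} [Fintype J] {Y : J → Type*} [∀ j, AddCommGroup (Y j)]
    [∀ j, Module ℂ (Y j)] [∀ j, FiniteDimensional ℂ (Y j)] (T : ∀ j, Module.End ℂ (Y j)) (z : ℂ) :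
    ∃ p : ℂ[X], ∀ j, (∀ x, aeval (T j) p x ∈ (T j).maxGenEigenspace z) ∧
      ∀ x ∈ (T j).maxGenEigenspace z, aeval (T j) p x = x := by
  classical
  -- The product annihilates all the `T j`, so one Bézout identity between `(X - z)^k` and the
  -- cofactor `g` serves every `j`.
  set m : ℂ[X] := ∏ j, minpoly ℂ (T j) with hm
  have hm0 : m ≠ 0 := Finset.prod_ne_zero_iff.mpr fun j _ => minpoly.ne_zero_of_finite ℂ (T j)
  obtain ⟨g, hg, hgz⟩ := Polynomial.exists_eq_pow_rootMultiplicity_mul_and_not_dvd m hm0 z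
  set k := rootMultiplicity z m
  have hmT : ∀ j, aeval (T j) m = 0 := fun j => by
    obtain ⟨q, hq⟩ := Finset.dvd_prod_of_mem (fun j => minpoly ℂ (T j)) (Finset.mem_univ j)
    rw [hm, hq, map_mul, minpoly.aeval, zero_mul]
  have hco : ∀ n, IsCoprime ((X - C z) ^ n) g := fun n =>
    ((irreducible_X_sub_C z).coprime_iff_not_dvd.mpr hgz).pow_left
  have happ : ∀ j (x : Y j) n, aeval (T j) ((Polynomial.X - C z) ^ n) x =
      ((T j - z • (1 : Module.End ℂ (Y j))) ^ n) x := fun j x n => by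
    rw [map_pow, map_sub, aeval_X, aeval_C, Algebra.algebraMap_eq_smul_one]
  obtain ⟨a, b, hab⟩ := hco k
  have hmul : ∀ j (p q : ℂ[X]) (x : Y j), aeval (T j) (p * q) x = aeval (T j) p (aeval (T j) q x) :=
    fun j p q x => by rw [map_mul, Module.End.mul_apply]
  refine ⟨b * g, fun j => ⟨fun x => ?_, fun x hx => ?_⟩⟩
  · rw [Module.End.mem_maxGenEigenspace]
    refine ⟨k, ?_⟩
    rw [← happ, ← hmul, mul_left_comm, ← hg, hmul, hmT, LinearMap.zero_apply, map_zero]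
  · rw [Module.End.mem_maxGenEigenspace] at hx
    obtain ⟨n, hn⟩ := hx
    rw [← happ] at hn
    obtain ⟨c, d, hcd⟩ := hco n
    have h1 : aeval (T j) ((Polynomial.X - C z) ^ k) x = 0 := by
      have h2 : (Polynomial.X - C z) ^ k = c * (Polynomial.X - C z) ^ k * (Polynomial.X - C z) ^ n
          + d * m := by
        rw [hg]
        linear_combination (-(Polynomial.X - C z) ^ k) * hcd
      rw [h2, map_add, LinearMap.add_apply, hmul, hn, map_zero, hmul, hmT, LinearMap.zero_apply,
        map_zero, add_zero]
    have h3 : b * g = 1 - a * (Polynomial.X - C z) ^ k := by linear_combination hab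
    rw [h3, map_sub, LinearMap.sub_apply, hmul, h1, map_zero, map_one, sub_zero]
    rfl

end Weights

/-! ### The extremal dominant vector -/

section Maximal

variable {ι V V' : Type*} [AddCommGroup V] [Module ℝ V] [AddCommGroup V'] [Module ℝ V']
variable {P : RootPairing ι ℝ V V'} [Fintype ι] {B : Finset ι} (hB : IsSimpleRoots P B)

theorem rootForm_self_nonneg (x : V) : 0 ≤ P.RootForm x x := by
  rw [P.rootForm_apply_apply]
  exact Finset.sum_nonneg fun i _ => mul_self_nonneg _

theorem rootForm_self_pos {M : Finset ι} {x : V} (hx : x ∈ US P M) (h0 : x ≠ 0) :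
    0 < P.RootForm x x :=
  (rootForm_self_nonneg x).lt_of_ne fun h =>
    h0 (P.eq_zero_of_mem_rootSpan_of_rootForm_self_eq_zero (US_le_rootSpan M hx) h.symm)

include hB in
theorem eq_sum_fund [DecidableEq ι] {M : Finset ι} {ω : ι → V}
    (hω : ∀ j ∈ M, ω j ∈ US P M)
    (hδ : ∀ i ∈ M, ∀ j ∈ M, P.coroot' i (ω j) = if i = j then 1 else 0) {v : V}
    (hv : v ∈ US P M) : v = ∑ j ∈ M, P.coroot' j v • ω j := by
  rw [← sub_eq_zero]
  refine eq_zero_of_mem_US (sub_mem hv (sum_mem fun j hj => Submodule.smul_mem _ _ (hω j hj))) ?_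
  intro i hi
  rw [map_sub, map_sum, Finset.sum_eq_single i]
  · rw [map_smul, hδ i hi i hi, if_pos rfl, smul_eq_mul, mul_one, sub_self]
  · intro j hj hji
    rw [map_smul, hδ i hi j hj, if_neg (Ne.symm hji), smul_zero]
  · intro h
    exact absurd hi h

include hB in
/-- Among finitely many linear functionals and the normalized dominant vectors in the span of the
simple roots in `M`, the largest value is attained. -/
theorem exists_maximal {M : Finset ι} (hM : M ⊆ B) {J : Type*} [Finite J] (F : J → V →ₗ[ℝ] ℝ)
    (j₀ : J) {v₀ : V} (hv₀ : v₀ ∈ US P M) (hdom : Dominant P M v₀) (hpos : 0 < F j₀ v₀) :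
    ∃ j ω c, ω ∈ US P M ∧ Dominant P M ω ∧ P.RootForm ω ω = 1 ∧ 0 < c ∧ F j ω = c ∧
      ∀ i, ∀ v ∈ US P M, Dominant P M v → F i v ≤ c * √(P.RootForm v v) := by
  classical
  obtain ⟨ω, hω, hδ⟩ := exists_fund hB hM
  set φ : (M → ℝ) →ₗ[ℝ] V := ∑ j : M, (LinearMap.proj j).smulRight (ω j) with hφ
  have hφa : ∀ x, φ x = ∑ j : M, x j • ω j := fun x => by
    rw [hφ, LinearMap.sum_apply]
    rfl
  have hφU : ∀ x, φ x ∈ US P M := fun x => by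
    rw [hφa]
    exact sum_mem fun j _ => Submodule.smul_mem _ _ (hω j j.2)
  have hφc : ∀ x (i : M), P.coroot' i (φ x) = x i := fun x i => by
    rw [hφa, map_sum, Finset.sum_eq_single i]
    · rw [map_smul, hδ i i.2 i i.2, if_pos rfl, smul_eq_mul, mul_one]
    · intro j _ hji
      rw [map_smul, hδ i i.2 j j.2, if_neg (fun h => hji (Subtype.ext h.symm)), smul_zero]
    · intro h
      exact absurd (Finset.mem_univ i) h
  have hφs : ∀ v ∈ US P M, φ (fun j => P.coroot' j v) = v := fun v hv => by
    rw [hφa]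
    exact (Finset.sum_coe_sort M fun j => P.coroot' j v • ω j).trans (eq_sum_fund hB hω hδ hv).symm
  -- The quotient is invariant under positive scaling, so in fundamental coordinates the dominant
  -- cone can be replaced by the compact standard simplex.
  set g : J → (M → ℝ) → ℝ := fun i x => F i (φ x) / √(P.RootForm (φ x) (φ x)) with hg
  have hgs : ∀ i x (s : ℝ), 0 < s → g i (s • x) = g i x := fun i x s hs => by
    simp only [hg, map_smul, LinearMap.smul_apply, smul_eq_mul]
    rw [← mul_assoc, Real.sqrt_mul (mul_self_nonneg s), Real.sqrt_mul_self hs.le,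
      mul_div_mul_left _ _ hs.ne']
  have hcont : ∀ i, ContinuousOn (g i) (stdSimplex ℝ M) := fun i => by
    refine ContinuousOn.div ?_ ?_ ?_
    · exact ((F i ∘ₗ φ).continuous_of_finiteDimensional).continuousOn
    · refine (Real.continuous_sqrt.comp ?_).continuousOn
      simp only [P.rootForm_apply_apply]
      refine continuous_finsetSum _ fun j _ => ?_
      have : Continuous fun x => P.coroot' j (φ x) :=
        (P.coroot' j ∘ₗ φ).continuous_of_finiteDimensional
      exact this.mul this
    · intro x hx h0
      rw [Real.sqrt_eq_zero (rootForm_self_nonneg _)] at h0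
      have h1 := P.eq_zero_of_mem_rootSpan_of_rootForm_self_eq_zero
        (US_le_rootSpan M (hφU x)) h0
      have h2 : ∀ j, x j = 0 := fun j => by rw [← hφc x j, h1, map_zero]
      have h3 := hx.2
      simp [h2] at h3
  have hred : ∀ v ∈ US P M, Dominant P M v → v ≠ 0 → ∃ x ∈ stdSimplex ℝ M, ∃ s : ℝ, 0 < s ∧
      v = φ (s • x) := by
    intro v hv hd h0
    have hnn : ∀ j : M, 0 ≤ P.coroot' j v := fun j => hd j j.2
    have hs : 0 < ∑ j : M, P.coroot' j v := by
      refine (Finset.sum_nonneg fun j _ => hnn j).lt_of_ne fun h => h0 ?_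
      refine eq_zero_of_mem_US hv fun j hj => ?_
      exact (Finset.sum_eq_zero_iff_of_nonneg fun j _ => hnn j).mp h.symm ⟨j, hj⟩ (Finset.mem_univ _)
    refine ⟨(∑ j : M, P.coroot' j v)⁻¹ • fun j : M => P.coroot' j v, ⟨fun j => ?_, ?_⟩, _, hs, ?_⟩
    · exact mul_nonneg (inv_nonneg.mpr hs.le) (hnn j)
    · simp only [Pi.smul_apply, smul_eq_mul, ← Finset.mul_sum]
      exact inv_mul_cancel₀ hs.ne'
    · rw [smul_inv_smul₀ hs.ne', hφs v hv]
  have hv₀0 : v₀ ≠ 0 := fun h => by rw [h, map_zero] at hpos; exact lt_irrefl _ hpos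
  obtain ⟨x₀, hx₀, s₀, hs₀, hvx⟩ := hred v₀ hv₀ hdom hv₀0
  have hmax : ∀ i, ∃ x ∈ stdSimplex ℝ M, IsMaxOn (g i) (stdSimplex ℝ M) x := fun i =>
    (isCompact_stdSimplex ℝ M).exists_isMaxOn ⟨x₀, hx₀⟩ (hcont i)
  choose y hy hymax using hmax
  have : Nonempty J := ⟨j₀⟩
  obtain ⟨j, hj⟩ := Finite.exists_max fun i => g i (y i)
  have hall : ∀ i, ∀ v ∈ US P M, Dominant P M v → v ≠ 0 →
      F i v / √(P.RootForm v v) ≤ g j (y j) := by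
    intro i v hv hd h0
    obtain ⟨x, hx, s, hs, rfl⟩ := hred v hv hd h0
    exact (hgs i x s hs).le.trans ((hymax i hx).trans (hj i))
  have hq := rootForm_self_pos (hφU (y j)) (x := φ (y j)) (fun h => by
    have h2 : ∀ i, y j i = 0 := fun i => by rw [← hφc (y j) i, h, map_zero]
    have h3 := (hy j).2
    simp [h2] at h3)
  have hr := Real.sqrt_pos.mpr hq
  refine ⟨j, (√(P.RootForm (φ (y j)) (φ (y j))))⁻¹ • φ (y j), g j (y j),
    Submodule.smul_mem _ _ (hφU _), ?_, ?_, ?_, ?_, ?_⟩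
  · intro i hi
    rw [map_smul]
    exact mul_nonneg (inv_nonneg.mpr hr.le) (((hφc (y j) ⟨i, hi⟩).symm ▸ (hy j).1 ⟨i, hi⟩))
  · simp only [map_smul, LinearMap.smul_apply, smul_eq_mul]
    rw [← mul_assoc, ← mul_inv, Real.mul_self_sqrt hq.le, inv_mul_cancel₀ hq.ne']
  · exact (div_pos hpos (Real.sqrt_pos.mpr (rootForm_self_pos hv₀ hv₀0))).trans_le
      (hall j₀ v₀ hv₀ hdom hv₀0)
  · rw [map_smul, smul_eq_mul, hg]
    ring
  · intro i v hv hd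
    by_cases h0 : v = 0
    · rw [h0]
      simp
    · exact (div_le_iff₀ (Real.sqrt_pos.mpr (rootForm_self_pos hv h0))).mp (hall i v hv hd h0)

variable [P.IsReduced]

include hB in
/-- The value at the maximal vector strictly decreases under nontrivial minimal coset
representatives of its stabilizer. -/
theorem lt_of_maximal {M : Finset ι} (hM : M ⊆ B) {ω : V} (hω : ω ∈ US P M)
    (hdom : Dominant P M ω) (hq : P.RootForm ω ω = 1) {c : ℝ} (hc : 0 < c) {F : V →ₗ[ℝ] ℝ}
    (hF : ∀ v ∈ US P M, Dominant P M v → F v ≤ c * √(P.RootForm v v)) (hFω : F ω = c)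
    {u : P.weylGroup} (hu : u ∈ WM P M) (hu1 : u ≠ 1)
    (hpos : ∀ j ∈ M, P.coroot' j ω = 0 → PosV hB (u • P.root j)) : F (u⁻¹ • ω) < c := by
  classical
  obtain ⟨ω', hω', hδ⟩ := exists_fund hB hM
  -- The linearization at `ω` of the gap between `F v` and `c |v|`: zero at `ω`, and nonpositive on
  -- dominant vectors by the first variation.
  set e : V →ₗ[ℝ] ℝ := F - c • P.RootForm ω with he
  have hea : ∀ v, e v = F v - c * P.RootForm ω v := fun v => rfl
  have heω : e ω = 0 := by rw [hea, hFω, hq, mul_one, sub_self]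
  have hdomω : ∀ j ∈ M, Dominant P M (ω' j) := fun j hj i hi => by
    rw [hδ i hi j hj]
    split_ifs <;> norm_num
  have hele : ∀ v ∈ US P M, Dominant P M v → e v ≤ 0 := by
    intro v hv hd
    by_contra hlt
    push Not at hlt
    set b := P.RootForm ω v with hb
    set q := P.RootForm v v with hq'
    have hqnn : 0 ≤ q := rootForm_self_nonneg v
    -- The bound `F (ω + t v) ≤ c |ω + t v|` and `√(1 + y) ≤ 1 + y/2` give `e v ≤ c t q / 2`, which
    -- fails for small `t > 0`. The denominator uses `q + 1` so that it is visibly nonzero.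
    obtain ⟨t, ht, htq⟩ : ∃ t : ℝ, 0 < t ∧ c * (t * q) < 2 * e v := by
      refine ⟨e v / (c * (q + 1)), by positivity, ?_⟩
      have h1 : c * (e v / (c * (q + 1)) * q) = e v * (q / (q + 1)) := by
        field_simp
      have h2 : q / (q + 1) < 1 := (div_lt_one (by linarith)).mpr (by linarith)
      rw [h1]
      nlinarith
    have h1 := hF (ω + t • v) (add_mem hω (Submodule.smul_mem _ _ hv)) (fun j hj => by
      rw [map_add, map_smul]
      exact add_nonneg (hdom j hj) (mul_nonneg ht.le (hd j hj)))
    have h2 : P.RootForm (ω + t • v) (ω + t • v) = 1 + 2 * (t * b) + t ^ 2 * q := by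
      simp only [map_add, map_smul, LinearMap.add_apply, LinearMap.smul_apply, smul_eq_mul]
      rw [hq, rootForm_comm v ω, ← hb, ← hq']
      ring
    have h3 : √(P.RootForm (ω + t • v) (ω + t • v)) ≤ 1 + (t * b + t ^ 2 * q / 2) := by
      have h4 := rootForm_self_nonneg (P := P) (ω + t • v)
      rw [h2] at h4 ⊢
      refine Real.sqrt_le_iff.mpr ⟨by nlinarith, by nlinarith [sq_nonneg (t * b + t ^ 2 * q / 2)]⟩
    rw [map_add, map_smul, hFω, smul_eq_mul] at h1
    have h5 := h1.trans (mul_le_mul_of_nonneg_left h3 hc.le)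
    have h6 : t * F v ≤ t * (c * b + c * (t * q) / 2) := by nlinarith
    have h7 := le_of_mul_le_mul_left h6 ht
    rw [hea] at htq hlt
    rw [← hb] at htq
    linarith
  -- `e ω = 0` is a sum of nonpositive terms, so every fundamental vector that occurs in `ω` is a
  -- zero of `e`.
  have hezero : ∀ j ∈ M, P.coroot' j ω ≠ 0 → e (ω' j) = 0 := by
    intro j hj hne
    have h1 : ∑ j ∈ M, P.coroot' j ω * e (ω' j) = 0 := by
      have h2 := congrArg e (eq_sum_fund hB hω' hδ hω)
      rw [heω, map_sum] at h2
      simpa using h2.symm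
    have h2 := (Finset.sum_eq_zero_iff_of_nonpos fun j hj =>
      mul_nonpos_of_nonneg_of_nonpos (hdom j hj) (hele _ (hω' j hj) (hdomω j hj))).mp h1 j hj
    exact (mul_eq_zero.mp h2).resolve_left hne
  have huω : u⁻¹ • ω ∈ US P M := smul_mem_US (inv_mem hu) hω
  -- Fundamental vectors that occur in `ω` contribute nothing. At the others the coordinate of
  -- `u⁻¹ω` is the pairing of `ω` with the coroot of the positive root `u α_j`, hence nonnegative.
  have he2 : e (u⁻¹ • ω) ≤ 0 := by
    rw [eq_sum_fund hB hω' hδ huω, map_sum]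
    refine Finset.sum_nonpos fun j hj => ?_
    rw [map_smul, smul_eq_mul]
    by_cases h : P.coroot' j ω = 0
    · refine mul_nonpos_of_nonneg_of_nonpos ?_ (hele _ (hω' j hj) (hdomω j hj))
      have h1 := coroot'_smul P u j (u⁻¹ • ω)
      rw [smul_inv_smul] at h1
      rw [← h1]
      have h2 := hpos j hj h
      rw [← root_smul] at h2
      refine hdom.coroot'_nonneg hB hM ?_ h2
      rw [root_smul]
      exact smul_mem_US hu (root_mem_US hj)
    · rw [hezero j hj h, mul_zero]
  -- If `u` fixed `ω` it would lie in the parabolic subgroup of the simple roots orthogonal to `ω`,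
  -- and it keeps all of these positive. Distinct unit vectors then have product below one.
  have hne : u⁻¹ • ω ≠ ω := by
    intro h
    have h1 : u • ω = ω := by rw [← h, smul_inv_smul, h]
    have h2 := stabilizer_dominant hB hM hdom hu h1
    refine hu1 (eq_one_of_posV hB ((Finset.filter_subset _ _).trans hM) h2 fun j hj => ?_)
    rw [Finset.mem_filter] at hj
    exact hpos j hj.1 hj.2
  have hlt : P.RootForm ω (u⁻¹ • ω) < 1 := by
    have h1 := rootForm_self_pos (sub_mem huω hω) (sub_ne_zero.mpr hne)
    simp only [map_sub, LinearMap.sub_apply] at h1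
    rw [rootForm_smul, hq, rootForm_comm (u⁻¹ • ω) ω] at h1
    linarith
  rw [hea] at he2
  nlinarith

end Maximal

/-! ### From eigenspaces of a central vector of `H_N` back to `H_M`-modules -/

section Core

open Polynomial

variable {ι V V' : Type*} [AddCommGroup V] [Module ℝ V] [AddCommGroup V'] [Module ℝ V']
variable {P : RootPairing ι ℝ V V'} {κ : ι → ℝ} [Fintype ι] [P.IsReduced] {B : Finset ι}
variable (hB : IsSimpleRoots P B) {M N : Finset ι}
variable {X : Type u} [AddCommGroup X] [Module ℂ X] [FiniteDimensional ℂ X]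

theorem aeval_rep_aM (ρ : HeckeM P M κ →ₐ[ℂ] Module.End ℂ X) (D : SymA V) (p : ℂ[X]) :
    aeval (ρ (aM P M κ D)) p = ρ (aM P M κ (aeval D p)) := by
  rw [aeval_algHom_apply, aeval_algHom_apply]

include hB in
/-- A parabolic-stable subspace `F` whose weights are separated from `z` by minimal coset
representatives contains the generalized `z`-eigenvectors of the submodule that it generates. -/
theorem mem_of_mem_span (hM : M ⊆ B) (hN : N ⊆ M) (ρ : HeckeM P M κ →ₐ[ℂ] Module.End ℂ X)
    (D : SymA V) (z : ℂ) (F : Submodule ℂ X) (hF : RepInv (ρ.comp (incM hN)) F)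
    (hwt : ∀ χ, IsWt (ρ.comp (aM P M κ)) F χ → ∀ u ∈ WM P M, u ≠ 1 →
      (∀ j ∈ N, PosV hB (u • P.root j)) → χ (actA P u⁻¹ D) ≠ z) {y : X}
    (hy : y ∈ Submodule.span ℂ {y | ∃ h, ∃ x ∈ F, y = ρ h x})
    (hyz : y ∈ (ρ (aM P M κ D)).maxGenEigenspace z) : y ∈ F := by
  have hFa : ∀ a, ∀ x ∈ F, ρ (aM P M κ a) x ∈ F := fun a x hx => by
    have := hF (aM P N κ a) x hx
    rwa [AlgHom.comp_apply, incM_aM] at this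
  have hFp : ∀ p : ℂ[X], ∀ x ∈ F, aeval (ρ (aM P M κ D)) p x ∈ F := fun p x hx => by
    rw [aeval_rep_aM]
    exact hFa _ x hx
  have hmul : ∀ (p q : ℂ[X]) (x : X), aeval (ρ (aM P M κ D)) (p * q) x =
      aeval (ρ (aM P M κ D)) p (aeval (ρ (aM P M κ D)) q x) :=
    fun p q x => by rw [map_mul, Module.End.mul_apply]
  -- The vectors that die in `X / F` after localizing polynomials in `D` at `z`. The generalized
  -- `z`-eigenspace meets `Z` inside `F`, so it suffices that `Z` contains all translates of `F`.
  let Z : Submodule ℂ X :=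
    { carrier := {y | ∃ p : ℂ[X], p.eval z ≠ 0 ∧ aeval (ρ (aM P M κ D)) p y ∈ F}
      zero_mem' := ⟨1, by simp, by rw [map_zero]; exact zero_mem F⟩
      add_mem' := by
        rintro a b ⟨p, hp, hpa⟩ ⟨q, hq, hqb⟩
        refine ⟨p * q, by rw [eval_mul]; exact mul_ne_zero hp hq, ?_⟩
        rw [map_add]
        refine add_mem ?_ ?_
        · rw [mul_comm p q, hmul]
          exact hFp _ _ hpa
        · rw [hmul]
          exact hFp _ _ hqb
      smul_mem' := by
        rintro c a ⟨p, hp, hpa⟩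
        exact ⟨p, hp, by rw [map_smul]; exact F.smul_mem c hpa⟩ }
  have hFZ : F ≤ Z := fun x hx => ⟨1, by simp, by rw [map_one]; exact hx⟩
  have key : ∀ n, ∀ w : WM P M, len M (w : P.weylGroup) = n → ∀ x ∈ F, ρ (tM P M κ w) x ∈ Z := by
    intro n
    induction n using Nat.strong_induction_on with
    | _ n ih =>
      intro w hw x hx
      have hG : ∀ h ∈ lenLT P M κ n, ∀ x ∈ F, ρ h x ∈ Z := by
        intro h hh x hx
        induction hh using Submodule.span_induction with
        | mem h hh =>
          obtain ⟨w, a, hlt, rfl⟩ := hh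
          rw [map_mul, Module.End.mul_apply]
          exact ih _ hlt w rfl _ (hFa a x hx)
        | zero => rw [map_zero]; exact zero_mem Z
        | add a b _ _ ha hb => rw [map_add]; exact add_mem ha hb
        | smul c a _ ha => rw [map_smul]; exact Z.smul_mem c ha
      obtain ⟨u, hu, y, hy, hwuy, hupos, hle⟩ := exists_coset_rep hB hM hN w.2
      have hwe : w = ⟨u, hu⟩ * ⟨y, WM_mono hN hy⟩ := Subtype.ext hwuy
      have hx' : ρ (tM P M κ ⟨y, WM_mono hN hy⟩) x ∈ F := by
        have := hF (tM P N κ ⟨y, hy⟩) x hx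
        rwa [AlgHom.comp_apply, incM_tM] at this
      rw [hwe, map_mul (tM P M κ), map_mul, Module.End.mul_apply]
      set x' := ρ (tM P M κ ⟨y, WM_mono hN hy⟩) x
      by_cases hu1 : u = 1
      · have : (⟨u, hu⟩ : WM P M) = 1 := Subtype.ext hu1
        rw [this, map_one, map_one]
        exact hFZ hx'
      · set E := actA P u⁻¹ D with hE
        set T := (ρ (aM P M κ E)).restrict (hFa E) with hT
        set r := minpoly ℂ T with hr
        -- A root of the minimal polynomial of `u⁻¹D` on `F` is the value of some weight of `F`
        -- there, and separation forbids the value `z`.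
        have hrz : r.eval z ≠ 0 := by
          intro h0
          obtain ⟨v, hv⟩ := (Module.End.hasEigenvalue_of_isRoot (f := T) (μ := z)
            h0).exists_hasEigenvector
          obtain ⟨χ, hχ, hχz⟩ := exists_isWt_of_eigenvector (ρ.comp (aM P M κ)) (U := F) hFa (b := E)
            (z := z) v.2 (fun h => hv.2 (Subtype.ext h)) (congrArg Subtype.val hv.apply_eq_smul)
          exact hwt χ hχ u hu hu1 hupos hχz
        have hrx : aeval (ρ (aM P M κ E)) r x' = 0 := by
          have h1 : aeval T r = 0 := minpoly.aeval ℂ T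
          have h2 : ∀ p : ℂ[X], ∀ v : F, ((aeval T p) v : X) = aeval (ρ (aM P M κ E)) p (v : X) := by
            intro p v
            induction p using Polynomial.induction_on' with
            | add p q hp hq => simp [hp, hq]
            | monomial n c =>
              rw [aeval_monomial, aeval_monomial, Module.End.mul_apply, Module.End.mul_apply,
                Module.algebraMap_end_apply, Module.algebraMap_end_apply, hT,
                Module.End.pow_restrict]
              rfl
          rw [← h2 r ⟨x', hx'⟩, h1]
          rfl
        have h1 := aM_mul_tM_sub_mem (κ := κ) (⟨u, hu⟩ : WM P M) (aeval D r)
        -- Up to shorter elements `r(D) t_u = t_u r(u⁻¹D)`, and `r(u⁻¹D)` kills `x'`. So `r(D) t_u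
        -- x'` is in `Z` by induction.
        have h2 : aeval (ρ (aM P M κ D)) r (ρ (tM P M κ ⟨u, hu⟩) x') ∈ Z := by
          have h3 := hG _ (lenLT_mono (hle.trans hw.le) h1) x' hx'
          rw [map_sub, LinearMap.sub_apply, map_mul, map_mul, Module.End.mul_apply,
            Module.End.mul_apply] at h3
          change _ - ρ (tM P M κ ⟨u, hu⟩) (ρ (aM P M κ (actA P u⁻¹ (aeval D r))) x') ∈ Z at h3
          rw [← aeval_algHom_apply (actA P u⁻¹), ← hE, ← aeval_rep_aM ρ E, hrx, map_zero,
            sub_zero, ← aeval_rep_aM] at h3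
          exact h3
        obtain ⟨p, hp, hpF⟩ := h2
        exact ⟨p * r, by rw [eval_mul]; exact mul_ne_zero hp hrz, by rw [hmul]; exact hpF⟩
  have hall : ∀ h, ∀ x ∈ F, ρ h x ∈ Z := by
    intro h x hx
    have h1 : h ∈ Submodule.span ℂ {h : HeckeM P M κ | ∃ w a, h = tM P M κ w * aM P M κ a} := by
      rw [span_tM_mul_aM]
      trivial
    induction h1 using Submodule.span_induction with
    | mem h hh =>
      obtain ⟨w, a, rfl⟩ := hh
      rw [map_mul, Module.End.mul_apply]
      exact key _ w rfl _ (hFa a x hx)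
    | zero => rw [map_zero]; exact zero_mem Z
    | add a b _ _ ha hb => rw [map_add]; exact add_mem ha hb
    | smul c a _ ha => rw [map_smul]; exact Z.smul_mem c ha
  have hyZ : y ∈ Z := by
    refine (Submodule.span_le.mpr ?_) hy
    rintro _ ⟨h, x, hx, rfl⟩
    exact hall h x hx
  obtain ⟨p, hp, hpF⟩ := hyZ
  obtain ⟨k, hk⟩ := (Module.End.mem_maxGenEigenspace _ _ _).mp hyz
  -- `p` does not vanish at `z`, so it is invertible on vectors killed by a power of `D - z`, with
  -- an inverse that is a polynomial in `D` and so preserves `F`.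
  have hco : IsCoprime ((Polynomial.X - C z) ^ k) p :=
    ((irreducible_X_sub_C z).coprime_iff_not_dvd.mpr (fun h => hp (dvd_iff_isRoot.mp h))).pow_left
  obtain ⟨a, b, hab⟩ := hco
  have happ : aeval (ρ (aM P M κ D)) ((Polynomial.X - C z) ^ k) y = 0 := by
    rw [map_pow, map_sub, aeval_X, aeval_C, Algebra.algebraMap_eq_smul_one, hk]
  have h1 : y = aeval (ρ (aM P M κ D)) (a * (Polynomial.X - C z) ^ k + b * p) y := by
    rw [hab, map_one]
    rfl
  rw [h1, map_add, LinearMap.add_apply, hmul, happ, map_zero, zero_add, hmul]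
  exact hFp _ _ hpF

theorem commute_aM {D : SymA V} (hD : ∀ j ∈ N, refl P j D = D) (h : HeckeM P N κ) :
    Commute (aM P N κ D) h := by
  have h1 : h ∈ Submodule.span ℂ {h : HeckeM P N κ | ∃ w a, h = tM P N κ w * aM P N κ a} := by
    rw [span_tM_mul_aM]
    trivial
  induction h1 using Submodule.span_induction with
  | mem h hh =>
    obtain ⟨w, a, rfl⟩ := hh
    refine (commute_aM_tM hD w).mul_right ?_
    rw [commute_iff_eq, ← map_mul, ← map_mul, mul_comm]
  | zero => exact Commute.zero_right _
  | add a b _ _ ha hb => exact ha.add_right hb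
  | smul c a _ ha => exact ha.smul_right c

theorem repInv_maxGenEigenspace (hN : N ⊆ M) {D : SymA V} (hD : ∀ j ∈ N, refl P j D = D) (z : ℂ)
    (ρ : HeckeM P M κ →ₐ[ℂ] Module.End ℂ X) :
    RepInv (ρ.comp (incM hN)) ((ρ (aM P M κ D)).maxGenEigenspace z) := by
  intro h x hx
  refine Module.End.mapsTo_maxGenEigenspace_of_comm (g := ρ.comp (incM hN) h) ?_ z hx
  have := ((commute_aM hD h).map (incM hN)).map ρ
  rwa [incM_aM] at this

/-- The weights with value `z` at `D` are separated from their images under nontrivial minimal coset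
representatives. -/
def Separated (N : Finset ι) (D : SymA V) (z : ℂ) (ρ : HeckeM P M κ →ₐ[ℂ] Module.End ℂ X) : Prop :=
  ∀ χ, IsWt (ρ.comp (aM P M κ)) ⊤ χ → χ D = z → ∀ u ∈ WM P M, u ≠ 1 →
    (∀ j ∈ N, PosV hB (u • P.root j)) → χ (actA P u⁻¹ D) ≠ z

theorem weight_apply_of_mem {ρ : HeckeM P M κ →ₐ[ℂ] Module.End ℂ X} {D : SymA V} {z : ℂ} {x : X}
    (hx : x ∈ (ρ (aM P M κ D)).maxGenEigenspace z) (hx0 : x ≠ 0) {χ : SymA V →ₐ[ℂ] ℂ}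
    (hχ : ∀ a, ρ.comp (aM P M κ) a x = χ a • x) : χ D = z :=
  eq_of_mem_maxGenEigenspace hx hx0 (hχ D)

/-- The span of the translates of a subspace is stable. -/
theorem repInv_span {H : Type*} [Ring H] [Algebra ℂ H] (ρ : H →ₐ[ℂ] Module.End ℂ X)
    (F : Submodule ℂ X) : RepInv ρ (Submodule.span ℂ {y | ∃ h, ∃ x ∈ F, y = ρ h x}) := by
  intro g y hy
  induction hy using Submodule.span_induction with
  | mem y hy =>
    obtain ⟨h, x, hx, rfl⟩ := hy
    exact Submodule.subset_span ⟨g * h, x, hx, by rw [map_mul, Module.End.mul_apply]⟩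
  | zero => rw [map_zero]; exact zero_mem _
  | add a b _ _ ha hb => rw [map_add]; exact add_mem ha hb
  | smul c a _ ha => rw [map_smul]; exact Submodule.smul_mem _ c ha

theorem le_span_rep {H : Type*} [Ring H] [Algebra ℂ H] (ρ : H →ₐ[ℂ] Module.End ℂ X)
    (F : Submodule ℂ X) : F ≤ Submodule.span ℂ {y | ∃ h, ∃ x ∈ F, y = ρ h x} :=
  fun x hx => Submodule.subset_span ⟨1, x, hx, by rw [map_one]; rfl⟩

/-- A nonzero stable subspace of the eigenspace generates all of `X`, yet by separation the
generated module meets the eigenspace in that subspace only. -/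
theorem isIrrRep_maxGenEigenspace (hM : M ⊆ B) (hN : N ⊆ M) {D : SymA V}
    (hD : ∀ j ∈ N, refl P j D = D) {z : ℂ} {ρ : HeckeM P M κ →ₐ[ℂ] Module.End ℂ X}
    (hρ : IsIrrRep ρ) (hsep : Separated hB N D z ρ)
    (hE : (ρ (aM P M κ D)).maxGenEigenspace z ≠ ⊥) :
    IsIrrRep (subRep (ρ.comp (incM hN)) _ (repInv_maxGenEigenspace hN hD z ρ)) := by
  set E := (ρ (aM P M κ D)).maxGenEigenspace z with hEdef
  refine ⟨Submodule.nontrivial_iff_ne_bot.mpr hE, fun U hU => ?_⟩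
  refine or_iff_not_imp_left.mpr fun hU0 => ?_
  set F := U.map E.subtype with hF
  have hFE : F ≤ E := by
    rintro _ ⟨x, _, rfl⟩
    exact x.2
  have hF0 : F ≠ ⊥ := fun h => hU0 ((Submodule.map_injective_of_injective
    E.injective_subtype) (h.trans (Submodule.map_bot _).symm))
  have hFinv : RepInv (ρ.comp (incM hN)) F := by
    rintro h _ ⟨x, hx, rfl⟩
    exact ⟨_, hU h x hx, rfl⟩
  have hspan := (hρ.eq_bot_or_top _ (repInv_span ρ F)).resolve_left (fun h =>
    hF0 (le_bot_iff.mp (h ▸ le_span_rep ρ F)))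
  rw [eq_top_iff]
  intro x _
  have h1 : (x : X) ∈ F := by
    refine mem_of_mem_span hB hM hN ρ D z F hFinv ?_ (hspan ▸ Submodule.mem_top) x.2
    rintro χ ⟨y, hy, hy0, hχ⟩
    exact hsep χ ⟨y, trivial, hy0, hχ⟩ (weight_apply_of_mem (hFE hy) hy0 hχ)
  obtain ⟨y, hy, hyx⟩ := h1
  rwa [← Subtype.ext hyx]

variable {Y : Type u} [AddCommGroup Y] [Module ℂ Y] [FiniteDimensional ℂ Y]

section Product

variable {H : Type*} [Ring H] [Algebra ℂ H]

/-- The product of two representations. -/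
def prodRep (ρ : H →ₐ[ℂ] Module.End ℂ X) (ρ' : H →ₐ[ℂ] Module.End ℂ Y) :
    H →ₐ[ℂ] Module.End ℂ (X × Y) :=
  (LinearMap.prodMapAlgHom ℂ X Y).comp (ρ.prod ρ')

theorem prodRep_apply (ρ : H →ₐ[ℂ] Module.End ℂ X) (ρ' : H →ₐ[ℂ] Module.End ℂ Y) (h : H)
    (p : X × Y) : prodRep ρ ρ' h p = (ρ h p.1, ρ' h p.2) := rfl

/-- A stable subspace of a product that is in general position is the graph of an isomorphism. -/
theorem repIso_of_prod {ρ : H →ₐ[ℂ] Module.End ℂ X} {ρ' : H →ₐ[ℂ] Module.End ℂ Y}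
    (hρ : IsIrrRep ρ) (hρ' : IsIrrRep ρ') {T : Submodule ℂ (X × Y)} (hT : RepInv (prodRep ρ ρ') T)
    {x : X} {y : Y} (hx : x ≠ 0) (hy : y ≠ 0) (hxy : (x, y) ∈ T) (h1 : (x, 0) ∉ T)
    (h2 : (0, y) ∉ T) : RepIso ρ ρ' := by
  have hfst : T.map (LinearMap.fst ℂ X Y) = ⊤ := by
    refine (hρ.eq_bot_or_top _ ?_).resolve_left fun h => ?_
    · rintro h _ ⟨y, hy, rfl⟩
      exact ⟨_, hT h y hy, rfl⟩
    · have h1 : x ∈ T.map (LinearMap.fst ℂ X Y) := ⟨_, hxy, rfl⟩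
      rw [h, Submodule.mem_bot] at h1
      exact hx h1
  have hsnd : T.map (LinearMap.snd ℂ X Y) = ⊤ := by
    refine (hρ'.eq_bot_or_top _ ?_).resolve_left fun h => ?_
    · rintro h _ ⟨y, hy, rfl⟩
      exact ⟨_, hT h y hy, rfl⟩
    · have h1 : y ∈ T.map (LinearMap.snd ℂ X Y) := ⟨_, hxy, rfl⟩
      rw [h, Submodule.mem_bot] at h1
      exact hy h1
  have hinr : T.comap (LinearMap.inr ℂ X Y) = ⊥ := by
    refine (hρ'.eq_bot_or_top _ ?_).resolve_right fun h => ?_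
    · intro h y hy
      have h1 := hT h _ hy
      rw [LinearMap.inr_apply, prodRep_apply, map_zero] at h1
      exact h1
    · have h3 : y ∈ T.comap (LinearMap.inr ℂ X Y) := h ▸ Submodule.mem_top
      exact h2 h3
  have hinl : T.comap (LinearMap.inl ℂ X Y) = ⊥ := by
    refine (hρ.eq_bot_or_top _ ?_).resolve_right fun h => ?_
    · intro h y hy
      have h1 := hT h _ hy
      rw [LinearMap.inl_apply, prodRep_apply, map_zero] at h1
      exact h1
    · have h3 : x ∈ T.comap (LinearMap.inl ℂ X Y) := h ▸ Submodule.mem_top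
      exact h1 h3
  have hf : Function.Bijective ((LinearMap.fst ℂ X Y).comp T.subtype) := by
    constructor
    · rw [← LinearMap.ker_eq_bot, LinearMap.ker_eq_bot']
      rintro ⟨⟨x, y⟩, hxy⟩ h
      obtain rfl : x = 0 := h
      have : y ∈ T.comap (LinearMap.inr ℂ X Y) := hxy
      rw [hinr, Submodule.mem_bot] at this
      subst this
      rfl
    · intro x
      have h1 : x ∈ T.map (LinearMap.fst ℂ X Y) := hfst ▸ Submodule.mem_top
      obtain ⟨y, hy, rfl⟩ := h1
      exact ⟨⟨y, hy⟩, rfl⟩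
  have hg : Function.Bijective ((LinearMap.snd ℂ X Y).comp T.subtype) := by
    constructor
    · rw [← LinearMap.ker_eq_bot, LinearMap.ker_eq_bot']
      rintro ⟨⟨x, y⟩, hxy⟩ h
      obtain rfl : y = 0 := h
      have : x ∈ T.comap (LinearMap.inl ℂ X Y) := hxy
      rw [hinl, Submodule.mem_bot] at this
      subst this
      rfl
    · intro x
      have h1 : x ∈ T.map (LinearMap.snd ℂ X Y) := hsnd ▸ Submodule.mem_top
      obtain ⟨y, hy, rfl⟩ := h1
      exact ⟨⟨y, hy⟩, rfl⟩
  refine ⟨(LinearEquiv.ofBijective _ hf).symm.trans (LinearEquiv.ofBijective _ hg), fun h x => ?_⟩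
  obtain ⟨y, rfl⟩ := (LinearEquiv.ofBijective _ hf).surjective x
  have h1 : ρ h (LinearEquiv.ofBijective _ hf y) =
      LinearEquiv.ofBijective _ hf ⟨prodRep ρ ρ' h y, hT h y y.2⟩ := rfl
  rw [h1, LinearEquiv.trans_apply, LinearEquiv.trans_apply, LinearEquiv.symm_apply_apply,
    LinearEquiv.symm_apply_apply]
  rfl

end Product

/-- The graph of the given isomorphism generates a submodule of `X × Y` whose generalized
`z`-eigenvectors lie in the graph. So it contains neither `(x, 0)` nor `(0, e x)` for `x ≠ 0` in the
eigenspace, and is itself the graph of an isomorphism. -/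
theorem repIso_of_maxGenEigenspace (hM : M ⊆ B) (hN : N ⊆ M) {D : SymA V}
    (hD : ∀ j ∈ N, refl P j D = D) {z : ℂ} {ρ : HeckeM P M κ →ₐ[ℂ] Module.End ℂ X}
    {ρ' : HeckeM P M κ →ₐ[ℂ] Module.End ℂ Y}
    (hρ : IsIrrRep ρ) (hρ' : IsIrrRep ρ') (hsep : Separated hB N D z ρ)
    (hE : (ρ (aM P M κ D)).maxGenEigenspace z ≠ ⊥)
    (hiso : RepIso (subRep (ρ.comp (incM hN)) _ (repInv_maxGenEigenspace hN hD z ρ))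
      (subRep (ρ'.comp (incM hN)) _ (repInv_maxGenEigenspace hN hD z ρ'))) : RepIso ρ ρ' := by
  set E := (ρ (aM P M κ D)).maxGenEigenspace z with hEdef
  set E' := (ρ' (aM P M κ D)).maxGenEigenspace z with hEdef'
  obtain ⟨e, he⟩ := hiso
  set R := prodRep ρ ρ' with hR
  set F : Submodule ℂ (X × Y) := LinearMap.range (E.subtype.prod (E'.subtype ∘ₗ e.toLinearMap))
    with hF
  have hFmem : ∀ x : E, ((x : X), (e x : Y)) ∈ F := fun x => ⟨x, rfl⟩
  have hFinv : RepInv (R.comp (incM hN)) F := by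
    rintro h _ ⟨x, rfl⟩
    refine ⟨subRep (ρ.comp (incM hN)) _ (repInv_maxGenEigenspace hN hD z ρ) h x, ?_⟩
    change ((_ : X), (e _ : Y)) = _
    rw [he]
    rfl
  set T := Submodule.span ℂ {y | ∃ h, ∃ x ∈ F, y = R h x} with hT
  have hTinv : RepInv R T := repInv_span R F
  have hFT : F ≤ T := le_span_rep R F
  obtain ⟨x₀, hx₀, hx₀0⟩ := (Submodule.ne_bot_iff E).mp hE
  have hx₀e : e ⟨x₀, hx₀⟩ ≠ 0 := fun h => hx₀0 (congrArg Subtype.val (e.map_eq_zero_iff.mp h))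
  have hpow : ∀ k x y, ((R (aM P M κ D) - z • (1 : Module.End ℂ (X × Y))) ^ k) (x, y) =
      (((ρ (aM P M κ D) - z • (1 : Module.End ℂ X)) ^ k) x,
        ((ρ' (aM P M κ D) - z • (1 : Module.End ℂ Y)) ^ k) y) := by
    intro k
    induction k with
    | zero => exact fun _ _ => rfl
    | succ k ih =>
      intro x y
      rw [pow_succ, pow_succ, pow_succ, Module.End.mul_apply, Module.End.mul_apply,
        Module.End.mul_apply, ← ih]
      rfl
  have hTF : ∀ y ∈ T, y ∈ (R (aM P M κ D)).maxGenEigenspace z → y ∈ F := by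
    intro y hy hyz
    refine mem_of_mem_span hB hM hN R D z F hFinv ?_ hy hyz
    rintro χ ⟨_, ⟨x, rfl⟩, hx0, hχ⟩
    have hx0' : (x : X) ≠ 0 := by
      intro h
      have h1 : x = 0 := Subtype.ext h
      rw [h1, map_zero] at hx0
      exact hx0 rfl
    have hχ' : ∀ a, ρ.comp (aM P M κ) a x = χ a • (x : X) := fun a => congrArg Prod.fst (hχ a)
    exact hsep χ ⟨x, trivial, hx0', hχ'⟩ (weight_apply_of_mem x.2 hx0' hχ')
  refine repIso_of_prod hρ hρ' hTinv hx₀0 (fun h => hx₀e (Subtype.ext h))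
    (hFT (hFmem ⟨x₀, hx₀⟩)) (fun h1 => ?_) (fun h1 => ?_)
  · obtain ⟨k, hk⟩ := (Module.End.mem_maxGenEigenspace _ _ _).mp hx₀
    obtain ⟨x, hx⟩ := hTF _ h1 ((Module.End.mem_maxGenEigenspace _ _ _).mpr ⟨k, by
      rw [hpow, hk, map_zero]
      rfl⟩)
    have h2 : (x : X) = x₀ := congrArg Prod.fst hx
    have h3 : (e x : Y) = 0 := congrArg Prod.snd hx
    have h4 : x = 0 := e.map_eq_zero_iff.mp (Subtype.ext h3)
    rw [h4] at h2
    exact hx₀0 h2.symm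
  · obtain ⟨k, hk⟩ := (Module.End.mem_maxGenEigenspace _ _ _).mp (e ⟨x₀, hx₀⟩).2
    obtain ⟨x, hx⟩ := hTF _ h1 ((Module.End.mem_maxGenEigenspace _ _ _).mpr ⟨k, by
      rw [hpow, hk, map_zero]
      rfl⟩)
    have h2 : (x : X) = 0 := congrArg Prod.fst hx
    have h3 : (e x : Y) = e ⟨x₀, hx₀⟩ := congrArg Prod.snd hx
    have h4 : x = 0 := Subtype.ext h2
    rw [h4, map_zero] at h3
    exact hx₀e (Subtype.ext h3.symm)

end Core

/-! ### Vanishing on proper parabolic subalgebras bounds the weights -/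

section Positivity

open Polynomial

variable {ι V V' : Type*} [AddCommGroup V] [Module ℝ V] [AddCommGroup V'] [Module ℝ V']
variable {P : RootPairing ι ℝ V V'} {κ : ι → ℝ} [Fintype ι] [P.IsReduced] {B : Finset ι}
variable (hB : IsSimpleRoots P B) {M : Finset ι}

/-- The trace of an endomorphism whose range lies in a subspace is the trace on that subspace. -/
theorem trace_restrict_of_range_le {X : Type u} [AddCommGroup X] [Module ℂ X]
    [FiniteDimensional ℂ X] {E : Submodule ℂ X} {f : Module.End ℂ X} (hf : ∀ x, f x ∈ E)
    {g : Module.End ℂ E} (hg : ∀ x : E, (g x : X) = f x) :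
    LinearMap.trace ℂ E g = LinearMap.trace ℂ X f := by
  rw [trace_eq_trace_restrict_add_trace_mapQ E f (fun x _ => hf x)]
  have h1 : E.mapQ E f (fun x _ => hf x) = 0 := by
    ext x
    simp [hf x]
  have h2 : g = f.restrict (fun x _ => hf x) := by
    ext x
    exact hg x
  rw [h1, map_zero, add_zero, h2]

include hB in
/-- A family of representations without isomorphic members whose characters satisfy a linear relation
on all proper parabolic subalgebras has only weights that are nonpositive on dominant vectors. -/
theorem weight_nonpos (hM : M ⊆ B) {J : Type*} [Fintype J] (X : J → Type u)
    [∀ j, AddCommGroup (X j)] [∀ j, Module ℂ (X j)] [∀ j, FiniteDimensional ℂ (X j)]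
    (ρ : ∀ j, HeckeM P M κ →ₐ[ℂ] Module.End ℂ (X j)) (hirr : ∀ j, IsIrrRep (ρ j))
    (hiso : ∀ i j, RepIso (ρ i) (ρ j) → i = j) (c : J → ℂ) (hc : ∀ j, c j ≠ 0)
    (hpar : ∀ N (hN : N ⊆ M), N ≠ M → ∀ h : HeckeM P N κ,
      ∑ j, c j * repChar (ρ j) (incM hN h) = 0)
    (π : ℂ →ₗ[ℝ] ℝ) (j : J) {χ : SymA V →ₐ[ℂ] ℂ} (hχ : IsWt ((ρ j).comp (aM P M κ)) ⊤ χ) {v : V}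
    (hv : v ∈ US P M) (hdom : Dominant P M v) : π (χ (ofV v)) ≤ 0 := by
  classical
  by_contra hpos
  push Not at hpos
  have hfin : ∀ j, Finite {χ | IsWt ((ρ j).comp (aM P M κ)) ⊤ χ} := fun j =>
    (finite_isWt ((ρ j).comp (aM P M κ)) ⊤).to_subtype
  -- The maximum runs over the weights of all representations at once, so that the same `ω` and `z`
  -- separate weights in each of them.
  obtain ⟨⟨j₀, χ₀, hχ₀⟩, ω, m, hω, hωdom, hq, hm, hFω, hmax⟩ := exists_maximal hB hM
    (J := Σ j, {χ | IsWt ((ρ j).comp (aM P M κ)) ⊤ χ})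
    (fun p => π ∘ₗ (p.2.1.toLinearMap.restrictScalars ℝ) ∘ₗ ofVL) ⟨j, χ, hχ⟩ hv hdom hpos
  have hmax' : ∀ j χ, IsWt ((ρ j).comp (aM P M κ)) ⊤ χ → ∀ v ∈ US P M, Dominant P M v →
    π (χ (ofV v)) ≤ m * √(P.RootForm v v) := fun j χ hχ => hmax ⟨j, χ, hχ⟩
  replace hFω : π (χ₀ (ofV ω)) = m := hFω
  set z := χ₀ (ofV ω) with hz
  set N := M.filter fun j => P.coroot' j ω = 0 with hNdef
  have hN : N ⊆ M := Finset.filter_subset _ _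
  have hNM : N ≠ M := by
    intro h
    have h1 : ω = 0 := eq_zero_of_mem_US hω fun j hj => by
      rw [← h, hNdef, Finset.mem_filter] at hj
      exact hj.2
    rw [h1] at hq
    simp at hq
  have hD : ∀ j ∈ N, refl P j (ofV ω) = ofV ω := fun j hj => by
    rw [hNdef, Finset.mem_filter] at hj
    rw [refl_eq_actA, actA_ofV, refIdx_smul, hj.2, zero_smul, sub_zero]
  have hsep : ∀ j, Separated hB N (ofV ω) z (ρ j) := by
    intro j χ hχ hχz u hu hu1 hupos heq
    have h1 := lt_of_maximal hB hM hω hωdom hq hm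
      (F := π ∘ₗ (χ.toLinearMap.restrictScalars ℝ) ∘ₗ ofVL) (hmax' j χ hχ)
      (by change π (χ (ofV ω)) = m; rw [hχz, hFω]) hu hu1
      (fun j hj h0 => hupos j (Finset.mem_filter.mpr ⟨hj, h0⟩))
    rw [actA_ofV] at heq
    change π (χ (ofV (u⁻¹ • ω))) < m at h1
    rw [heq, hFω] at h1
    exact lt_irrefl _ h1
  set E : ∀ j, Submodule ℂ (X j) := fun j => (ρ j (aM P M κ (ofV ω))).maxGenEigenspace z with hE
  have hE0 : E j₀ ≠ ⊥ := by
    obtain ⟨x, _, hx0, hx⟩ := hχ₀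
    intro h
    refine hx0 ((Submodule.mem_bot ℂ).mp (h ▸ ?_))
    refine (Module.End.mem_maxGenEigenspace _ _ _).mpr ⟨1, ?_⟩
    rw [pow_one, LinearMap.sub_apply, LinearMap.smul_apply, Module.End.one_apply, sub_eq_zero]
    exact hx (ofV ω)
  have hLI := linearIndependent_repChar (fun j : {j // E j ≠ ⊥} => E j)
    (fun j => subRep ((ρ j).comp (incM hN)) _ (repInv_maxGenEigenspace hN hD z (ρ j)))
    (fun j => isIrrRep_maxGenEigenspace hB hM hN hD (hirr j) (hsep j) j.2)
    (fun i j hij => Subtype.ext (hiso _ _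
      (repIso_of_maxGenEigenspace hB hM hN hD (hirr i) (hirr j) (hsep i) i.2 hij)))
  -- The trace of `h` on every eigenspace is the trace of `h p(ω)` on the whole module, and `h p(ω)`
  -- again comes from `H_N`, where the relation holds.
  obtain ⟨p, hp⟩ := exists_aeval_eq_proj (fun j => ρ j (aM P M κ (ofV ω))) z
  have htr : ∀ j h, repChar (subRep ((ρ j).comp (incM hN)) _
      (repInv_maxGenEigenspace hN hD z (ρ j))) h =
      repChar (ρ j) (incM hN (h * aM P N κ (aeval (ofV ω) p))) := by
    intro j h
    rw [repChar_apply, repChar_apply]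
    have hcomm : ρ j (incM hN (h * aM P N κ (aeval (ofV ω) p))) =
        ρ j (incM hN h) * aeval (ρ j (aM P M κ (ofV ω))) p := by
      rw [map_mul (incM hN), map_mul, incM_aM, aeval_rep_aM]
    rw [hcomm]
    refine trace_restrict_of_range_le (fun x => ?_) (fun x => ?_)
    · exact repInv_maxGenEigenspace hN hD z (ρ j) h _ ((hp j).1 x)
    · rw [subRep_apply_coe, Module.End.mul_apply, (hp j).2 x x.2]
      rfl
  have hsum : ∑ j : {j // E j ≠ ⊥}, c j • repChar (subRep ((ρ j).comp (incM hN)) _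
      (repInv_maxGenEigenspace hN hD z (ρ j))) = 0 := by
    ext h
    rw [LinearMap.sum_apply, LinearMap.zero_apply,
      ← hpar N hN hNM (h * aM P N κ (aeval (ofV ω) p))]
    simp only [LinearMap.smul_apply, smul_eq_mul, htr]
    rw [← Finset.sum_subtype (Finset.univ.filter fun j => E j ≠ ⊥) (fun j => by simp)
      (fun j => c j * repChar (ρ j) (incM hN (h * aM P N κ (aeval (ofV ω) p))))]
    refine Finset.sum_subset (Finset.subset_univ _) fun j _ hj => ?_
    have hj' : E j = ⊥ := by simpa using hj
    have h0 : ρ j (incM hN (h * aM P N κ (aeval (ofV ω) p))) = 0 := by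
      ext x
      have h1 := (hp j).1 x
      change _ ∈ E j at h1
      rw [hj', Submodule.mem_bot] at h1
      rw [map_mul (incM hN), map_mul, incM_aM, ← aeval_rep_aM, Module.End.mul_apply, h1, map_zero]
      rfl
    rw [repChar_apply, h0, map_zero, mul_zero]
  exact hc j₀ (Fintype.linearIndependent_iff.mp hLI (fun j => c j) hsum ⟨j₀, hE0⟩)

end Positivity

/-! ### A sign character recording the signs of the parameters -/

section SignCharacter

variable {ι V V' : Type*} [AddCommGroup V] [Module ℝ V] [AddCommGroup V'] [Module ℝ V']
variable {P : RootPairing ι ℝ V V'} [Fintype ι] [P.IsReduced] {B : Finset ι}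
variable (hB : IsSimpleRoots P B) (κ : ι → ℝ)

open Classical in
/-- The sign of a root. -/
def posSign (i : ι) : ℝ := if PosV hB (P.root i) then 1 else -1

theorem posSign_of_eq_neg {i j : ι} (h : P.root i = -P.root j) :
    posSign hB i = -posSign hB j := by
  unfold posSign
  by_cases hj : PosV hB (P.root j)
  · have : ¬ PosV hB (P.root i) := h ▸ not_posV_both hB hj
    rw [if_neg this, if_pos hj]
  · have : PosV hB (P.root i) := h ▸ posV_neg_of_not hB hj
    rw [if_neg hj, if_pos this, neg_neg]

open Classical in
variable (P B) in
/-- The roots that are conjugate to simple roots with negative parameter. -/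
def negRoots : Finset ι :=
  Finset.univ.filter fun i => ∃ w : P.weylGroup, ∃ j ∈ B, κ j < 0 ∧ P.root i = w • P.root j

theorem smul_mem_negRoots (w : P.weylGroup) {i : ι} (hi : i ∈ negRoots P B κ) :
    w • i ∈ negRoots P B κ := by
  classical
  rw [negRoots, Finset.mem_filter] at hi ⊢
  obtain ⟨_, w', j, hj, hκ, h⟩ := hi
  exact ⟨Finset.mem_univ _, w * w', j, hj, hκ, by rw [root_smul, h, mul_smul]⟩

theorem mem_negRoots_iff (hκ : InvPar P B κ) {j : ι} (hj : j ∈ B) :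
    j ∈ negRoots P B κ ↔ κ j < 0 := by
  classical
  rw [negRoots, Finset.mem_filter]
  constructor
  · rintro ⟨_, w, i, hi, hneg, h⟩
    rwa [hκ i hi j hj ⟨w, h.symm⟩] at hneg
  · exact fun h => ⟨Finset.mem_univ _, 1, j, hj, h, (one_smul _ _).symm⟩

open Classical in
/-- The sign character of the Weyl group attached to the parameter function. -/
def parSign (w : P.weylGroup) : ℝ :=
  ∏ i ∈ (negRoots P B κ).filter fun i => PosV hB (P.root i), posSign hB (w • i)

theorem parSign_one : parSign hB κ 1 = 1 := by
  classical
  refine Finset.prod_eq_one fun i hi => ?_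
  rw [one_smul, posSign, if_pos (Finset.mem_filter.mp hi).2]

/-- `s_j` permutes the positive roots of `negRoots` other than `α_j` and negates `α_j`, which is
among them exactly if `κ j < 0`. This makes the sign depend on the group element only, while on
words it is a product over letters. -/
theorem parSign_mul_refIdx (hκ : InvPar P B κ) (w : P.weylGroup) {j : ι} (hj : j ∈ B) :
    parSign hB κ (w * refIdx P j) = parSign hB κ w * (if κ j < 0 then -1 else 1) := by
  classical
  set S := (negRoots P B κ).filter fun i => PosV hB (P.root i) with hS
  have hjS : j ∈ S ↔ κ j < 0 := by
    rw [hS, Finset.mem_filter, mem_negRoots_iff κ hκ hj]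
    exact ⟨fun h => h.1, fun h => ⟨h, posV_root hB hj⟩⟩
  have hneg : P.root (refIdx P j • j) = -P.root j := by rw [root_smul, refIdx_smul_root]
  have hinv : ∀ i : ι, refIdx P j • refIdx P j • i = i := fun i => by
    rw [← mul_smul, refIdx_mul_self, one_smul]
  have hmaps : ∀ i ∈ S.erase j, refIdx P j • i ∈ S.erase j := by
    intro i hi
    rw [Finset.mem_erase, hS, Finset.mem_filter] at hi ⊢
    refine ⟨fun h => ?_, smul_mem_negRoots κ _ hi.2.1, ?_⟩
    · have h1 := congrArg (refIdx P j • ·) h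
      simp only [hinv] at h1
      have h2 := hi.2.2
      rw [h1, hneg] at h2
      exact not_posV_both hB (posV_root hB hj) h2
    · rw [root_smul]
      exact posV_refIdx hB hj hi.2.2 hi.1
  have hprod : ∏ i ∈ S.erase j, posSign hB ((w * refIdx P j) • i) =
      ∏ i ∈ S.erase j, posSign hB (w • i) :=
    Finset.prod_nbij' (refIdx P j • ·) (refIdx P j • ·) hmaps hmaps (fun i _ => hinv i)
      (fun i _ => hinv i) (fun i _ => by rw [mul_smul])
  change ∏ i ∈ S, _ = (∏ i ∈ S, _) * _
  by_cases h : κ j < 0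
  · rw [if_pos h, ← Finset.mul_prod_erase _ _ (hjS.mpr h), ← Finset.mul_prod_erase _ _ (hjS.mpr h),
      hprod, posSign_of_eq_neg hB (i := (w * refIdx P j) • j) (j := w • j)]
    · ring
    · rw [mul_smul, root_smul, hneg, root_smul, smul_neg]
  · rw [if_neg h, mul_one]
    rwa [Finset.erase_eq_of_notMem (fun h' => h (hjS.mp h'))] at hprod

theorem parSign_wordProd (hκ : InvPar P B κ) {l : List ι} (hl : ∀ i ∈ l, i ∈ B) :
    parSign hB κ (wordProd P l) = (l.map fun i => if κ i < 0 then (-1 : ℝ) else 1).prod := by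
  induction l using List.reverseRecOn with
  | nil => exact parSign_one hB κ
  | append_singleton l i ih =>
    rw [wordProd_append, wordProd_cons, wordProd_nil, mul_one,
      parSign_mul_refIdx hB κ hκ _ (hl i (by simp)), ih fun j hj => hl j (by simp [hj])]
    simp

theorem parSign_refIdx_mul (hκ : InvPar P B κ) {w : P.weylGroup} (hw : w ∈ WM P B) {j : ι}
    (hj : j ∈ B) :
    parSign hB κ (refIdx P j * w) = (if κ j < 0 then -1 else 1) * parSign hB κ w := by
  obtain ⟨l, hl, rfl⟩ := mem_WM_iff.mp hw
  rw [← wordProd_cons, parSign_wordProd hB κ hκ hl, parSign_wordProd hB κ hκ (l := j :: l)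
    (by simpa using ⟨hj, hl⟩), List.map_cons, List.prod_cons]

theorem parSign_ne_zero (w : P.weylGroup) : parSign hB κ w ≠ 0 :=
  Finset.prod_ne_zero_iff.mpr fun i _ => by
    unfold posSign
    split_ifs <;> norm_num

end SignCharacter

/-! ### Independence of the translates of a weight vector -/

section Chains

variable {ι V V' : Type*} [AddCommGroup V] [Module ℝ V] [AddCommGroup V'] [Module ℝ V']
variable {P : RootPairing ι ℝ V V'} {κ : ι → ℝ} [Fintype ι] [P.IsReduced] {B : Finset ι}
variable (hB : IsSimpleRoots P B) {M : Finset ι}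

variable (P M κ) in
/-- The lower terms of the commutation of a vector with the product of a word. -/
def lowerTerm : (l : List M) → V → HeckeM P M κ
  | [], _ => 0
  | i :: l, v => tM P M κ (sM P i.2) * lowerTerm l (refIdx P i • v) +
      ((κ i * P.coroot' i v : ℝ) : ℂ) • tM P M κ (l.map fun i : M => sM P i.2).prod

/-- Iterated cross relation: each lower term deletes one letter `i` of the word, with factor `κ i`
times a coroot pairing. -/
theorem ofV_mul_word (l : List M) (v : V) :
    aM P M κ (ofV v) * tM P M κ (l.map fun i : M => sM P i.2).prod =
      tM P M κ (l.map fun i : M => sM P i.2).prod *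
        aM P M κ (ofV (((l.map fun i : M => sM P i.2).prod : WM P M).1⁻¹ • v)) +
      lowerTerm P κ M l v := by
  induction l generalizing v with
  | nil => simp [lowerTerm]
  | cons i l ih =>
    rw [List.map_cons, List.prod_cons, map_mul (tM P M κ), ← mul_assoc, aM_mul_tM_sM, add_mul,
      mul_assoc, refl_eq_actA, actA_ofV, ih, mul_add, diffOp_ofV, lowerTerm, mul_assoc,
      AlgHom.commutes, smul_mul_assoc, ← Algebra.smul_def,
      smul_smul ((κ i : ℝ) : ℂ)]
    have h1 : ((sM P i.2 * (l.map fun i : M => sM P i.2).prod : WM P M) : P.weylGroup)⁻¹ • v =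
        ((l.map fun i : M => sM P i.2).prod : WM P M).1⁻¹ • refIdx P (i : ι) • v := by
      rw [← mul_smul]
      congr 1
      rw [Subgroup.coe_mul, mul_inv_rev, refIdx_inv]
    rw [h1, Complex.ofReal_mul, add_assoc]

include hB in
theorem parSign_sM_mul (hκ : InvPar P B κ) (hM : M ⊆ B) (i : M) (w : WM P M) :
    parSign hB κ (sM P i.2 * w : WM P M).1 =
      (if κ i < 0 then -1 else 1) * parSign hB κ w.1 :=
  parSign_refIdx_mul hB κ hκ (WM_mono hM w.2) (hM i.2)

theorem len_prod_le (l : List M) : len M ((l.map fun i : M => sM P i.2).prod : WM P M).1 ≤ l.length := by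
  induction l with
  | nil => simp [len_one]
  | cons i l ih =>
    rw [List.map_cons, List.prod_cons, List.length_cons]
    exact (len_refIdx_mul_le (Subtype.mem _) i.2).trans (Nat.succ_le_succ ih)

theorem exists_prod_eq (w : WM P M) :
    ∃ l : List M, (l.map fun i : M => sM P i.2).prod = w ∧ l.length = len M w.1 := by
  obtain ⟨w, hw⟩ := w
  induction hn : len M w generalizing w with
  | zero => exact ⟨[], Subtype.ext (eq_one_of_len hw hn).symm, rfl⟩
  | succ n ih =>
    obtain ⟨i, hi, u, hu, hwu, hlen⟩ := exists_len_descent hw hn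
    obtain ⟨l, hl, hll⟩ := ih u hu hlen
    refine ⟨⟨i, hi⟩ :: l, ?_, by rw [List.length_cons, hll]⟩
    rw [List.map_cons, List.prod_cons, hl]
    exact Subtype.ext hwu.symm

variable (P κ M) in
/-- Combinations of group elements of length at most `n` whose coefficients have the sign
prescribed by `s`. -/
def lowerCone (n : ℕ) (s : ℝ) : AddSubmonoid (HeckeM P M κ) :=
  AddSubmonoid.closure {h | ∃ w : WM P M, len M w.1 ≤ n ∧ ∃ d : ℝ,
    0 ≤ d * parSign hB κ w.1 * s ∧ h = (d : ℂ) • tM P M κ w}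

theorem sM_mul_mem_lowerCone (hκ : InvPar P B κ) (hM : M ⊆ B) (i : M) {n : ℕ} {s : ℝ}
    {h : HeckeM P M κ} (hh : h ∈ lowerCone P κ hB M n s) :
    tM P M κ (sM P i.2) * h ∈ lowerCone P κ hB M (n + 1) ((if κ i < 0 then -1 else 1) * s) := by
  induction hh using AddSubmonoid.closure_induction with
  | mem h hh =>
    obtain ⟨w, hw, d, hd, rfl⟩ := hh
    refine AddSubmonoid.subset_closure ⟨sM P i.2 * w,
      (len_refIdx_mul_le w.2 i.2).trans (Nat.succ_le_succ hw), d, ?_, ?_⟩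
    · rw [parSign_sM_mul hB hκ hM]
      split_ifs <;> linarith
    · rw [mul_smul_comm, map_mul (tM P M κ)]
  | zero => rw [mul_zero]; exact zero_mem _
  | add a b _ _ ha hb => rw [mul_add]; exact add_mem ha hb

theorem sM_mul_lowerTerm_mem (hκ : InvPar P B κ) (hM : M ⊆ B) (i : M) (l : List M) (v : V)
    (h : lowerTerm P κ M l v ∈ lowerCone P κ hB M (l.length - 1)
      (parSign hB κ ((l.map fun i : M => sM P i.2).prod : WM P M).1)) :
    tM P M κ (sM P i.2) * lowerTerm P κ M l v ∈ lowerCone P κ hB M l.length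
      (parSign hB κ (((i :: l).map fun i : M => sM P i.2).prod : WM P M).1) := by
  -- For the empty word the truncated length `0 - 1 = 0` would give the bound one instead of zero,
  -- but then the lower term is zero.
  rcases l with _ | ⟨j, l⟩
  · rw [lowerTerm, mul_zero]
    exact zero_mem _
  · have h2 := sM_mul_mem_lowerCone hB hκ hM i h
    rwa [← parSign_sM_mul hB hκ hM] at h2

/-- Deleting the letter `i` changes the sign character by the sign of `κ i`, which the factor `κ i`
compensates when the coroot pairing is nonnegative. So no two terms can cancel. -/
theorem lowerTerm_mem (hκ : InvPar P B κ) (hM : M ⊆ B) (l : List M) (v : V)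
    (hv : ∀ (l₁ : List M) (i : M) (l₂ : List M), l = l₁ ++ i :: l₂ →
      0 ≤ P.coroot' i (((l₁.map fun i : M => sM P i.2).prod : WM P M).1⁻¹ • v)) :
    lowerTerm P κ M l v ∈ lowerCone P κ hB M (l.length - 1)
      (parSign hB κ ((l.map fun i : M => sM P i.2).prod : WM P M).1) := by
  induction l generalizing v with
  | nil => exact zero_mem _
  | cons i l ih =>
    refine add_mem (sM_mul_lowerTerm_mem hB hκ hM i l _ (ih _ fun l₁ j l₂ hl => ?_))
      (AddSubmonoid.subset_closure ⟨_, len_prod_le l, _, ?_, rfl⟩)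
    · have h3 := hv (i :: l₁) j l₂ (by rw [hl]; rfl)
      rw [List.map_cons, List.prod_cons, Subgroup.coe_mul, mul_inv_rev, refIdx_inv, mul_smul] at h3
      exact h3
    · have h2 : 0 ≤ P.coroot' i v := by simpa using hv [] i l rfl
      rw [List.map_cons, List.prod_cons, parSign_sM_mul hB hκ hM]
      have h3 := mul_self_nonneg (parSign hB κ ((l.map fun i : M => sM P i.2).prod : WM P M).1)
      split_ifs with h
      · nlinarith [mul_nonneg (mul_nonneg (neg_nonneg.mpr h.le) h2) h3]
      · nlinarith [mul_nonneg (mul_nonneg (not_lt.mp h) h2) h3]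

include hB in
/-- Reduced words have nonnegative coefficients at dominant vectors. -/
theorem coroot'_nonneg_of_reduced (hM : M ⊆ B) {v : V} (hv : Dominant P M v) {l₁ : List M} {i : M}
    {l₂ : List M} (hl : len M (((l₁ ++ i :: l₂).map fun i : M => sM P i.2).prod : WM P M).1 =
      (l₁ ++ i :: l₂).length) :
    0 ≤ P.coroot' i (((l₁.map fun i : M => sM P i.2).prod : WM P M).1⁻¹ • v) := by
  set w := (l₁.map fun i : M => sM P i.2).prod with hw
  have h1 : PosV hB (w.1 • P.root i) := by
    by_contra hneg
    rw [← root_smul] at hneg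
    have h2 := posV_neg_of_not hB hneg
    rw [root_smul] at h2
    have h3 := len_mul_refIdx_lt hB hM w.2 i.2 h2
    have h4 := len_prod_le (P := P) l₁
    rw [← hw] at h4
    obtain ⟨l, hl', hll⟩ := exists_prod_eq (w * sM P i.2)
    have h5 : ((l₁ ++ i :: l₂).map fun i : M => sM P i.2).prod =
        ((l ++ l₂).map fun i : M => sM P i.2).prod := by
      rw [List.map_append, List.prod_append, List.map_append, List.prod_append, hl', List.map_cons,
        List.prod_cons, ← hw, mul_assoc]
    rw [h5] at hl
    have h6 := len_prod_le (P := P) (l ++ l₂)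
    have h7 : ((w * sM P i.2 : WM P M) : P.weylGroup) = w * refIdx P i := rfl
    rw [h7] at hll
    rw [hl, List.length_append, List.length_append, List.length_cons, hll] at h6
    omega
  have h2 := coroot'_smul P w.1 i (w.1⁻¹ • v)
  rw [smul_inv_smul] at h2
  rw [← h2]
  refine hv.coroot'_nonneg hB hM ?_ (by rwa [root_smul])
  rw [root_smul]
  exact smul_mem_US w.2 (root_mem_US i.2)

variable {X : Type u} [AddCommGroup X] [Module ℂ X]

include hB in
-- One application of `v` replaces `t_w x` by a sum over deleted letters, since the leading term
-- kills `x`. All contributions have the sign of `parSign`; deleting the first letter of a reduced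
-- word leaves length exactly `n`, and this term is strictly nonzero because `κ` is nonzero and `v`
-- regular.
theorem exists_pow_apply_eq (hκ : InvPar P B κ) (hM : M ⊆ B) (hκ0 : ∀ i ∈ M, κ i ≠ 0)
    (ρ : HeckeM P M κ →ₐ[ℂ] Module.End ℂ X) {x : X}
    (hx : ∀ v ∈ US P M, ρ (aM P M κ (ofV v)) x = 0) {v : V} (hv : v ∈ US P M)
    (hreg : ∀ j ∈ M, 0 < P.coroot' j v) (n : ℕ) (w : WM P M) (hw : len M w.1 ≤ n) :
    ∃ c : ℝ, (ρ (aM P M κ (ofV v)) ^ n) (ρ (tM P M κ w) x) = (c : ℂ) • x ∧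
      0 ≤ c * parSign hB κ w.1 ∧ (len M w.1 = n → 0 < c * parSign hB κ w.1) := by
  induction n generalizing w with
  | zero =>
    have h1 : w = 1 := Subtype.ext (eq_one_of_len w.2 (Nat.le_zero.mp hw))
    rw [h1]
    have h2 : parSign hB κ ((1 : WM P M) : P.weylGroup) = 1 := parSign_one hB κ
    exact ⟨1, by simp, by rw [h2]; norm_num, by rw [h2]; norm_num⟩
  | succ n ih =>
    rcases hw.lt_or_eq with hlt | heq
    · obtain ⟨c, hc, _⟩ := ih w (Nat.lt_succ_iff.mp hlt)
      refine ⟨0, ?_, by simp, fun h => absurd h hlt.ne⟩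
      rw [pow_succ', Module.End.mul_apply, hc, map_smul, hx v hv, smul_zero, Complex.ofReal_zero,
        zero_smul]
    · obtain ⟨l, rfl, hl⟩ := exists_prod_eq w
      rw [heq] at hl
      obtain ⟨i, l, rfl⟩ := List.exists_cons_of_length_eq_add_one hl
      have hl' : l.length = n := Nat.succ.inj hl
      have hgood : ∀ (l₁ : List M) (j : M) (l₂ : List M), i :: l = l₁ ++ j :: l₂ →
          0 ≤ P.coroot' j (((l₁.map fun i : M => sM P i.2).prod : WM P M).1⁻¹ • v) := by
        intro l₁ j l₂ hl₁
        refine coroot'_nonneg_of_reduced hB hM (fun j hj => (hreg j hj).le) (l₂ := l₂) ?_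
        rw [← hl₁, heq, hl]
      have hcone : ∀ {s : ℝ} {h : HeckeM P M κ}, h ∈ lowerCone P κ hB M n s →
          ∃ c : ℝ, (ρ (aM P M κ (ofV v)) ^ n) (ρ h x) = (c : ℂ) • x ∧ 0 ≤ c * s := by
        intro s h hh
        induction hh using AddSubmonoid.closure_induction with
        | mem h hh =>
          obtain ⟨u, hu, d, hd, rfl⟩ := hh
          obtain ⟨c, hc, hc1, _⟩ := ih u hu
          refine ⟨d * c, ?_, ?_⟩
          · rw [map_smul, LinearMap.smul_apply, map_smul, hc, smul_smul, Complex.ofReal_mul]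
          · have h2 : 0 < parSign hB κ u.1 ^ 2 := by
              have := parSign_ne_zero hB κ u.1
              positivity
            have h3 := mul_nonneg hd hc1
            have h4 : d * parSign hB κ u.1 * s * (c * parSign hB κ u.1) =
              (d * c * s) * parSign hB κ u.1 ^ 2 := by ring
            rw [h4] at h3
            exact nonneg_of_mul_nonneg_left h3 h2
        | zero => exact ⟨0, by simp, by simp⟩
        | add a b _ _ ha hb =>
          obtain ⟨c, hc, hc1⟩ := ha
          obtain ⟨d, hd, hd1⟩ := hb
          exact ⟨c + d, by rw [map_add, LinearMap.add_apply, map_add, hc, hd, Complex.ofReal_add,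
            add_smul], by linarith⟩
      have hlen : len M ((l.map fun i : M => sM P i.2).prod : WM P M).1 = n := by
        refine le_antisymm ((len_prod_le l).trans hl'.le) ?_
        have h1 := len_refIdx_mul_le (P := P) (M := M)
          ((l.map fun i : M => sM P i.2).prod : WM P M).2 i.2
        rw [List.map_cons, List.prod_cons] at heq
        change len M (refIdx P i * _) = _ at heq
        rw [heq] at h1
        exact Nat.le_of_succ_le_succ h1
      have hfirst : tM P M κ (sM P i.2) * lowerTerm P κ M l (refIdx P i • v) ∈
          lowerCone P κ hB M n (parSign hB κ
            (((i :: l).map fun i : M => sM P i.2).prod : WM P M).1) := by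
        rw [← hl']
        refine sM_mul_lowerTerm_mem hB hκ hM i l _ (lowerTerm_mem hB hκ hM l _ fun l₁ j l₂ h => ?_)
        have h3 := hgood (i :: l₁) j l₂ (by rw [h]; rfl)
        rw [List.map_cons, List.prod_cons, Subgroup.coe_mul, mul_inv_rev, refIdx_inv,
          mul_smul] at h3
        exact h3
      obtain ⟨c, hc, hc1⟩ := hcone hfirst
      obtain ⟨d, hd, _, hd2⟩ := ih _ hlen.le
      have hd3 := hd2 hlen
      refine ⟨c + κ i * P.coroot' i v * d, ?_, ?_⟩
      · rw [pow_succ, Module.End.mul_apply, ← Module.End.mul_apply (ρ (aM P M κ (ofV v))),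
          ← map_mul ρ, ofV_mul_word, map_add ρ, LinearMap.add_apply, map_mul ρ, Module.End.mul_apply,
          hx _ (smul_mem_US (inv_mem (Subtype.mem _)) hv), map_zero, zero_add, lowerTerm, map_add ρ,
          LinearMap.add_apply, map_add, hc, map_smul ρ, LinearMap.smul_apply, map_smul, hd,
          smul_smul, ← add_smul]
        push_cast
        rfl
      · have hpos : 0 < (c + κ i * P.coroot' i v * d) * parSign hB κ
            (((i :: l).map fun i : M => sM P i.2).prod : WM P M).1 := by
          rw [add_mul]
          refine add_pos_of_nonneg_of_pos hc1 ?_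
          rw [List.map_cons, List.prod_cons, parSign_sM_mul hB hκ hM]
          have h4 := mul_pos (hreg i i.2) hd3
          split_ifs with h
          · nlinarith [mul_pos (neg_pos.mpr h) h4]
          · nlinarith [mul_pos ((not_lt.mp h).lt_of_ne (hκ0 i i.2).symm) h4]
        exact ⟨hpos.le, fun _ => hpos⟩

include hB in
theorem exists_regular (hM : M ⊆ B) : ∃ v ∈ US P M, ∀ j ∈ M, 0 < P.coroot' j v := by
  classical
  obtain ⟨ω, hω, hδ⟩ := exists_fund hB hM
  refine ⟨∑ j ∈ M, ω j, sum_mem hω, fun j hj => ?_⟩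
  rw [map_sum, Finset.sum_congr rfl fun i hi => hδ j hj i hi]
  simp [hj]

include hB in
/-- The translates of a weight vector whose weight vanishes on the roots are independent. -/
theorem linearIndependent_translates (hκ : InvPar P B κ) (hM : M ⊆ B) (hκ0 : ∀ i ∈ M, κ i ≠ 0)
    (ρ : HeckeM P M κ →ₐ[ℂ] Module.End ℂ X) {x : X} (hx0 : x ≠ 0)
    (hx : ∀ v ∈ US P M, ρ (aM P M κ (ofV v)) x = 0) :
    LinearIndependent ℂ fun w : WM P M => ρ (tM P M κ w) x := by
  classical
  have := Fintype.ofFinite (WM P M)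
  obtain ⟨v, hv, hreg⟩ := exists_regular hB hM
  rw [Fintype.linearIndependent_iff]
  intro c hc w
  -- Multiplying by `t` of `w₀ w⁻¹` carries the term of `w` to the longest element `w₀` and the
  -- others to shorter ones, which `ℓ(w₀)` applications of `v` annihilate.
  have h1 := congrArg (fun y => (ρ (aM P M κ (ofV v)) ^ (len M (longest hB hM)))
    (ρ (tM P M κ (wM hB hM * w⁻¹)) y)) hc
  simp only [map_sum, map_smul, map_zero, ← Module.End.mul_apply, ← map_mul ρ,
    ← map_mul (tM P M κ)] at h1
  rw [Finset.sum_eq_single w] at h1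
  · obtain ⟨d, hd, _, hd2⟩ := exists_pow_apply_eq hB hκ hM hκ0 ρ hx hv hreg
      (len M (longest hB hM)) (wM hB hM) le_rfl
    rw [inv_mul_cancel_right, Module.End.mul_apply, hd, smul_smul] at h1
    have h2 := (smul_eq_zero.mp h1).resolve_right hx0
    refine (mul_eq_zero.mp h2).resolve_right fun h => ?_
    have h3 := hd2 rfl
    rw [Complex.ofReal_eq_zero.mp h, zero_mul] at h3
    exact lt_irrefl _ h3
  · intro w' _ hne
    set u := wM hB hM * w⁻¹ * w' with hu
    have hlt : len M u.1 < len M (longest hB hM) := by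
      refine len_lt_longest hB hM u.2 fun h => hne ?_
      have h2 : u = wM hB hM := Subtype.ext h
      rw [hu, mul_assoc, mul_eq_left, inv_mul_eq_one] at h2
      exact h2.symm
    obtain ⟨n, hn⟩ := Nat.exists_eq_succ_of_ne_zero (Nat.ne_of_gt (Nat.zero_lt_of_lt hlt))
    rw [hn] at hlt ⊢
    obtain ⟨d, hd, _⟩ := exists_pow_apply_eq hB hκ hM hκ0 ρ hx hv hreg n u
      (Nat.lt_succ_iff.mp hlt)
    rw [pow_succ', Module.End.mul_apply, Module.End.mul_apply, hd, map_smul, hx v hv, smul_zero,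
      smul_zero]
  · intro h
    exact absurd (Finset.mem_univ _) h

variable {Y : Type u} [AddCommGroup Y] [Module ℂ Y]

include hB in
/-- Irreducible representations that share a weight vanishing on the roots are isomorphic. -/
theorem repIso_of_weight (hκ : InvPar P B κ) (hM : M ⊆ B) (hκ0 : ∀ i ∈ M, κ i ≠ 0)
    [FiniteDimensional ℂ X] [FiniteDimensional ℂ Y]
    {ρ : HeckeM P M κ →ₐ[ℂ] Module.End ℂ X} {ρ' : HeckeM P M κ →ₐ[ℂ] Module.End ℂ Y}
    (hρ : IsIrrRep ρ) (hρ' : IsIrrRep ρ') {χ : SymA V →ₐ[ℂ] ℂ}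
    (hχ : ∀ v ∈ US P M, χ (ofV v) = 0) (h : IsWt (ρ.comp (aM P M κ)) ⊤ χ)
    (h' : IsWt (ρ'.comp (aM P M κ)) ⊤ χ) : RepIso ρ ρ' := by
  classical
  have := Fintype.ofFinite (WM P M)
  obtain ⟨x, -, hx0, hx⟩ := h
  obtain ⟨y, -, hy0, hy⟩ := h'
  have hLx := linearIndependent_translates hB hκ hM hκ0 ρ hx0 fun v hv => by
    have := hx (ofV v)
    rwa [hχ v hv, zero_smul] at this
  have hLy := linearIndependent_translates hB hκ hM hκ0 ρ' hy0 fun v hv => by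
    have := hy (ofV v)
    rwa [hχ v hv, zero_smul] at this
  rw [Fintype.linearIndependent_iff] at hLx hLy
  -- Both modules share the weight, so `g` moves `x` and `y` by the same coefficients. By
  -- independence of translates, `g` kills `x` if and only if it kills `y`, and the submodule
  -- generated by `(x, y)` is a graph.
  have hexp : ∀ g, ∃ c : WM P M → ℂ, ρ g x = ∑ w, c w • ρ (tM P M κ w) x ∧
      ρ' g y = ∑ w, c w • ρ' (tM P M κ w) y := by
    intro g
    have h1 : g ∈ Submodule.span ℂ {h : HeckeM P M κ | ∃ w a, h = tM P M κ w * aM P M κ a} := by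
      rw [span_tM_mul_aM]
      trivial
    induction h1 using Submodule.span_induction with
    | mem g hg =>
      obtain ⟨w, a, rfl⟩ := hg
      have h2 : ρ (aM P M κ a) x = χ a • x := hx a
      have h3 : ρ' (aM P M κ a) y = χ a • y := hy a
      refine ⟨Pi.single w (χ a), ?_, ?_⟩
      · rw [map_mul, Module.End.mul_apply, h2, map_smul, Finset.sum_eq_single w, Pi.single_eq_same]
        · intro u _ hu
          rw [Pi.single_eq_of_ne hu, zero_smul]
        · exact fun h => absurd (Finset.mem_univ _) h
      · rw [map_mul, Module.End.mul_apply, h3, map_smul, Finset.sum_eq_single w, Pi.single_eq_same]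
        · intro u _ hu
          rw [Pi.single_eq_of_ne hu, zero_smul]
        · exact fun h => absurd (Finset.mem_univ _) h
    | zero => exact ⟨0, by simp, by simp⟩
    | add a b _ _ ha hb =>
      obtain ⟨c, hc, hc'⟩ := ha
      obtain ⟨d, hd, hd'⟩ := hb
      exact ⟨c + d, by simp [hc, hd, add_smul, Finset.sum_add_distrib],
        by simp [hc', hd', add_smul, Finset.sum_add_distrib]⟩
    | smul z a _ ha =>
      obtain ⟨c, hc, hc'⟩ := ha
      exact ⟨z • c, by simp [hc, Finset.smul_sum, mul_smul], by simp [hc', Finset.smul_sum, mul_smul]⟩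
  set T : Submodule ℂ (X × Y) :=
    LinearMap.range ((LinearMap.applyₗ (x, y)) ∘ₗ (prodRep ρ ρ').toLinearMap) with hT
  have hmem : ∀ p, p ∈ T ↔ ∃ g, (ρ g x, ρ' g y) = p := fun p => Iff.rfl
  refine repIso_of_prod hρ hρ' (T := T) ?_ hx0 hy0 ((hmem _).mpr ⟨1, by simp⟩) ?_ ?_
  · rintro g p hp
    rw [hmem] at hp ⊢
    obtain ⟨g', rfl⟩ := hp
    exact ⟨g * g', by simp [prodRep_apply]⟩
  · rw [hmem]
    rintro ⟨g, hg⟩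
    obtain ⟨c, hc, hc'⟩ := hexp g
    rw [Prod.mk.injEq, hc, hc'] at hg
    have h0 := hLy c hg.2
    simp [h0] at hg
    exact hx0 hg.symm
  · rw [hmem]
    rintro ⟨g, hg⟩
    obtain ⟨c, hc, hc'⟩ := hexp g
    rw [Prod.mk.injEq, hc, hc'] at hg
    have h0 := hLx c hg.1
    simp [h0] at hg
    exact hy0 hg.symm

end Chains

/-! ### Generalized weight spaces and the trace -/

section GeneralizedWeights

variable {X : Type*} [AddCommGroup X] [Module ℂ X] [FiniteDimensional ℂ X]
variable {A : Type*} [CommRing A] [Algebra ℂ A] (f : A →ₐ[ℂ] Module.End ℂ X)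

/-- The generalized weight space of a function. -/
def genWt (χ : A → ℂ) : Submodule ℂ X := ⨅ a, (f a).maxGenEigenspace (χ a)

theorem mapsTo_genWt (χ : A → ℂ) (a : A) : ∀ x ∈ genWt f χ, f a x ∈ genWt f χ := by
  intro x hx
  rw [genWt, Submodule.mem_iInf] at hx ⊢
  exact fun b => Module.End.mapsTo_maxGenEigenspace_of_comm
    (LinearMap.ext fun x => apply_comm f _ _ x) _ (hx b)

theorem exists_isWt_of_genWt {χ : A → ℂ} (h : genWt f χ ≠ ⊥) :
    ∃ χ' : A →ₐ[ℂ] ℂ, (χ' : A → ℂ) = χ ∧ IsWt f ⊤ χ' := by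
  obtain ⟨χ', x, hx, hx0, hχ⟩ := exists_isWt f (mapsTo_genWt f χ) h
  refine ⟨χ', funext fun a => ?_, x, trivial, hx0, hχ⟩
  rw [genWt, Submodule.mem_iInf] at hx
  exact eq_of_mem_maxGenEigenspace (hx a) hx0 (hχ a)

theorem mem_genWt_of_isWt {χ : A → ℂ} {x : X} (hx : ∀ a, f a x = χ a • x) : x ∈ genWt f χ := by
  rw [genWt, Submodule.mem_iInf]
  exact fun a => (Module.End.mem_maxGenEigenspace _ _ _).mpr ⟨1, by simp [hx]⟩

theorem genWt_ne_bot {χ : A →ₐ[ℂ] ℂ} (h : IsWt f ⊤ χ) : genWt f χ ≠ ⊥ := by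
  obtain ⟨x, -, hx0, hx⟩ := h
  exact fun h0 => hx0 ((Submodule.mem_bot ℂ).mp (h0 ▸ mem_genWt_of_isWt f hx))

/-- The operator minus its eigenvalue is nilpotent there, and nilpotent operators have trace zero.
-/
theorem trace_restrict_genWt (χ : A → ℂ) (a : A) :
    LinearMap.trace ℂ (genWt f χ) ((f a).restrict (mapsTo_genWt f χ a)) =
      Module.finrank ℂ (genWt f χ) * χ a := by
  set g := (f a).restrict (mapsTo_genWt f χ a) with hg
  have hnil : IsNilpotent (g - χ a • (1 : Module.End ℂ (genWt f χ))) := by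
    refine ⟨Module.finrank ℂ X, LinearMap.ext fun x => Subtype.ext ?_⟩
    have h1 : ∀ k (x : genWt f χ), (((g - χ a • (1 : Module.End ℂ (genWt f χ))) ^ k) x : X) =
        ((f a - χ a • (1 : Module.End ℂ X)) ^ k) x := by
      intro k
      induction k with
      | zero => exact fun x => rfl
      | succ k ih =>
        intro x
        rw [pow_succ, pow_succ, Module.End.mul_apply, Module.End.mul_apply, ih]
        rfl
    rw [h1]
    have h2 := x.2
    simp only [genWt, Submodule.mem_iInf] at h2
    have h3 := h2 a
    rw [Module.End.maxGenEigenspace_eq_genEigenspace_finrank,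
      Module.End.mem_genEigenspace_nat] at h3
    exact h3
  have h1 := (LinearMap.isNilpotent_trace_of_isNilpotent hnil).eq_zero
  rw [map_sub, map_smul, LinearMap.trace_one, smul_eq_mul, sub_eq_zero] at h1
  rw [h1, mul_comm]

/-- The trace is the weighted sum over a finite set of characters that contains all weights. -/
theorem trace_eq_sum_genWt (S : Finset (A →ₐ[ℂ] ℂ)) (hS : ∀ χ, IsWt f ⊤ χ → χ ∈ S) (a : A) :
    LinearMap.trace ℂ X (f a) = ∑ χ ∈ S, Module.finrank ℂ (genWt f χ) * χ a := by
  classical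
  have h1 := Module.End.independent_iInf_maxGenEigenspace_of_forall_mapsTo (fun a : A => f a)
    (fun a b φ => Module.End.mapsTo_maxGenEigenspace_of_comm
      (LinearMap.ext fun x => apply_comm f _ _ x) φ)
  have h2 := Module.End.iSup_iInf_maxGenEigenspace_eq_top_of_iSup_maxGenEigenspace_eq_top_of_commute
    (fun a : A => f a) (fun a b _ => LinearMap.ext fun x => apply_comm f _ _ x)
    (fun a => Module.End.iSup_maxGenEigenspace_eq_top (f a))
  have h3 : iSupIndep fun χ : A →ₐ[ℂ] ℂ => genWt f χ :=
    h1.comp (f := fun χ : A →ₐ[ℂ] ℂ => (χ : A → ℂ)) DFunLike.coe_injective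
  have h4 : ⨆ χ : A →ₐ[ℂ] ℂ, genWt f χ = ⊤ := by
    rw [eq_top_iff, ← h2]
    refine iSup_le fun χ => ?_
    by_cases h : genWt f χ = ⊥
    · exact h.le.trans bot_le
    · obtain ⟨χ', rfl, -⟩ := exists_isWt_of_genWt f h
      exact le_iSup (fun χ : A →ₐ[ℂ] ℂ => genWt f χ) χ'
  have h5 := DirectSum.isInternal_submodule_of_iSupIndep_of_iSup_eq_top h3 h4
  have hmem : ∀ χ : A →ₐ[ℂ] ℂ, genWt f χ ≠ ⊥ → χ ∈ S := fun χ h => by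
    obtain ⟨χ', h6, h7⟩ := exists_isWt_of_genWt f h
    rw [← DFunLike.coe_injective h6]
    exact hS χ' h7
  have hfin : {χ : A →ₐ[ℂ] ℂ | genWt f χ ≠ ⊥}.Finite := S.finite_toSet.subset hmem
  rw [LinearMap.trace_eq_sum_trace_restrict' h5 hfin fun χ => mapsTo_genWt f χ a]
  simp only [trace_restrict_genWt]
  refine Finset.sum_subset (fun χ hχ => hmem χ (hfin.mem_toFinset.mp hχ)) fun χ _ hχ => ?_
  have : genWt f χ = ⊥ := by
    by_contra h
    exact hχ (hfin.mem_toFinset.mpr h)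
  rw [this, finrank_bot, Nat.cast_zero, zero_mul]

end GeneralizedWeights

/-! ### A combination of irreducible characters that vanishes on `A` is zero -/

section Vanishing

variable {ι V V' : Type*} [AddCommGroup V] [Module ℝ V] [AddCommGroup V'] [Module ℝ V']
variable {P : RootPairing ι ℝ V V'} {κ : ι → ℝ} [Fintype ι] [P.IsReduced] {B : Finset ι}
variable (hB : IsSimpleRoots P B)

theorem comp_mem_span_irrChars {H K : Type*} [Ring H] [Algebra ℂ H] [Ring K] [Algebra ℂ K]
    (φ : K →ₐ[ℂ] H) {τ : H →ₗ[ℂ] ℂ} (hτ : τ ∈ Submodule.span ℂ (irrChars.{u} H)) :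
    τ ∘ₗ φ.toLinearMap ∈ Submodule.span ℂ (irrChars.{u} K) := by
  induction hτ using Submodule.span_induction with
  | mem τ h =>
    obtain ⟨X, _, _, _, ρ, -, rfl⟩ := h
    exact repChar_mem_span (ρ.comp φ)
  | zero => rw [LinearMap.zero_comp]; exact zero_mem _
  | add a b _ _ ha hb => rw [LinearMap.add_comp]; exact add_mem ha hb
  | smul c a _ ha => rw [LinearMap.smul_comp]; exact Submodule.smul_mem _ c ha

theorem exists_repr_of_mem_span {H : Type*} [Ring H] [Algebra ℂ H] {τ : H →ₗ[ℂ] ℂ}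
    (hτ : τ ∈ Submodule.span ℂ (irrChars.{u} H)) :
    ∃ (S : Finset (H →ₗ[ℂ] ℂ)) (c : (H →ₗ[ℂ] ℂ) → ℂ), (∀ f ∈ S, c f ≠ 0) ∧
      (∀ f ∈ S, f ∈ irrChars.{u} H) ∧ τ = ∑ f ∈ S, c f • f := by
  obtain ⟨c, hc, hsum⟩ := Submodule.mem_span_set.mp hτ
  exact ⟨c.support, c, fun f hf => Finsupp.mem_support_iff.mp hf, fun f hf => hc hf, hsum.symm⟩

include hB in
/-- Two weights of an irreducible representation that vanish on the roots coincide. -/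
theorem weight_unique {M : Finset ι} (hM : M ⊆ B) {X : Type u} [AddCommGroup X] [Module ℂ X]
    {ρ : HeckeM P M κ →ₐ[ℂ] Module.End ℂ X} (hρ : IsIrrRep ρ) {χ χ' : SymA V →ₐ[ℂ] ℂ}
    (h : IsWt (ρ.comp (aM P M κ)) ⊤ χ) (h' : IsWt (ρ.comp (aM P M κ)) ⊤ χ')
    (hχ : ∀ v ∈ US P M, χ (ofV v) = 0) (hχ' : ∀ v ∈ US P M, χ' (ofV v) = 0) : χ = χ' := by
  classical
  obtain ⟨ω, hω, hδ⟩ := exists_fund hB hM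
  refine symA_hom_ext fun v => ?_
  -- Split `v` into a part in the span of `M` and a part `v - u` orthogonal to it. The latter is
  -- central, so it acts by one scalar on the irreducible module, and the two weights agree on it.
  set u := ∑ j ∈ M, P.coroot' j v • ω j with hu
  have huU : u ∈ US P M := sum_mem fun j hj => Submodule.smul_mem _ _ (hω j hj)
  have hfix : ∀ j ∈ M, refl P j (ofV (v - u)) = ofV (v - u) := by
    intro i hi
    have h1 : P.coroot' i (v - u) = 0 := by
      rw [map_sub, hu, map_sum, Finset.sum_eq_single i]
      · rw [map_smul, hδ i hi i hi, if_pos rfl, smul_eq_mul, mul_one, sub_self]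
      · intro j hj hji
        rw [map_smul, hδ i hi j hj, if_neg (Ne.symm hji), smul_zero]
      · exact fun h => absurd hi h
    rw [refl_eq_actA, actA_ofV, refIdx_smul, h1, zero_smul, sub_zero]
  obtain ⟨x, -, hx0, hx⟩ := h
  obtain ⟨y, -, hy0, hy⟩ := h'
  have hE : (ρ (aM P M κ (ofV (v - u)))).eigenspace (χ (ofV (v - u))) = ⊤ := by
    refine (hρ.eq_bot_or_top _ fun g z hz => ?_).resolve_left fun h0 => ?_
    · rw [Module.End.mem_eigenspace_iff] at hz ⊢
      rw [← Module.End.mul_apply, ← map_mul, (commute_aM hfix g).eq, map_mul, Module.End.mul_apply,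
        hz, map_smul]
    · exact hx0 ((Submodule.mem_bot ℂ).mp (h0 ▸ Module.End.mem_eigenspace_iff.mpr (hx _)))
  have h1 : χ (ofV (v - u)) = χ' (ofV (v - u)) := by
    have h2 : y ∈ (ρ (aM P M κ (ofV (v - u)))).eigenspace (χ (ofV (v - u))) :=
      hE ▸ Submodule.mem_top
    have h3 : ρ (aM P M κ (ofV (v - u))) y = χ' (ofV (v - u)) • y := hy (ofV (v - u))
    rw [Module.End.mem_eigenspace_iff, h3] at h2
    exact (smul_left_injective ℂ hy0 h2).symm
  rwa [ofV_sub, map_sub, map_sub, hχ u huU, hχ' u huU, sub_zero, sub_zero] at h1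

include hB in
/-- A combination of irreducible characters of a parabolic graded Hecke algebra that vanishes on the
polynomial part vanishes. -/
theorem eq_zero_of_comp_aM (hκ : InvPar P B κ) (hκ0 : ∀ i ∈ B, κ i ≠ 0) {M : Finset ι} (hM : M ⊆ B)
    {τ : HeckeM P M κ →ₗ[ℂ] ℂ} (hτ : τ ∈ Submodule.span ℂ (irrChars.{u} (HeckeM P M κ)))
    (h0 : ∀ a, τ (aM P M κ a) = 0) : τ = 0 := by
  classical
  induction M using Finset.strongInduction with
  | H M ih =>
    have hpar : ∀ N (hN : N ⊆ M), N ≠ M → ∀ h : HeckeM P N κ, τ (incM hN h) = 0 := by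
      intro N hN hNM h
      have h1 := ih N (Finset.ssubset_iff_subset_ne.mpr ⟨hN, hNM⟩) (hN.trans hM)
        (comp_mem_span_irrChars (incM hN) hτ) (fun a => by
          rw [LinearMap.comp_apply, AlgHom.toLinearMap_apply, incM_aM, h0])
      exact LinearMap.congr_fun h1 h
    obtain ⟨S, c, hc, hirr, hsum⟩ := exists_repr_of_mem_span hτ
    have hex : ∀ f : S, ∃ (X : Type u) (_ : AddCommGroup X) (_ : Module ℂ X)
      (_ : FiniteDimensional ℂ X) (ρ : HeckeM P M κ →ₐ[ℂ] Module.End ℂ X),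
        IsIrrRep ρ ∧ repChar ρ = f := fun f => hirr f f.2
    choose X i1 i2 i3 ρ hρ hch using hex
    have hiso : ∀ f g, RepIso (ρ f) (ρ g) → f = g := fun f g h =>
      Subtype.ext (by rw [← hch f, ← hch g, h.repChar_eq])
    have hsum' : ∀ h, τ h = ∑ f : S, c f * repChar (ρ f) h := fun h => by
      rw [hsum, LinearMap.sum_apply, ← Finset.sum_coe_sort S]
      exact Finset.sum_congr rfl fun f _ => by rw [hch]; rfl
    have hvan : ∀ f χ, IsWt ((ρ f).comp (aM P M κ)) ⊤ χ → ∀ v ∈ US P M, χ (ofV v) = 0 := by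
      intro f χ hχ v hv
      -- The bound holds for `π` and `-π`. Real and imaginary parts then kill dominant vectors, and
      -- these span.
      have key : ∀ π : ℂ →ₗ[ℝ] ℝ, ∀ v ∈ US P M, Dominant P M v → π (χ (ofV v)) = 0 := by
        intro π v hv hd
        have h1 := fun π => weight_nonpos hB hM X ρ hρ hiso (fun f => c f) (fun f => hc f f.2)
          (fun N hN hNM h => by rw [← hsum', hpar N hN hNM]) π f hχ hv hd
        have h2 := h1 (-π)
        rw [LinearMap.neg_apply] at h2
        exact le_antisymm (h1 π) (by linarith)
      have key2 : ∀ v ∈ US P M, Dominant P M v → χ (ofV v) = 0 := fun v hv hd =>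
        Complex.ext (key Complex.reLm v hv hd) (key Complex.imLm v hv hd)
      obtain ⟨ω, hω, hδ⟩ := exists_fund hB hM
      rw [eq_sum_fund hB hω hδ hv, ofV_sum, map_sum]
      refine Finset.sum_eq_zero fun j hj => ?_
      rw [ofV_smul, map_smul, key2 _ (hω j hj), smul_zero]
      intro i hi
      rw [hδ i hi j hj]
      split_ifs <;> norm_num
    have hwt : ∀ f, ∃ χ, IsWt ((ρ f).comp (aM P M κ)) ⊤ χ := fun f => by
      have := (hρ f).nontrivial
      exact exists_isWt _ (fun _ _ _ => trivial) top_ne_bot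
    choose χ hχ using hwt
    have htr : ∀ f a, repChar (ρ f) (aM P M κ a) =
        Module.finrank ℂ (genWt ((ρ f).comp (aM P M κ)) (χ f)) * χ f a := by
      intro f a
      have h1 := trace_eq_sum_genWt ((ρ f).comp (aM P M κ)) {χ f} (fun χ' hχ' =>
        Finset.mem_singleton.mpr (weight_unique hB hM (hρ f) hχ' (hχ f) (hvan f _ hχ')
          (hvan f _ (hχ f)))) a
      rw [Finset.sum_singleton] at h1
      exact h1
    have hinj : Function.Injective χ := fun f g hfg => hiso f g
      (repIso_of_weight hB hκ hM (fun i hi => hκ0 i (hM hi)) (hρ f) (hρ g) (hvan f _ (hχ f)) (hχ f)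
        (hfg ▸ hχ g))
    -- Every module now contributes its dimension times a single character of `A`, and these
    -- characters are distinct, so Dedekind's lemma applies.
    have hLI := (linearIndependent_monoidHom (SymA V) ℂ).comp (fun f => (χ f : SymA V →* ℂ))
      (fun f g hfg => hinj (AlgHom.ext fun a => DFunLike.congr_fun hfg a))
    rw [Fintype.linearIndependent_iff] at hLI
    have hzero := hLI (fun f => c f * Module.finrank ℂ (genWt ((ρ f).comp (aM P M κ)) (χ f))) (by
      ext a
      rw [Finset.sum_apply, Pi.zero_apply, ← h0 a, hsum']
      refine Finset.sum_congr rfl fun f _ => ?_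
      rw [htr, ← mul_assoc]
      rfl)
    have hempty : IsEmpty S := ⟨fun f => by
      rcases mul_eq_zero.mp (hzero f) with h | h
      · exact hc f f.2 h
      · exact genWt_ne_bot _ (hχ f) (Submodule.finrank_eq_zero.mp (Nat.cast_eq_zero.mp h))⟩
    ext h
    rw [hsum', Finset.univ_eq_empty, Finset.sum_empty, LinearMap.zero_apply]

end Vanishing

/-! ### Irreducible representations are finite-dimensional -/

section FiniteDimensionality

/-- A finitely generated module over a commutative algebra of finite type has a proper stable
subspace of finite codimension. -/
theorem exists_finite_quotient {A : Type*} [CommRing A] [Algebra ℂ A] [Algebra.FiniteType ℂ A]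
    {X : Type*} [AddCommGroup X] [Module ℂ X] [Nontrivial X] (f : A →ₐ[ℂ] Module.End ℂ X)
    {s : Set X} (hs : s.Finite) (hspan : Submodule.span ℂ {y | ∃ a, ∃ x ∈ s, y = f a x} = ⊤) :
    ∃ N : Submodule ℂ X, N ≠ ⊤ ∧ (∀ a, ∀ x ∈ N, f a x ∈ N) ∧ FiniteDimensional ℂ (X ⧸ N) := by
  let _ : Module A X := Module.compHom X f.toRingHom
  have hsmul : ∀ (a : A) (x : X), a • x = f a x := fun _ _ => rfl
  have : IsScalarTower ℂ A X := ⟨fun c a x => by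
    rw [hsmul, hsmul, map_smul, LinearMap.smul_apply]⟩
  have hfin : Module.Finite A X := by
    refine ⟨Submodule.fg_def.mpr ⟨s, hs, ?_⟩⟩
    rw [eq_top_iff]
    intro x _
    have hx : x ∈ Submodule.span ℂ {y | ∃ a, ∃ x ∈ s, y = f a x} := hspan ▸ Submodule.mem_top
    have h1 : Submodule.span ℂ {y | ∃ a, ∃ x ∈ s, y = f a x} ≤
        (Submodule.span A s).restrictScalars ℂ := by
      refine Submodule.span_le.mpr ?_
      rintro _ ⟨a, x, hx, rfl⟩
      exact Submodule.smul_mem (Submodule.span A s) a (Submodule.subset_span hx)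
    exact h1 hx
  -- The quotient by a maximal submodule is a residue field of `A`, finite over `ℂ` by the
  -- Nullstellensatz.
  obtain ⟨N, hN⟩ := IsCoatomic.exists_coatom (Submodule A X)
  obtain ⟨I, hI, ⟨e⟩⟩ := isSimpleModule_iff_quot_maximal.mp (isSimpleModule_iff_isCoatom.mpr hN)
  let _ := Ideal.Quotient.field I
  have h1 : Algebra.FiniteType ℂ (A ⧸ I) :=
    Algebra.FiniteType.of_surjective (Ideal.Quotient.mkₐ ℂ I) (Ideal.Quotient.mkₐ_surjective ℂ I)
  have h2 : Module.Finite ℂ (A ⧸ I) := finite_of_finite_type_of_isJacobsonRing ℂ (A ⧸ I)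
  have h3 : Module.Finite ℂ (X ⧸ N) := Module.Finite.equiv (e.restrictScalars ℂ).symm
  refine ⟨N.restrictScalars ℂ, fun h => hN.1 ?_, fun a x hx => N.smul_mem a hx, h3⟩
  rw [eq_top_iff]
  intro x _
  have : x ∈ N.restrictScalars ℂ := h ▸ Submodule.mem_top
  exact this

variable {ι V V' : Type*} [AddCommGroup V] [Module ℝ V] [AddCommGroup V'] [Module ℝ V']
variable {P : RootPairing ι ℝ V V'} {κ : ι → ℝ}

theorem finiteType_symA [FiniteDimensional ℝ V] : Algebra.FiniteType ℂ (SymA V) := by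
  refine ⟨Subalgebra.fg_def.mpr ⟨Set.range fun i => ofV (Module.finBasis ℝ V i),
    Set.finite_range _, ?_⟩⟩
  rw [eq_top_iff, ← adjoin_ofV]
  refine Algebra.adjoin_le ?_
  rintro _ ⟨v, rfl⟩
  rw [← (Module.finBasis ℝ V).sum_repr v, ofV_sum]
  refine sum_mem fun i _ => ?_
  rw [ofV_smul]
  exact Subalgebra.smul_mem _ (Algebra.subset_adjoin (Set.mem_range_self i)) _

/-- The algebra is spanned by the products `a t_w`. -/
theorem span_aM_mul_tM {M : Finset ι} :
    Submodule.span ℂ {h : HeckeM P M κ | ∃ a w, h = aM P M κ a * tM P M κ w} = ⊤ := by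
  set S := Submodule.span ℂ {h : HeckeM P M κ | ∃ a w, h = aM P M κ a * tM P M κ w} with hS
  have hmem : ∀ a w, aM P M κ a * tM P M κ w ∈ S := fun a w => Submodule.subset_span ⟨a, w, rfl⟩
  have hs : ∀ i (hi : i ∈ M), ∀ h ∈ S, tM P M κ (sM P hi) * h ∈ S := by
    intro i hi h hh
    induction hh using Submodule.span_induction with
    | mem x hx =>
      obtain ⟨a, w, rfl⟩ := hx
      have h1 := aM_mul_tM_sM (P := P) (κ := κ) hi (refl P i a)
      have h2 : refl P i (refl P i a) = a := by
        rw [refl_eq_actA, ← actA_mul, refIdx_mul_self, actA_one]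
      rw [h2, ← sub_eq_iff_eq_add] at h1
      rw [← mul_assoc, ← h1, sub_mul, mul_assoc, ← map_mul (tM P M κ), smul_mul_assoc]
      exact sub_mem (hmem _ _) (Submodule.smul_mem _ _ (hmem _ _))
    | zero => rw [mul_zero]; exact zero_mem _
    | add x y _ _ hx hy => rw [mul_add]; exact add_mem hx hy
    | smul c x _ hx => rw [mul_smul_comm]; exact Submodule.smul_mem _ _ hx
  have hta : ∀ (w : WM P M) a, tM P M κ w * aM P M κ a ∈ S := by
    rintro ⟨w, hw⟩ a
    induction hw using WM_induction with
    | one =>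
      have h1 := hmem a 1
      rw [map_one, mul_one] at h1
      have : (⟨1, one_mem _⟩ : WM P M) = 1 := rfl
      rwa [this, map_one, one_mul]
    | mul i hi w hw ih =>
      have : (⟨refIdx P i * w, mul_mem (refIdx_mem hi) hw⟩ : WM P M) = sM P hi * ⟨w, hw⟩ := rfl
      rw [this, map_mul, mul_assoc]
      exact hs i hi _ ih
  rw [eq_top_iff, ← span_tM_mul_aM]
  refine Submodule.span_le.mpr ?_
  rintro _ ⟨w, a, rfl⟩
  exact hta w a

/-- Irreducible representations are finite-dimensional. -/
theorem IsIrrRep.finiteDimensional [Finite ι] [FiniteDimensional ℝ V] {M : Finset ι} {X : Type u}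
    [AddCommGroup X] [Module ℂ X] {ρ : HeckeM P M κ →ₐ[ℂ] Module.End ℂ X} (hρ : IsIrrRep ρ) :
    FiniteDimensional ℂ X := by
  have := hρ.nontrivial
  have := finiteType_symA (V := V)
  obtain ⟨x, hx⟩ := exists_ne (0 : X)
  have hcyc : ∀ y, ∃ h, ρ h x = y := by
    have h1 : LinearMap.range (LinearMap.applyₗ x ∘ₗ ρ.toLinearMap) = ⊤ := by
      refine (hρ.eq_bot_or_top _ ?_).resolve_left fun h => hx ?_
      · rintro g _ ⟨h, rfl⟩
        exact ⟨g * h, by simp⟩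
      · have h2 : x ∈ LinearMap.range (LinearMap.applyₗ x ∘ₗ ρ.toLinearMap) := ⟨1, by simp⟩
        rwa [h, Submodule.mem_bot] at h2
    intro y
    have h2 : y ∈ LinearMap.range (LinearMap.applyₗ x ∘ₗ ρ.toLinearMap) := h1 ▸ Submodule.mem_top
    exact h2
  have hspan : Submodule.span ℂ {y | ∃ a, ∃ z ∈ Set.range (fun w => ρ (tM P M κ w) x),
      y = ρ.comp (aM P M κ) a z} = ⊤ := by
    rw [eq_top_iff]
    intro y _
    obtain ⟨h, rfl⟩ := hcyc y
    have h1 : h ∈ Submodule.span ℂ {h : HeckeM P M κ | ∃ a w, h = aM P M κ a * tM P M κ w} := by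
      rw [span_aM_mul_tM]
      trivial
    induction h1 using Submodule.span_induction with
    | mem h hh =>
      obtain ⟨a, w, rfl⟩ := hh
      exact Submodule.subset_span ⟨a, _, ⟨w, rfl⟩, by rw [map_mul]; rfl⟩
    | zero => rw [map_zero]; exact zero_mem _
    | add a b _ _ ha hb => rw [map_add]; exact add_mem (ha trivial) (hb trivial)
    | smul c a _ ha => rw [map_smul]; exact Submodule.smul_mem _ c (ha trivial)
  obtain ⟨N, hN, hNa, hNfin⟩ := exists_finite_quotient (ρ.comp (aM P M κ)) (Set.finite_range _) hspan
  -- The largest stable subspace inside `N`, hence zero. As `N` is stable under `A` and the products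
  -- `a t_w` span, membership is tested by the finitely many `t_w`, so `X` embeds into a finite
  -- power of `X / N`.
  let K : Submodule ℂ X :=
    { carrier := {y | ∀ h, ρ h y ∈ N}
      zero_mem' := fun h => by rw [map_zero]; exact zero_mem N
      add_mem' := fun ha hb h => by rw [map_add]; exact add_mem (ha h) (hb h)
      smul_mem' := fun c a ha h => by rw [map_smul]; exact N.smul_mem c (ha h) }
  have hK : K = ⊥ := by
    refine (hρ.eq_bot_or_top K fun g y hy h => ?_).resolve_right fun h => hN ?_
    · rw [← Module.End.mul_apply, ← map_mul]
      exact hy (h * g)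
    · rw [eq_top_iff]
      intro y _
      have h1 : y ∈ K := h ▸ Submodule.mem_top
      have h2 := h1 1
      rwa [map_one] at h2
  refine Module.Finite.of_injective (LinearMap.pi fun w : WM P M => N.mkQ ∘ₗ ρ (tM P M κ w)) ?_
  rw [← LinearMap.ker_eq_bot, ← le_bot_iff, ← hK]
  intro y hy h
  have hyw : ∀ w, ρ (tM P M κ w) y ∈ N := fun w => by
    have := congrFun (LinearMap.mem_ker.mp hy) w
    exact (Submodule.Quotient.mk_eq_zero N).mp this
  have h1 : h ∈ Submodule.span ℂ {h : HeckeM P M κ | ∃ a w, h = aM P M κ a * tM P M κ w} := by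
    rw [span_aM_mul_tM]
    trivial
  induction h1 using Submodule.span_induction with
  | mem h hh =>
    obtain ⟨a, w, rfl⟩ := hh
    rw [map_mul, Module.End.mul_apply]
    exact hNa a _ (hyw w)
  | zero => rw [map_zero]; exact zero_mem _
  | add a b _ _ ha hb => rw [map_add]; exact add_mem ha hb
  | smul c a _ ha => rw [map_smul]; exact Submodule.smul_mem _ c ha

end FiniteDimensionality

/-! ### The given graded Hecke algebra as a quotient of `H_B` -/

section Comparison

variable {ι V V' : Type*} [AddCommGroup V] [Module ℝ V] [AddCommGroup V'] [Module ℝ V']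
variable (P : RootPairing ι ℝ V V') (B : Finset ι) (k : B → ℝ)

open Classical in
/-- The extension by zero of a parameter function. -/
def extPar (i : ι) : ℝ := if h : i ∈ B then k ⟨i, h⟩ else 0

theorem extPar_of_mem {i : ι} (h : i ∈ B) : extPar B k i = k ⟨i, h⟩ := dif_pos h

/-- The homomorphism to the graded Hecke algebra. -/
def toGradedHecke : HeckeM P B (extPar B k) →ₐ[ℂ] GradedHecke P B k :=
  liftM ((t P B k).comp (WM P B).subtype) (ofA P B k) fun i hi a => by
    rw [extPar_of_mem B k hi]
    exact ofA_mul_t P B k ⟨i, hi⟩ a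

theorem toGradedHecke_aM (a : SymA V) : toGradedHecke P B k (aM P B _ a) = ofA P B k a :=
  liftM_aM _ _ _ a

/-- The simple reflections generate the whole Weyl group. Surjectivity suffices to carry
irreducibility and isomorphisms between the two algebras. -/
theorem toGradedHecke_surjective [Fintype ι] [P.IsReduced] (hB : IsSimpleRoots P B) :
    Function.Surjective (toGradedHecke P B k) := by
  intro h
  obtain ⟨x, rfl⟩ := RingQuot.mkAlgHom_surjective ℂ (Rel P B k) h
  change mk P B k x ∈ (toGradedHecke P B k).range
  induction x using FreeAlgebra.induction with
  | grade0 r => rw [AlgHom.commutes]; exact Subalgebra.algebraMap_mem _ r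
  | grade1 x =>
    rcases x with w | a
    · exact ⟨tM P B _ ⟨w, WM_eq_top hB ▸ Subgroup.mem_top w⟩, liftM_tM _ _ _ _⟩
    · exact ⟨aM P B _ a, liftM_aM _ _ _ a⟩
  | mul a b ha hb => rw [map_mul]; exact mul_mem ha hb
  | add a b ha hb => rw [map_add]; exact add_mem ha hb

/-- The perfect pairing represents the real and imaginary parts of the character on `V`. So a sum
over weights is a sum over points `λ`. -/
theorem exists_evalA_eq (χ : SymA V →ₐ[ℂ] ℂ) : ∃ lam : ℂ ⊗[ℝ] V', evalA P lam = χ := by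
  set g : V →ₗ[ℝ] ℂ := χ.toLinearMap.restrictScalars ℝ ∘ₗ ofVL with hg
  have hex : ∀ d : Module.Dual ℝ V, ∃ u : V', ∀ v, P.toLinearMap v u = d v := fun d =>
    ⟨P.toLinearMap.flip.toPerfPair.symm d, fun v =>
      LinearMap.congr_fun (P.toLinearMap.flip.apply_symm_toPerfPair_self d) v⟩
  obtain ⟨u, hu⟩ := hex (Complex.reLm ∘ₗ g)
  obtain ⟨u', hu'⟩ := hex (Complex.imLm ∘ₗ g)
  refine ⟨1 ⊗ₜ u + Complex.I ⊗ₜ u', symA_hom_ext fun v => ?_⟩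
  rw [evalA, ofV, SymmetricAlgebra.lift_ι_apply, map_add, LinearMap.add_apply, pairC_tmul,
    pairC_tmul, hu, hu']
  change _ = g v
  rw [one_mul, one_mul, mul_one, mul_comm]
  exact Complex.re_add_im (g v)

variable (X : Type u) [AddCommGroup X] [Module ℂ X] [Module (GradedHecke P B k) X]
  [IsScalarTower ℂ (GradedHecke P B k) X]

/-- The representation of the algebra on a module of the graded Hecke algebra. -/
def modRep : HeckeM P B (extPar B k) →ₐ[ℂ] Module.End ℂ X :=
  (Algebra.lsmul ℂ ℂ X).comp (toGradedHecke P B k)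

theorem weightSpace_eq_genWt (lam : ℂ ⊗[ℝ] V') :
    weightSpace P B k X lam = genWt ((modRep P B k X).comp (aM P B _)) (evalA P lam) := by
  refine iInf_congr fun a => ?_
  rw [AlgHom.comp_apply, modRep, AlgHom.comp_apply, toGradedHecke_aM]

theorem finrank_weightSpace (lam : ℂ ⊗[ℝ] V') :
    Module.finrank ℂ (weightSpace P B k X lam) =
      Module.finrank ℂ (genWt ((modRep P B k X).comp (aM P B _)) (evalA P lam)) := by
  rw [weightSpace_eq_genWt]

variable {P B k X} in
theorem isIrrRep_modRep [Fintype ι] [P.IsReduced] (hB : IsSimpleRoots P B)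
    [IsSimpleModule (GradedHecke P B k) X] : IsIrrRep (modRep P B k X) := by
  refine ⟨IsSimpleModule.nontrivial (GradedHecke P B k) X, fun U hU => ?_⟩
  let U' : Submodule (GradedHecke P B k) X :=
    { U with
      smul_mem' := fun g x hx => by
        obtain ⟨h, rfl⟩ := toGradedHecke_surjective P B k hB g
        exact hU h x hx }
  rcases eq_bot_or_eq_top U' with h | h
  · refine Or.inl (eq_bot_iff.mpr fun x hx => ?_)
    have h1 : x ∈ U' := hx
    rw [h] at h1
    exact h1
  · refine Or.inr (eq_top_iff.mpr fun x _ => ?_)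
    have h1 : x ∈ U' := h ▸ Submodule.mem_top
    exact h1

variable {P B k X} in
theorem nonempty_linearEquiv_of_repIso [Fintype ι] [P.IsReduced] (hB : IsSimpleRoots P B)
    {Y : Type u} [AddCommGroup Y] [Module ℂ Y] [Module (GradedHecke P B k) Y]
    [IsScalarTower ℂ (GradedHecke P B k) Y] (h : RepIso (modRep P B k X) (modRep P B k Y)) :
    Nonempty (X ≃ₗ[GradedHecke P B k] Y) := by
  obtain ⟨e, he⟩ := h
  exact ⟨{ e with
    map_smul' := fun g x => by
      obtain ⟨h, rfl⟩ := toGradedHecke_surjective P B k hB g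
      exact he h x }⟩

end Comparison

end GradedHecke

end

/-! ### Linear independence of the `A`-characters -/

theorem theoremt {ι V V' : Type*} [AddCommGroup V] [Module ℝ V] [FiniteDimensional ℝ V]
    [AddCommGroup V'] [Module ℝ V'] [FiniteDimensional ℝ V'] [Finite ι]
    (P : RootPairing ι ℝ V V') [P.IsReduced]
    (B : Finset ι) (hB : GradedHecke.IsSimpleRoots P B)
    (k : B → ℝ) (hk : GradedHecke.IsInvariantParameter P B k) (hk0 : ∀ i, k i ≠ 0)
    {J : Type*} (X : J → Type*) [∀ j, AddCommGroup (X j)] [∀ j, Module ℂ (X j)]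
    [∀ j, Module (GradedHecke P B k) (X j)] [∀ j, IsScalarTower ℂ (GradedHecke P B k) (X j)]
    (hsimple : ∀ j, IsSimpleModule (GradedHecke P B k) (X j))
    (hiso : ∀ i j, Nonempty (X i ≃ₗ[GradedHecke P B k] X j) → i = j) :
    LinearIndependent ℤ (fun j => GradedHecke.character P B k (X j)) := by
  classical
  have := Fintype.ofFinite ι
  have hirr : ∀ j, GradedHecke.IsIrrRep (GradedHecke.modRep P B k (X j)) := fun j =>
    GradedHecke.isIrrRep_modRep hB
  have hfd : ∀ j, FiniteDimensional ℂ (X j) := fun j => (hirr j).finiteDimensional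
  have hκ : GradedHecke.InvPar P B (GradedHecke.extPar B k) := fun i hi j hj h => by
    rw [GradedHecke.extPar_of_mem B k hi, GradedHecke.extPar_of_mem B k hj]
    exact hk ⟨i, hi⟩ ⟨j, hj⟩ h
  have hκ0 : ∀ i ∈ B, GradedHecke.extPar B k i ≠ 0 := fun i hi => by
    rw [GradedHecke.extPar_of_mem B k hi]
    exact hk0 _
  rw [linearIndependent_iff']
  intro s g hg
  set τ := ∑ j ∈ s, (g j : ℂ) • GradedHecke.repChar (GradedHecke.modRep P B k (X j)) with hτ
  have hfin : (⋃ j ∈ s, {χ | GradedHecke.IsWt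
      ((GradedHecke.modRep P B k (X j)).comp (GradedHecke.aM P B _)) ⊤ χ}).Finite :=
    s.finite_toSet.biUnion fun j _ => GradedHecke.finite_isWt _ _
  have hτ0 : τ = 0 := by
    refine GradedHecke.eq_zero_of_comp_aM hB hκ hκ0 subset_rfl
      (sum_mem fun j _ => Submodule.smul_mem _ _ (GradedHecke.repChar_mem_span _)) fun a => ?_
    rw [hτ, LinearMap.sum_apply]
    have h1 : ∀ j ∈ s, ((g j : ℂ) • GradedHecke.repChar (GradedHecke.modRep P B k (X j)))
        (GradedHecke.aM P B _ a) = ∑ χ ∈ hfin.toFinset, (g j : ℂ) * (Module.finrank ℂ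
          (GradedHecke.genWt ((GradedHecke.modRep P B k (X j)).comp (GradedHecke.aM P B _)) χ) *
            χ a) := by
      intro j hj
      rw [LinearMap.smul_apply, smul_eq_mul, ← Finset.mul_sum,
        ← GradedHecke.trace_eq_sum_genWt _ hfin.toFinset fun χ hχ =>
          hfin.mem_toFinset.mpr (Set.mem_biUnion hj hχ)]
      rfl
    -- Grouping by weights, the coefficient of each `χ` is the given relation evaluated at the point
    -- `λ` that represents `χ`.
    rw [Finset.sum_congr rfl h1, Finset.sum_comm]
    refine Finset.sum_eq_zero fun χ _ => ?_
    obtain ⟨lam, rfl⟩ := GradedHecke.exists_evalA_eq P χ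
    have h2 := congrFun hg lam
    rw [Finset.sum_apply, Pi.zero_apply] at h2
    simp only [Pi.smul_apply, GradedHecke.character, GradedHecke.finrank_weightSpace,
      smul_eq_mul] at h2
    simp only [← mul_assoc, ← Finset.sum_mul]
    have h3 := congrArg (fun n : ℤ => (n : ℂ)) h2
    push_cast at h3
    rw [h3, zero_mul]
  have hLI := GradedHecke.linearIndependent_repChar X (fun j => GradedHecke.modRep P B k (X j))
    hirr fun i j h => hiso i j (GradedHecke.nonempty_linearEquiv_of_repIso hB h)
  intro j hj
  exact Int.cast_eq_zero.mp (linearIndependent_iff'.mp hLI s (fun j => (g j : ℂ)) hτ0 j hj)
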